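/- **Theorem 1.2.** Let $N\ge 1$ be an integer, $0<s<1$, $0<\beta<N$ and $N-\beta\le 2s$. Let $G:[0,\infty)\to[0,\infty)$ be differentiable with $G(0)=0$, and suppose: * ($\mathcal A_0$) there are $\mu\in\left[2,\,1+\frac{2s+\beta}{N}\right)$ and $\eta>0$ such that $G(\psi)\le\eta(\psi^2+\psi^\mu)$ and $|G'(\psi)|\le\eta(\psi+\psi^{\mu-1})$ for all $\psi\ge 0$; * ($\mathcal A_1$) there are $0<\alpha<1+\frac{2s+\beta}{N}$, $\eta>0$ and $\delta>0$ such that $G(\psi)\ge\eta\psi^\alpha$ for all $0<\psi<\delta$; and $G(\theta\psi)\ge\theta^{1+\frac{2s+\beta}{2N}}G(\psi)$ for all $\theta\ge 1$ and $\psi\ge 0$. Let $H^s=H^s(\mathbb R^N)$ be the space of (real- or complex-valued) $u\in L^2(\mathbb R^N)$ with $\|\nabla_s u\|_2:=\|(-\Delta)^{s/2}u\|_2<\infty$, where $(-\Delta)^{s/2}$ is the Fourier multiplier with symbol $|\xi|^s$, normed by $\|u\|_{H^s}^2=\|u\|_2^2+\|\nabla_s u\|_2^2$. For $u\in H^s$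 put $$\mathcal E(u)=\frac12\|\nabla_s u\|_2^2-\frac12\int_{\mathbb R^N\times\mathbb R^N}\frac{G(|u(x)|)\,G(|u(y)|)}{|x-y|^{N-\beta}}\,dx\,dy ,\qquad \mathcal I_\lambda=\inf\left\{\mathcal E(u): u\in H^s,\ \|u\|_2^2=\lambda\right\}.$$ Then for every $\lambda>0$ the infimum $\mathcal I_\lambda$ is finite and attained: there is $u_\lambda\in H^s$ with $\|u_\lambda\|_2^2=\lambda$ and $\mathcal E(u_\lambda)=\mathcal I_\lambda$. Moreover, every minimizing sequence is relatively compact in $H^s$ up to translations: if $u_n\in H^s$, $\|u_n\|_2^2=\lambda$ and $\mathcal E(u_n)\to\mathcal I_\lambda$, then there are $y_n\in\mathbb R^N$ such that every subsequence of $\left(u_n(\cdot+y_n)\right)_n$ has a further subsequence that converges in $H^s$, and its limit is a minimizer of $\mathcal I_\lambda$. -/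

import Mathlib

open MeasureTheory Filter Topology
open scoped ENNReal FourierTransform

noncomputable section

namespace FracHartree

/-- The Euclidean space `ℝ^N`. -/
abbrev Rn (N : ℕ) : Type := EuclideanSpace ℝ (Fin N)

/-- The space `L²(ℝ^N)` of `𝕜`-valued functions, where `𝕜` is `ℝ` or `ℂ`. -/
abbrev L2 (𝕜 : Type) [RCLike 𝕜] (N : ℕ) : Type := Lp (α := Rn N) 𝕜 2 volume

/-- The complex-valued function underlying `u` (the identity for `𝕜 = ℂ`, the inclusion
`ℝ ⊆ ℂ` for `𝕜 = ℝ`). -/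
def complexify {𝕜 : Type} [RCLike 𝕜] {N : ℕ} (u : L2 𝕜 N) : L2 ℂ N :=
  (RCLike.map 𝕜 ℂ).compLp u

/-- The kinetic term `‖∇_s u‖₂² = ‖(-Δ)^{s/2} u‖₂² ∈ [0, ∞]`. Since `𝓕` is the Fourier-Plancherel
transform with kernel `exp (-2 π i x · ξ)`, the symbol of `(-Δ)^s` is `(2 π |ξ|)^{2s}`. -/
def kinetic {𝕜 : Type} [RCLike 𝕜] {N : ℕ} (s : ℝ) (u : L2 𝕜 N) : ℝ≥0∞ :=
  ∫⁻ ξ : Rn N, ENNReal.ofReal ((2 * Real.pi * ‖ξ‖) ^ (2 * s)) *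
    ‖(𝓕 (complexify u) : L2 ℂ N) ξ‖ₑ ^ 2

/-- The fractional Sobolev space `H^s(ℝ^N)`, as a subset of `L²(ℝ^N)`. -/
def Hs (𝕜 : Type) [RCLike 𝕜] (N : ℕ) (s : ℝ) : Set (L2 𝕜 N) :=
  {u | kinetic s u < ∞}

/-- The squared `H^s` norm `‖u‖₂² + ‖∇_s u‖₂²`. -/
def hsNormSq {𝕜 : Type} [RCLike 𝕜] {N : ℕ} (s : ℝ) (u : L2 𝕜 N) : ℝ≥0∞ :=
  ‖u‖ₑ ^ 2 + kinetic s u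

/-- The Hartree term
`D(G(|u|), G(|u|)) = ∬ G(|u(x)|) |x - y|^{β - N} G(|u(y)|) dx dy ∈ [0, ∞]`. -/
def hartree {𝕜 : Type} [RCLike 𝕜] {N : ℕ} (β : ℝ) (G : ℝ → ℝ) (u : L2 𝕜 N) : ℝ≥0∞ :=
  ∫⁻ x : Rn N, ∫⁻ y : Rn N,
    ENNReal.ofReal (G ‖u x‖ * ‖x - y‖ ^ (β - (N : ℝ)) * G ‖u y‖)

/-- The energy `E(u) = ½ ‖∇_s u‖₂² - ½ D(G(|u|), G(|u|))`, for `u ∈ H^s`. -/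
def energy {𝕜 : Type} [RCLike 𝕜] {N : ℕ} (s β : ℝ) (G : ℝ → ℝ) (u : L2 𝕜 N) : EReal :=
  ((kinetic s u / 2 : ℝ≥0∞) : EReal) - ((hartree β G u / 2 : ℝ≥0∞) : EReal)

/-- The constraint set `{u ∈ H^s : ‖u‖₂² = lam}`. -/
def admissible (𝕜 : Type) [RCLike 𝕜] (N : ℕ) (s lam : ℝ) : Set (L2 𝕜 N) :=
  {u | u ∈ Hs 𝕜 N s ∧ ‖u‖ ^ 2 = lam}

/-- `I_lam = inf {E(u) : u ∈ H^s, ‖u‖₂² = lam}`, an infimum in `[-∞, ∞]`. -/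
def groundEnergy (𝕜 : Type) [RCLike 𝕜] (N : ℕ) (s β : ℝ) (G : ℝ → ℝ) (lam : ℝ) : EReal :=
  ⨅ u ∈ admissible 𝕜 N s lam, energy s β G u

/-- `u` is a minimizer of the constrained problem. -/
def IsMinimizer {𝕜 : Type} [RCLike 𝕜] {N : ℕ} (s β : ℝ) (G : ℝ → ℝ) (lam : ℝ)
    (u : L2 𝕜 N) : Prop :=
  u ∈ admissible 𝕜 N s lam ∧ energy s β G u = groundEnergy 𝕜 N s β G lam

/-- `(u_n)` is a minimizing sequence of the constrained problem. -/
def IsMinimizingSeq {𝕜 : Type} [RCLike 𝕜] {N : ℕ} (s β : ℝ) (G : ℝ → ℝ) (lam : ℝ)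
    (u : ℕ → L2 𝕜 N) : Prop :=
  (∀ n, u n ∈ admissible 𝕜 N s lam) ∧
    Tendsto (fun n => energy s β G (u n)) atTop (𝓝 (groundEnergy 𝕜 N s β G lam))

/-- The translate `x ↦ u (x + y)`. -/
def translate {𝕜 : Type} [RCLike 𝕜] {N : ℕ} (y : Rn N) (u : L2 𝕜 N) : L2 𝕜 N :=
  Lp.compMeasurePreserving (fun x : Rn N => x + y) (measurePreserving_add_right volume y) u

/-- `w_n → w` in `H^s`. -/
def TendstoHs {𝕜 : Type} [RCLike 𝕜] {N : ℕ} (s : ℝ) (w : ℕ → L2 𝕜 N) (w₀ : L2 𝕜 N) : Prop :=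
  Tendsto (fun n => hsNormSq s (w n - w₀)) atTop (𝓝 0)

/-- The standing assumptions on `G : [0, ∞) → [0, ∞)` (the values of `G` on the negative
half-line are irrelevant) together with the growth condition `A₀`. -/
structure AssumptionA0 (N : ℕ) (s β : ℝ) (G : ℝ → ℝ) : Prop where
  nonneg : ∀ t, 0 ≤ t → 0 ≤ G t
  differentiable : DifferentiableOn ℝ G (Set.Ici 0)
  map_zero : G 0 = 0
  growth : ∃ μ : ℝ, 2 ≤ μ ∧ μ < 1 + (2 * s + β) / N ∧ ∃ η : ℝ, 0 < η ∧ ∀ t, 0 ≤ t →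
    G t ≤ η * (t ^ 2 + t ^ μ) ∧ |derivWithin G (Set.Ici 0) t| ≤ η * (t + t ^ (μ - 1))

/-- The condition `A₁`: a lower bound near `0` and a superhomogeneity condition. -/
structure AssumptionA1 (N : ℕ) (s β : ℝ) (G : ℝ → ℝ) : Prop where
  lower : ∃ α : ℝ, 0 < α ∧ α < 1 + (2 * s + β) / N ∧ ∃ η : ℝ, 0 < η ∧ ∃ δ : ℝ, 0 < δ ∧
    ∀ t, 0 < t → t < δ → η * t ^ α ≤ G t
  scaling : ∀ θ t : ℝ, 1 ≤ θ → 0 ≤ t → θ ^ (1 + (2 * s + β) / (2 * N)) * G t ≤ G (θ * t)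

end FracHartree

end

/-! The theorem is a concentration-compactness argument in which Fourier cut-offs detect where mass
concentrates. Write K for the kinetic term, D for the Hartree term, I for the infimum at mass λ.

Coercivity: D is a bilinear form in the density G(|u|), bounded on L¹ ∩ L^r by Young's inequality
once the kernel is cut at a finite radius (`form_le`). The upper bound on μ leaves an open interval
of admissible r, and for these a Gagliardo–Nirenberg inequality bounds the density by (1 + K)^κ with
κ < 1/2. Hence D is sublinear in K at fixed mass (`exists_hartree_le`), so the infimum is finite and
minimizing sequences are bounded in H^s (`exists_kinetic_le`).

Negativity: wide Gaussians of mass λ and width b^(-1/2) have K = O(b^s), whereas the lower bound on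
G near 0 gives D ≥ C b^q with q < s exactly because α < 1 + (2s + β)/N. Letting b → 0 yields I < 0
(`exists_kinetic_lt_hartree`).

Strict binding: superhomogeneity of G makes D grow under u ↦ θu faster than K does. Rescaling w of
mass 0 < m < λ to mass λ gives E(w) > (m/λ) I, which excludes dichotomy (`mass_mul_lt_realEnergy`).

Compactness: along a minimizing sequence D eventually stays above -I > 0. If all low-frequency parts
were uniformly small, all subcritical L^p norms with p > 2 would vanish, and D with them; so some
low-frequency part is bounded below at a point, which a translation moves to the origin
(`exists_lowPass_large`). Evaluation of a low-frequency part at a point is weakly continuous, so a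
weak limit w is nonzero. With v the remainder, mass and K split in the Hilbert space sense, and D(w
+ v) ≤ D(w) + D(v) + o(1) by local compactness and the derivative bound on G
(`eventually_hartree_add_le`). Strict binding then forces w to carry all the mass; v tends to 0 in
L², D(v) → 0, and comparison of energies gives K(v) → 0 and E(w) = I (`exists_subseq_tendstoHs`). -/

noncomputable section

namespace FracHartree

/-! ### The Fourier transform of functions in `L¹ ∩ L²` -/

theorem continuous_fourier {N : ℕ} {f : Rn N → ℂ} (hf : Integrable f) : Continuous (𝓕 f) :=
  VectorFourier.fourierIntegral_continuous Real.continuous_fourierChar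
    (by exact continuous_inner) hf

theorem continuous_fourierInv {N : ℕ} {f : Rn N → ℂ} (hf : Integrable f) : Continuous (𝓕⁻ f) := by
  have : 𝓕⁻ f = fun x => 𝓕 f (-x) := by
    ext x; exact Real.fourierInv_eq_fourier_neg f x
  rw [this]
  exact (continuous_fourier hf).comp continuous_neg

/-- The L² transform is known only abstractly, so both sides are tested against smooth compactly
supported functions: moving the transform onto the test function gives the same integral in the
distributional and in the L¹ sense. -/
theorem fourier_ae_eq {N : ℕ} (g : L2 ℂ N) (hg : Integrable g) :
    (𝓕 g : L2 ℂ N) =ᵐ[volume] 𝓕 (g : Rn N → ℂ) := by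
  refine ae_eq_of_integral_contDiff_smul_eq
    ((Lp.memLp (𝓕 g : L2 ℂ N)).locallyIntegrable (by norm_num))
    (continuous_fourier hg).locallyIntegrable ?_
  intro φ hφ hφc
  have h1 : HasCompactSupport (Complex.ofRealCLM ∘ φ) := hφc.comp_left rfl
  have h2 : ContDiff ℝ ((⊤ : ℕ∞) : WithTop ℕ∞) (Complex.ofRealCLM ∘ φ) := by fun_prop
  set Φ := h1.toSchwartzMap h2 with hΦ
  have e1 := congrArg (fun T => T Φ) (Lp.fourier_toTemperedDistribution_eq g)
  simp only [TemperedDistribution.fourier_apply, Lp.toTemperedDistribution_apply] at e1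
  have e2 : ∫ x, φ x • (𝓕 g : L2 ℂ N) x = ∫ x, Φ x • (𝓕 g : L2 ℂ N) x := by
    apply integral_congr_ae
    filter_upwards with x
    simp [hΦ]
  have e3 : ∫ x, φ x • 𝓕 (g : Rn N → ℂ) x = ∫ x, Φ x • 𝓕 (g : Rn N → ℂ) x := by
    apply integral_congr_ae
    filter_upwards with x
    simp [hΦ]
  rw [e2, e3, ← e1]
  have := VectorFourier.integral_fourierIntegral_smul_eq_flip (L := innerₗ (Rn N))
    (μ := volume) (ν := volume) (f := (Φ : Rn N → ℂ)) (g := (g : Rn N → ℂ))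
    Real.continuous_fourierChar (by exact continuous_inner) Φ.integrable hg
  rw [flip_innerₗ] at this
  rw [SchwartzMap.fourier_coe]
  exact this

theorem fourierInv_ae_eq {N : ℕ} (g : L2 ℂ N) (hg : Integrable g) :
    (𝓕⁻ g : L2 ℂ N) =ᵐ[volume] 𝓕⁻ (g : Rn N → ℂ) := by
  refine ae_eq_of_integral_contDiff_smul_eq
    ((Lp.memLp (𝓕⁻ g : L2 ℂ N)).locallyIntegrable (by norm_num))
    (continuous_fourierInv hg).locallyIntegrable ?_
  intro φ hφ hφc
  have h1 : HasCompactSupport (Complex.ofRealCLM ∘ φ) := hφc.comp_left rfl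
  have h2 : ContDiff ℝ ((⊤ : ℕ∞) : WithTop ℕ∞) (Complex.ofRealCLM ∘ φ) := by fun_prop
  set Φ := h1.toSchwartzMap h2 with hΦ
  have e1 := congrArg (fun T => T Φ) (Lp.fourierInv_toTemperedDistribution_eq g)
  simp only [TemperedDistribution.fourierInv_apply, Lp.toTemperedDistribution_apply] at e1
  have e2 : ∫ x, φ x • (𝓕⁻ g : L2 ℂ N) x = ∫ x, Φ x • (𝓕⁻ g : L2 ℂ N) x := by
    apply integral_congr_ae
    filter_upwards with x
    simp [hΦ]
  have e3 : ∫ x, φ x • 𝓕⁻ (g : Rn N → ℂ) x = ∫ x, Φ x • 𝓕⁻ (g : Rn N → ℂ) x := by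
    apply integral_congr_ae
    filter_upwards with x
    simp [hΦ]
  rw [e2, e3, ← e1]
  have := VectorFourier.integral_fourierIntegral_smul_eq_flip (L := -innerₗ (Rn N))
    (μ := volume) (ν := volume) (f := (Φ : Rn N → ℂ)) (g := (g : Rn N → ℂ))
    Real.continuous_fourierChar (by exact continuous_inner.neg) Φ.integrable hg
  rw [show (-innerₗ (Rn N)).flip = -innerₗ (Rn N) by
    ext x y; simp [real_inner_comm]] at this
  rw [SchwartzMap.fourierInv_coe]
  exact this

/-! ### Multiplication operators on `L²` -/

theorem enorm_sq_eq_lintegral {𝕜 : Type} [RCLike 𝕜] {N : ℕ} (u : L2 𝕜 N) :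
    ‖u‖ₑ ^ 2 = ∫⁻ x, ‖u x‖ₑ ^ 2 := by
  rw [Lp.enorm_def, eLpNorm_eq_lintegral_rpow_enorm_toReal (by norm_num) (by norm_num),
    ← ENNReal.rpow_natCast, ← ENNReal.rpow_mul]
  simp

theorem enorm_fourier {N : ℕ} (u : L2 ℂ N) : ‖(𝓕 u : L2 ℂ N)‖ₑ = ‖u‖ₑ := by
  rw [← ofReal_norm, ← ofReal_norm, Lp.norm_fourier_eq]

theorem enorm_fourierInv {N : ℕ} (u : L2 ℂ N) : ‖(𝓕⁻ u : L2 ℂ N)‖ₑ = ‖u‖ₑ := by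
  rw [← enorm_fourier (𝓕⁻ u), FourierTransform.fourier_fourierInv_eq]

/-- A measurable function bounded by `1`, as an element of `L^∞`. -/
theorem memLp_top_of_le_one {N : ℕ} {m : Rn N → ℂ} (hm : Measurable m) (hb : ∀ x, ‖m x‖ ≤ 1) :
    MemLp m ∞ (volume : Measure (Rn N)) :=
  memLp_top_of_bound hm.aestronglyMeasurable 1 (Eventually.of_forall hb)

/-- Multiplication by a measurable function bounded by `1`. -/
def mulOp {N : ℕ} (m : Rn N → ℂ) (hm : Measurable m) (hb : ∀ x, ‖m x‖ ≤ 1) :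
    L2 ℂ N →L[ℂ] L2 ℂ N :=
  (ContinuousLinearMap.mul ℂ ℂ).holderL volume ∞ 2 2 ((memLp_top_of_le_one hm hb).toLp m)

theorem coeFn_mulOp {N : ℕ} (m : Rn N → ℂ) (hm : Measurable m) (hb : ∀ x, ‖m x‖ ≤ 1)
    (f : L2 ℂ N) : mulOp m hm hb f =ᵐ[volume] fun x => m x * f x := by
  have h := ContinuousLinearMap.coeFn_holder (r := 2) (ContinuousLinearMap.mul ℂ ℂ)
    ((memLp_top_of_le_one hm hb).toLp m) f
  filter_upwards [h, (memLp_top_of_le_one hm hb).coeFn_toLp] with x h1 h2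
  rw [show (mulOp m hm hb f) x = _ from h1, h2]
  simp

/-! ### Complexification -/

theorem norm_map_rclike {𝕜 : Type} [RCLike 𝕜] (z : 𝕜) : ‖RCLike.map 𝕜 ℂ z‖ = ‖z‖ := by
  have h : ‖RCLike.map 𝕜 ℂ z‖ ^ 2 = ‖z‖ ^ 2 := by
    rw [← RCLike.normSq_eq_def' z, ← RCLike.normSq_eq_def', RCLike.normSq_apply,
      RCLike.normSq_apply]
    simp
  exact (sq_eq_sq₀ (norm_nonneg _) (norm_nonneg _)).1 h

theorem coeFn_complexify {𝕜 : Type} [RCLike 𝕜] {N : ℕ} (u : L2 𝕜 N) :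
    complexify u =ᵐ[volume] fun x => RCLike.map 𝕜 ℂ (u x) :=
  ContinuousLinearMap.coeFn_compLp _ u

theorem norm_complexify_ae {𝕜 : Type} [RCLike 𝕜] {N : ℕ} (u : L2 𝕜 N) :
    ∀ᵐ x, ‖complexify u x‖ = ‖u x‖ := by
  filter_upwards [coeFn_complexify u] with x hx
  rw [hx, norm_map_rclike]

theorem enorm_complexify_ae {𝕜 : Type} [RCLike 𝕜] {N : ℕ} (u : L2 𝕜 N) :
    ∀ᵐ x, ‖complexify u x‖ₑ = ‖u x‖ₑ := by
  filter_upwards [norm_complexify_ae u] with x hx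
  rw [← ofReal_norm, hx, ofReal_norm]

/-- `u ↦ 𝓕 (complexify u)` as a continuous real-linear map. -/
def ft (𝕜 : Type) [RCLike 𝕜] (N : ℕ) : L2 𝕜 N →L[ℝ] L2 ℂ N :=
  ((Lp.fourierTransformₗᵢ (Rn N) ℂ).toContinuousLinearEquiv.toContinuousLinearMap.restrictScalars
    ℝ) ∘L ((RCLike.map 𝕜 ℂ).compLpL 2 volume)

theorem ft_apply {𝕜 : Type} [RCLike 𝕜] {N : ℕ} (u : L2 𝕜 N) : ft 𝕜 N u = 𝓕 (complexify u) := rfl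

theorem enorm_complexify {𝕜 : Type} [RCLike 𝕜] {N : ℕ} (u : L2 𝕜 N) : ‖complexify u‖ₑ = ‖u‖ₑ := by
  rw [Lp.enorm_def, Lp.enorm_def]
  exact eLpNorm_congr_norm_ae (norm_complexify_ae u)

theorem enorm_ft {𝕜 : Type} [RCLike 𝕜] {N : ℕ} (u : L2 𝕜 N) : ‖ft 𝕜 N u‖ₑ = ‖u‖ₑ := by
  rw [ft_apply, enorm_fourier, enorm_complexify]

/-! ### Low-frequency cut-off -/

theorem measurable_indicator_one {N : ℕ} {S : Set (Rn N)} (hS : MeasurableSet S) :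
    Measurable (S.indicator (fun _ => (1 : ℂ))) := measurable_const.indicator hS

theorem norm_indicator_one_le {N : ℕ} (S : Set (Rn N)) (x : Rn N) :
    ‖S.indicator (fun _ => (1 : ℂ)) x‖ ≤ 1 := by
  by_cases h : x ∈ S <;> simp [h]

/-- Restriction of an `L²` function to a measurable set, extended by zero. -/
def cutOp {N : ℕ} (S : Set (Rn N)) (hS : MeasurableSet S) : L2 ℂ N →L[ℂ] L2 ℂ N :=
  mulOp (S.indicator fun _ => 1) (measurable_indicator_one hS) (norm_indicator_one_le S)

theorem coeFn_cutOp {N : ℕ} (S : Set (Rn N)) (hS : MeasurableSet S) (f : L2 ℂ N) :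
    cutOp S hS f =ᵐ[volume] S.indicator f := by
  filter_upwards [coeFn_mulOp _ (measurable_indicator_one hS) (norm_indicator_one_le S) f] with x hx
  rw [cutOp, hx]
  by_cases h : x ∈ S <;> simp [h]

/-- The low-frequency part, on `|ξ| < R`, of the function with Fourier transform `U`. -/
def lowPass {N : ℕ} (R : ℝ) (U : L2 ℂ N) : Rn N → ℂ :=
  𝓕⁻ ((Metric.ball (0 : Rn N) R).indicator U)

theorem integrable_indicator_ball {N : ℕ} (R : ℝ) (U : L2 ℂ N) :
    Integrable ((Metric.ball (0 : Rn N) R).indicator U) := by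
  rw [integrable_indicator_iff measurableSet_ball]
  have : IsFiniteMeasure (volume.restrict (Metric.ball (0 : Rn N) R)) :=
    ⟨by simpa using measure_ball_lt_top⟩
  exact ((Lp.memLp U).restrict _).integrable (by norm_num)

/-- Since the truncated transform is integrable, the low-frequency part is an honest function, with
meaningful values at every point rather than almost everywhere. -/
theorem continuous_lowPass {N : ℕ} (R : ℝ) (U : L2 ℂ N) : Continuous (lowPass R U) :=
  continuous_fourierInv (integrable_indicator_ball R U)

theorem lowPass_ae_eq {N : ℕ} (R : ℝ) (U : L2 ℂ N) :
    (𝓕⁻ (cutOp (Metric.ball 0 R) measurableSet_ball U) : L2 ℂ N) =ᵐ[volume] lowPass R U := by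
  have h := coeFn_cutOp (Metric.ball 0 R) measurableSet_ball U
  filter_upwards [fourierInv_ae_eq _ ((integrable_indicator_ball R U).congr h.symm)] with x hx
  rw [hx, lowPass]
  exact Real.fourierInv_congr_ae h x

theorem cutOp_add_compl {N : ℕ} (S : Set (Rn N)) (hS : MeasurableSet S) (f : L2 ℂ N) :
    cutOp S hS f + cutOp Sᶜ hS.compl f = f := by
  ext1
  filter_upwards [Lp.coeFn_add (cutOp S hS f) (cutOp Sᶜ hS.compl f), coeFn_cutOp S hS f,
    coeFn_cutOp Sᶜ hS.compl f] with x h1 h2 h3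
  rw [h1, Pi.add_apply, h2, h3]
  by_cases h : x ∈ S <;> simp [h]

theorem sub_lowPass_ae_eq {N : ℕ} (R : ℝ) (u : L2 ℂ N) :
    (𝓕⁻ (cutOp (Metric.ball 0 R)ᶜ measurableSet_ball.compl (𝓕 u)) : L2 ℂ N) =ᵐ[volume]
      fun x => u x - lowPass R (𝓕 u) x := by
  have h : (𝓕⁻ (cutOp (Metric.ball 0 R)ᶜ measurableSet_ball.compl (𝓕 u)) : L2 ℂ N)
      = u - 𝓕⁻ (cutOp (Metric.ball 0 R) measurableSet_ball (𝓕 u)) := by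
    rw [eq_sub_iff_add_eq', ← FourierTransform.fourierInv_add, cutOp_add_compl,
      FourierTransform.fourierInv_fourier_eq]
  rw [h]
  filter_upwards [Lp.coeFn_sub u (𝓕⁻ (cutOp (Metric.ball 0 R) measurableSet_ball (𝓕 u))),
    lowPass_ae_eq R (𝓕 u)] with x h1 h2
  rw [h1, Pi.sub_apply, h2]

theorem enorm_cutOp_sq {N : ℕ} (S : Set (Rn N)) (hS : MeasurableSet S) (f : L2 ℂ N) :
    ‖cutOp S hS f‖ₑ ^ 2 = ∫⁻ x in S, ‖f x‖ₑ ^ 2 := by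
  rw [enorm_sq_eq_lintegral, ← lintegral_indicator hS]
  apply lintegral_congr_ae
  filter_upwards [coeFn_cutOp S hS f] with x hx
  rw [hx]
  by_cases h : x ∈ S <;> simp [h]

theorem lintegral_sub_lowPass {N : ℕ} (R : ℝ) (u : L2 ℂ N) :
    ∫⁻ x, ‖u x - lowPass R (𝓕 u) x‖ₑ ^ 2 =
      ∫⁻ ξ in (Metric.ball (0 : Rn N) R)ᶜ, ‖(𝓕 u : L2 ℂ N) ξ‖ₑ ^ 2 := by
  rw [← enorm_cutOp_sq _ measurableSet_ball.compl, ← enorm_fourierInv, enorm_sq_eq_lintegral]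
  apply lintegral_congr_ae
  filter_upwards [sub_lowPass_ae_eq R u] with x hx
  rw [hx]

/-- `lowPass R U x` is the inner product of `U` with a fixed `L²` function. -/
theorem exists_inner_eq_lowPass {N : ℕ} (R : ℝ) (x : Rn N) :
    ∃ g : L2 ℂ N, (∀ U : L2 ℂ N, lowPass R U x = inner ℂ g U) ∧
      ‖g‖ₑ ^ 2 = volume (Metric.ball (0 : Rn N) R) := by
  set f : Rn N → ℂ := (Metric.ball (0 : Rn N) R).indicator
    (fun ξ => ((Real.fourierChar (-inner ℝ ξ x) : Circle) : ℂ)) with hf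
  have hfm : AEStronglyMeasurable f volume :=
    (Continuous.aestronglyMeasurable (by fun_prop)).indicator measurableSet_ball
  have hfL : MemLp f 2 volume := by
    rw [hf, memLp_indicator_iff_restrict measurableSet_ball]
    have : IsFiniteMeasure (volume.restrict (Metric.ball (0 : Rn N) R)) :=
      ⟨by simpa using measure_ball_lt_top⟩
    exact MemLp.of_bound (Continuous.aestronglyMeasurable (by fun_prop)) 1
      (Eventually.of_forall fun ξ => (Circle.norm_coe _).le)
  refine ⟨hfL.toLp f, fun U => ?_, ?_⟩
  · rw [L2.inner_def, lowPass, Real.fourierInv_eq]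
    apply integral_congr_ae
    filter_upwards [hfL.coeFn_toLp] with ξ hξ
    rw [hξ, hf]
    by_cases h : ξ ∈ Metric.ball (0 : Rn N) R
    · rw [Set.indicator_of_mem h, Set.indicator_of_mem h]
      simp [Circle.smul_def, AddChar.map_neg_eq_inv, mul_comm]
    · simp [h]
  · rw [enorm_sq_eq_lintegral]
    have : ∫⁻ ξ, ‖(hfL.toLp f) ξ‖ₑ ^ 2 = ∫⁻ ξ, (Metric.ball (0 : Rn N) R).indicator 1 ξ := by
      apply lintegral_congr_ae
      filter_upwards [hfL.coeFn_toLp] with ξ hξ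
      rw [hξ, hf]
      by_cases h : ξ ∈ Metric.ball (0 : Rn N) R
      · rw [Set.indicator_of_mem h, Set.indicator_of_mem h]
        rw [← ofReal_norm, Circle.norm_coe]
        simp
      · simp [h]
    rw [this, lintegral_indicator_one measurableSet_ball]

/-- Bernstein's inequality, by Cauchy–Schwarz against the truncated character. -/
theorem enorm_lowPass_le {N : ℕ} (R : ℝ) (U : L2 ℂ N) (x : Rn N) :
    ‖lowPass R U x‖ₑ ≤ (volume (Metric.ball (0 : Rn N) R)) ^ (1 / 2 : ℝ) * ‖U‖ₑ := by
  obtain ⟨g, hg, hn⟩ := exists_inner_eq_lowPass R x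
  rw [hg U, ← hn, ← ENNReal.rpow_natCast, ← ENNReal.rpow_mul]
  simp only [Nat.cast_ofNat, ne_eq, OfNat.ofNat_ne_zero, not_false_eq_true, mul_one_div_cancel,
    ENNReal.rpow_one]
  rw [← ofReal_norm, ← ofReal_norm, ← ofReal_norm,
    ← ENNReal.ofReal_mul (norm_nonneg _)]
  exact ENNReal.ofReal_le_ofReal (norm_inner_le_norm g U)

/-! ### A Gagliardo–Nirenberg inequality -/

theorem lintegral_Ioi_rpow_indicator {q T : ℝ} (hq : 0 < q) (hT : 0 ≤ T) :
    ∫⁻ t in Set.Ioi (0 : ℝ), (if t ≤ T then ENNReal.ofReal (t ^ (q - 1)) else 0)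
      = ENNReal.ofReal (T ^ q / q) := by
  have h1 : ∫⁻ t in Set.Ioi (0 : ℝ), (if t ≤ T then ENNReal.ofReal (t ^ (q - 1)) else 0)
      = ∫⁻ t in Set.Ioc (0 : ℝ) T, ENNReal.ofReal (t ^ (q - 1)) := by
    rw [← lintegral_indicator measurableSet_Ioi, ← lintegral_indicator measurableSet_Ioc]
    congr 1 with t
    by_cases h : 0 < t <;> by_cases h' : t ≤ T <;> simp [h, h']
  rw [h1, ← ofReal_integral_eq_lintegral_ofReal]
  · rw [← intervalIntegral.integral_of_le hT, integral_rpow (Or.inl (by linarith))]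
    simp [Real.zero_rpow hq.ne']
  · have := (intervalIntegral.intervalIntegrable_rpow' (a := 0) (b := T)
      (show -1 < q - 1 by linarith))
    rwa [intervalIntegrable_iff_integrableOn_Ioc_of_le hT] at this
  · filter_upwards [ae_restrict_mem measurableSet_Ioc] with t ht
    exact Real.rpow_nonneg ht.1.le _

theorem exists_norm_lowPass_le {N : ℕ} (hN : 0 < N) : ∃ c : ℝ, 0 < c ∧
    ∀ (R : ℝ) (U : L2 ℂ N) (x : Rn N), 0 ≤ R → ‖lowPass R U x‖ ≤ c * R ^ ((N : ℝ) / 2) * ‖U‖ := by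
  have : Nonempty (Fin N) := ⟨⟨0, hN⟩⟩
  set V := (volume (Metric.ball (0 : Rn N) 1)).toReal
  have hV : 0 < V := ENNReal.toReal_pos (Metric.measure_ball_pos volume _ one_pos).ne'
    measure_ball_lt_top.ne
  refine ⟨V ^ (1 / 2 : ℝ), by positivity, fun R U x hR => ?_⟩
  have h := enorm_lowPass_le R U x
  rw [Measure.addHaar_ball volume 0 hR] at h
  have hV' : volume (Metric.ball (0 : Rn N) 1) = ENNReal.ofReal V :=
    (ENNReal.ofReal_toReal measure_ball_lt_top.ne).symm
  rw [hV', ← ENNReal.ofReal_mul (by positivity), ENNReal.ofReal_rpow_of_nonneg (by positivity)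
    (by norm_num), ← ofReal_norm, ← ofReal_norm, ← ENNReal.ofReal_mul (by positivity),
    ENNReal.ofReal_le_ofReal_iff (by positivity), Real.mul_rpow (by positivity) hV.le,
    ← Real.rpow_natCast, ← Real.rpow_mul hR] at h
  simp only [finrank_euclideanSpace, Fintype.card_fin] at h
  calc _ ≤ _ := h
    _ = _ := by rw [mul_one_div, mul_comm (R ^ _)]

/-- Where |u| ≥ t the high-frequency part is at least t/2 in modulus; Chebyshev and Plancherel then
bound the measure of this set. -/
theorem meas_le_of_lowPass_le {N : ℕ} (R t : ℝ) (ht : 0 < t) (u : L2 ℂ N)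
    (h : ∀ x, ‖lowPass R (𝓕 u) x‖ ≤ t / 2) :
    volume {x | t ≤ ‖u x‖} ≤ ENNReal.ofReal (4 / t ^ 2) *
      ∫⁻ ξ in (Metric.ball (0 : Rn N) R)ᶜ, ‖(𝓕 u : L2 ℂ N) ξ‖ₑ ^ 2 := by
  rw [← lintegral_sub_lowPass]
  have hsub : {x | t ≤ ‖u x‖} ⊆
      {x | ENNReal.ofReal ((t / 2) ^ 2) ≤ ‖u x - lowPass R (𝓕 u) x‖ₑ ^ 2} := by
    intro x hx
    simp only [Set.mem_ofPred_eq] at hx ⊢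
    rw [← ofReal_norm, ← ENNReal.ofReal_pow (norm_nonneg _)]
    apply ENNReal.ofReal_le_ofReal
    have := norm_sub_norm_le (u x) (lowPass R (𝓕 u) x)
    have := h x
    gcongr
    linarith
  have hm := meas_ge_le_lintegral_div
    (μ := (volume : Measure (Rn N))) (f := fun x => ‖u x - lowPass R (𝓕 u) x‖ₑ ^ 2)
    (((Lp.aestronglyMeasurable u).sub
      (continuous_lowPass R (𝓕 u)).aestronglyMeasurable).enorm.pow_const 2)
    (ε := ENNReal.ofReal ((t / 2) ^ 2)) (by simpa using by positivity) ENNReal.ofReal_ne_top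
  refine (measure_mono hsub).trans (hm.trans_eq ?_)
  rw [ENNReal.div_eq_inv_mul, ← ENNReal.ofReal_inv_of_pos (by positivity)]
  congr 2
  field_simp
  norm_num

/-- In the layer-cake formula, each level t gets its own frequency cut-off R(t), chosen so that the
low-frequency part stays below t/2. Exchanging the t and ξ integrals leaves an explicit power of
|ξ|. -/
theorem lintegral_rpow_le_freq {N : ℕ} (hN : 0 < N) {p : ℝ} (hp : 2 < p) :
    ∃ C : ℝ, 0 < C ∧ ∀ u : L2 ℂ N, ∫⁻ x, ‖u x‖ₑ ^ p ≤ ENNReal.ofReal (C * ‖u‖ ^ (p - 2)) *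
      ∫⁻ ξ : Rn N, ENNReal.ofReal (‖ξ‖ ^ (N * (p - 2) / 2)) * ‖(𝓕 u : L2 ℂ N) ξ‖ₑ ^ 2 := by
  obtain ⟨c, hc, hlow⟩ := exists_norm_lowPass_le hN
  have hN' : (0 : ℝ) < N := by exact_mod_cast hN
  -- The factor p comes from the layer-cake formula, 4 from Chebyshev at height t/2, and the last
  -- factor from integrating t^(p-3) up to the threshold T ξ.
  refine ⟨p * 4 * ((2 * c) ^ (p - 2) / (p - 2)), ?_, fun u => ?_⟩
  · have : 0 < p - 2 := by linarith
    positivity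
  rcases eq_or_ne u 0 with rfl | hu
  · have : ∫⁻ x, ‖((0 : L2 ℂ N) : Rn N → ℂ) x‖ₑ ^ p = 0 := by
      rw [← lintegral_zero (μ := (volume : Measure (Rn N)))]
      apply lintegral_congr_ae
      filter_upwards [Lp.coeFn_zero ℂ 2 (volume : Measure (Rn N))] with x hx
      rw [hx]
      simp [show 0 < p by linarith]
    rw [this]
    exact zero_le
  set A := ‖u‖
  have hA : 0 < A := norm_pos_iff.2 hu
  set U : L2 ℂ N := 𝓕 u
  have hUA : ‖U‖ = A := Lp.norm_fourier_eq u
  -- Inverse of the cut-off t ↦ R(t): the frequency ξ lies outside the ball of radius R(t) exactly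
  -- when t ≤ T ξ.
  set T : Rn N → ℝ := fun ξ => 2 * c * A * ‖ξ‖ ^ ((N : ℝ) / 2) with hT
  have hTm : Measurable T := by fun_prop
  have hTn : ∀ ξ, 0 ≤ T ξ := fun ξ => by positivity
  have hUm : AEMeasurable (fun ξ => ‖U ξ‖ₑ ^ 2) volume :=
    (Lp.aestronglyMeasurable U).enorm.pow_const 2
  have e1 : ∫⁻ x, ‖u x‖ₑ ^ p = ∫⁻ x, ENNReal.ofReal (‖u x‖ ^ p) := by
    congr 1 with x
    rw [← ofReal_norm, ENNReal.ofReal_rpow_of_nonneg (norm_nonneg _) (by linarith)]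
  have e2 : ∀ t ∈ Set.Ioi (0 : ℝ), volume {x | t ≤ ‖u x‖} * ENNReal.ofReal (t ^ (p - 1)) ≤
      4 * ∫⁻ ξ, (if t ≤ T ξ then ENNReal.ofReal (t ^ ((p - 2) - 1)) else 0) * ‖U ξ‖ₑ ^ 2 := by
    intro t (ht : 0 < t)
    -- The solution of c R^(N/2) A = t/2, the equality case of the pointwise bound `hlow`.
    set R : ℝ := (t / (2 * c * A)) ^ (2 / (N : ℝ)) with hR
    have hR0 : 0 ≤ R := by positivity
    have hRN : R ^ ((N : ℝ) / 2) = t / (2 * c * A) := by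
      rw [hR, ← Real.rpow_mul (by positivity)]
      rw [div_mul_div_cancel₀' (by positivity), div_self hN'.ne', Real.rpow_one]
    have hb : ∀ x, ‖lowPass R U x‖ ≤ t / 2 := fun x => by
      refine (hlow R U x hR0).trans_eq ?_
      rw [hRN, hUA]; field_simp
    have hset : ∀ ξ, ξ ∈ (Metric.ball (0 : Rn N) R)ᶜ ↔ t ≤ T ξ := fun ξ => by
      simp only [Set.mem_compl_iff, Metric.mem_ball, dist_zero_right, not_lt, hT]
      rw [← Real.rpow_le_rpow_iff hR0 (norm_nonneg _) (show 0 < (N : ℝ) / 2 by positivity), hRN,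
        div_le_iff₀' (by positivity)]
    calc volume {x | t ≤ ‖u x‖} * ENNReal.ofReal (t ^ (p - 1))
        ≤ (ENNReal.ofReal (4 / t ^ 2) *
          ∫⁻ ξ in (Metric.ball (0 : Rn N) R)ᶜ, ‖U ξ‖ₑ ^ 2) * ENNReal.ofReal (t ^ (p - 1)) := by
          gcongr
          exact meas_le_of_lowPass_le R t ht u hb
      _ = 4 * (ENNReal.ofReal (t ^ ((p - 2) - 1)) *
          ∫⁻ ξ in (Metric.ball (0 : Rn N) R)ᶜ, ‖U ξ‖ₑ ^ 2) := by
          rw [mul_right_comm, ← ENNReal.ofReal_mul (by positivity), ← mul_assoc]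
          congr 1
          rw [show (4 : ℝ≥0∞) = ENNReal.ofReal 4 by simp, ← ENNReal.ofReal_mul (by norm_num)]
          congr 1
          rw [show p - 1 = (p - 2 - 1) + 2 by ring, Real.rpow_add ht, Real.rpow_two]
          field_simp
      _ = _ := by
          rw [← lintegral_const_mul'' _ hUm.restrict,
            ← lintegral_indicator measurableSet_ball.compl]
          congr 2 with ξ
          by_cases h : ξ ∈ (Metric.ball (0 : Rn N) R)ᶜ
          · rw [Set.indicator_of_mem h, if_pos ((hset ξ).1 h)]
          · rw [Set.indicator_of_notMem h, if_neg (fun h' => h ((hset ξ).2 h'))]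
            simp
  rw [e1, lintegral_rpow_eq_lintegral_meas_le_mul volume
    (Eventually.of_forall fun x => norm_nonneg _) (Lp.aestronglyMeasurable u).norm.aemeasurable
    (by linarith)]
  have hint : AEMeasurable (Function.uncurry fun (t : ℝ) (ξ : Rn N) =>
      (if t ≤ T ξ then ENNReal.ofReal (t ^ ((p - 2) - 1)) else 0) * ‖U ξ‖ₑ ^ 2)
      ((volume.restrict (Set.Ioi 0)).prod volume) := by
    refine AEMeasurable.mul (Measurable.aemeasurable ?_)
      (hUm.comp_quasiMeasurePreserving Measure.quasiMeasurePreserving_snd)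
    exact Measurable.ite (measurableSet_le measurable_fst (hTm.comp measurable_snd))
      (by fun_prop) measurable_const
  calc ENNReal.ofReal p * ∫⁻ t in Set.Ioi (0 : ℝ),
        volume {x | t ≤ ‖u x‖} * ENNReal.ofReal (t ^ (p - 1))
      ≤ ENNReal.ofReal p * ∫⁻ t in Set.Ioi (0 : ℝ), 4 *
        ∫⁻ ξ, (if t ≤ T ξ then ENNReal.ofReal (t ^ ((p - 2) - 1)) else 0) * ‖U ξ‖ₑ ^ 2 := by
        gcongr ENNReal.ofReal p * ?_
        exact setLIntegral_mono' measurableSet_Ioi e2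
    _ = ENNReal.ofReal p * (4 * ∫⁻ ξ, ∫⁻ t in Set.Ioi (0 : ℝ),
        (if t ≤ T ξ then ENNReal.ofReal (t ^ ((p - 2) - 1)) else 0) * ‖U ξ‖ₑ ^ 2) := by
        rw [lintegral_const_mul' _ _ (by norm_num), lintegral_lintegral_swap hint]
    _ = ENNReal.ofReal p * (4 * ∫⁻ ξ, ENNReal.ofReal ((2 * c * A) ^ (p - 2) / (p - 2)) *
        (ENNReal.ofReal (‖ξ‖ ^ (N * (p - 2) / 2)) * ‖U ξ‖ₑ ^ 2)) := by
        congr 3 with ξ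
        rw [lintegral_mul_const]
        · rw [lintegral_Ioi_rpow_indicator (by linarith) (hTn ξ), ← mul_assoc,
            ← ENNReal.ofReal_mul
              (div_nonneg (Real.rpow_nonneg (by positivity) _) (by linarith))]
          congr 2
          rw [hT, Real.mul_rpow (by positivity) (by positivity), ← Real.rpow_mul (norm_nonneg _),
            show (N : ℝ) / 2 * (p - 2) = N * (p - 2) / 2 by ring]
          ring
        · exact Measurable.ite (measurableSet_le measurable_id measurable_const)
            (by fun_prop) measurable_const
    _ = _ := by
        rw [lintegral_const_mul' _ _ ENNReal.ofReal_ne_top, ← mul_assoc, ← mul_assoc]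
        congr 1
        rw [show (4 : ℝ≥0∞) = ENNReal.ofReal 4 by simp, ← ENNReal.ofReal_mul (by linarith),
          ← ENNReal.ofReal_mul (by linarith), Real.mul_rpow (by positivity) hA.le]
        congr 1
        ring

theorem kinetic_eq {𝕜 : Type} [RCLike 𝕜] {N : ℕ} (s : ℝ) (u : L2 𝕜 N) :
    kinetic s u = ∫⁻ ξ : Rn N, ENNReal.ofReal ((2 * Real.pi * ‖ξ‖) ^ (2 * s)) *
      ‖ft 𝕜 N u ξ‖ₑ ^ 2 := rfl

theorem lintegral_freq_le {𝕜 : Type} [RCLike 𝕜] {N : ℕ} {s τ : ℝ} (hs : 0 < s) (hτ0 : 0 ≤ τ)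
    (hτ1 : τ ≤ 1) (u : L2 𝕜 N) :
    ∫⁻ ξ : Rn N, ENNReal.ofReal (‖ξ‖ ^ (2 * s * τ)) * ‖ft 𝕜 N u ξ‖ₑ ^ 2 ≤
      kinetic s u ^ τ * (‖u‖ₑ ^ 2) ^ (1 - τ) := by
  rw [kinetic_eq, ← enorm_ft u, enorm_sq_eq_lintegral]
  set U := ft 𝕜 N u
  have hUm : AEMeasurable (fun ξ => ‖U ξ‖ₑ ^ 2) volume :=
    (Lp.aestronglyMeasurable U).enorm.pow_const 2
  refine le_trans ?_ (ENNReal.lintegral_mul_norm_pow_le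
    (AEMeasurable.mul (Measurable.aemeasurable (by fun_prop)) hUm) hUm hτ0 (by linarith) (by ring))
  apply lintegral_mono
  intro ξ
  simp only [Pi.mul_apply]
  rw [ENNReal.mul_rpow_of_nonneg _ _ hτ0, mul_assoc (_ ^ τ), ← ENNReal.rpow_add_of_nonneg _ _ hτ0
    (by linarith)]
  simp only [add_sub_cancel, ENNReal.rpow_one]
  gcongr
  rw [ENNReal.ofReal_rpow_of_nonneg (by positivity) hτ0, ← Real.rpow_mul (by positivity)]
  apply ENNReal.ofReal_le_ofReal
  apply Real.rpow_le_rpow (norm_nonneg _) _ (by positivity)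
  -- The factor 2π in the symbol exceeds 1 and can be dropped.
  have := Real.pi_gt_three
  nlinarith [norm_nonneg ξ]

/-- The exponent of the kinetic energy in the Gagliardo–Nirenberg inequality. -/
def gnExp (N : ℕ) (s p : ℝ) : ℝ := N * (p - 2) / (4 * s)

/-- The frequency moment of `lintegral_rpow_le_freq` is |ξ|^(2sτ) with τ = `gnExp N s p` ≤ 1, and
Hölder interpolates it between mass and kinetic energy. At p = 2 the claim is an identity. -/
theorem gagliardo_nirenberg (𝕜 : Type) [RCLike 𝕜] {N : ℕ} (hN : 0 < N) {s p : ℝ} (hs : 0 < s)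
    (hp : 2 ≤ p) (hps : N * (p - 2) ≤ 4 * s) :
    ∃ C : ℝ≥0∞, C ≠ ∞ ∧ ∀ u : L2 𝕜 N,
      ∫⁻ x, ‖u x‖ₑ ^ p ≤ C * ‖u‖ₑ ^ (p - 2 * gnExp N s p) * kinetic s u ^ gnExp N s p := by
  have hN' : (0 : ℝ) < N := by exact_mod_cast hN
  rcases eq_or_lt_of_le hp with rfl | hp'
  · refine ⟨1, by simp, fun u => ?_⟩
    have := enorm_sq_eq_lintegral u
    simp only [gnExp, sub_self, mul_zero, zero_div, sub_zero, ENNReal.rpow_zero, mul_one, one_mul]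
    simp only [← ENNReal.rpow_two] at this ⊢
    rw [this]
  obtain ⟨C, hC, h⟩ := lintegral_rpow_le_freq hN hp'
  refine ⟨ENNReal.ofReal C, ENNReal.ofReal_ne_top, fun u => ?_⟩
  have hτ0 : 0 ≤ gnExp N s p := div_nonneg (mul_nonneg hN'.le (by linarith)) (by linarith)
  have hτ1 : gnExp N s p ≤ 1 := (div_le_one (by linarith)).2 hps
  have e1 : ∫⁻ x, ‖u x‖ₑ ^ p = ∫⁻ x, ‖complexify u x‖ₑ ^ p := by
    apply lintegral_congr_ae
    filter_upwards [enorm_complexify_ae u] with x hx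
    rw [hx]
  rw [e1]
  refine (h (complexify u)).trans ?_
  have e2 : (N : ℝ) * (p - 2) / 2 = 2 * s * gnExp N s p := by
    rw [gnExp]; field_simp; norm_num
  have h3 := lintegral_freq_le hs hτ0 hτ1 u
  rw [e2]
  have e3 : ENNReal.ofReal (‖complexify u‖ ^ (p - 2)) = ‖u‖ₑ ^ (p - 2) := by
    rw [← ENNReal.ofReal_rpow_of_nonneg (norm_nonneg _) (by linarith), ofReal_norm,
      enorm_complexify]
  rw [ENNReal.ofReal_mul hC.le, e3]
  calc _ ≤ ENNReal.ofReal C * ‖u‖ₑ ^ (p - 2) *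
      (kinetic s u ^ gnExp N s p * (‖u‖ₑ ^ 2) ^ (1 - gnExp N s p)) := by gcongr; exact h3
    _ = ENNReal.ofReal C * (‖u‖ₑ ^ (p - 2) * (‖u‖ₑ ^ 2) ^ (1 - gnExp N s p)) *
      kinetic s u ^ gnExp N s p := by ring
    _ = _ := by
      congr 2
      rw [← ENNReal.rpow_natCast, ← ENNReal.rpow_mul, ← ENNReal.rpow_add_of_nonneg _ _
        (by linarith) (mul_nonneg (by norm_num) (by linarith))]
      congr 1
      push_cast
      ring

/-! ### The bilinear Hartree form -/

/-- The kernel `|z|^{β - N}`. -/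
def riesz {N : ℕ} (β : ℝ) (z : Rn N) : ℝ≥0∞ := ENNReal.ofReal (‖z‖ ^ (β - (N : ℝ)))

/-- The bilinear form `∬ f(x) |x - y|^{β - N} g(y) dx dy`. -/
def form {N : ℕ} (β : ℝ) (f g : Rn N → ℝ≥0∞) : ℝ≥0∞ :=
  ∫⁻ z : Rn N × Rn N, f z.1 * riesz β (z.1 - z.2) * g z.2 ∂(volume.prod volume)

theorem measurable_riesz {N : ℕ} (β : ℝ) : Measurable (riesz (N := N) β) := by
  unfold riesz; fun_prop

theorem aemeasurable_fst {N : ℕ} {f : Rn N → ℝ≥0∞} (hf : AEMeasurable f) :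
    AEMeasurable (fun z : Rn N × Rn N => f z.1) (volume.prod volume) :=
  hf.comp_quasiMeasurePreserving Measure.quasiMeasurePreserving_fst

theorem aemeasurable_snd {N : ℕ} {f : Rn N → ℝ≥0∞} (hf : AEMeasurable f) :
    AEMeasurable (fun z : Rn N × Rn N => f z.2) (volume.prod volume) :=
  hf.comp_quasiMeasurePreserving Measure.quasiMeasurePreserving_snd

theorem aemeasurable_form {N : ℕ} (β : ℝ) {f g : Rn N → ℝ≥0∞} (hf : AEMeasurable f)
    (hg : AEMeasurable g) : AEMeasurable
      (fun z : Rn N × Rn N => f z.1 * riesz β (z.1 - z.2) * g z.2) (volume.prod volume) :=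
  ((aemeasurable_fst hf).mul (((measurable_riesz β).comp
    (measurable_fst.sub measurable_snd)).aemeasurable)).mul (aemeasurable_snd hg)

theorem form_comm {N : ℕ} (β : ℝ) {f g : Rn N → ℝ≥0∞} :
    form β f g = form β g f := by
  unfold form
  rw [← lintegral_prod_swap]
  congr 1 with z
  simp only [Prod.fst_swap, Prod.snd_swap]
  rw [riesz, riesz, norm_sub_rev]
  ring

theorem form_add_left {N : ℕ} (β : ℝ) {f f' g : Rn N → ℝ≥0∞} (hf : AEMeasurable f)
    (hg : AEMeasurable g) : form β (f + f') g = form β f g + form β f' g := by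
  unfold form
  rw [← lintegral_add_left' (aemeasurable_form β hf hg)]
  congr 1 with z
  simp only [Pi.add_apply]
  ring

theorem form_mono {N : ℕ} (β : ℝ) {f f' g g' : Rn N → ℝ≥0∞} (hf : f ≤ᵐ[volume] f')
    (hg : g ≤ᵐ[volume] g') : form β f g ≤ form β f' g' := by
  apply lintegral_mono_ae
  filter_upwards [Measure.quasiMeasurePreserving_fst.ae hf,
    Measure.quasiMeasurePreserving_snd.ae hg] with z h1 h2
  gcongr

/-- Young's inequality for the trilinear form with two functions in `L^r`. -/
theorem young_le {N : ℕ} {r : ℝ} (hr1 : 1 < r) (hr2 : r < 2) {f g k : Rn N → ℝ≥0∞}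
    (hf : AEMeasurable f) (hg : AEMeasurable g) (hk : Measurable k) :
    ∫⁻ z : Rn N × Rn N, f z.1 * k (z.1 - z.2) * g z.2 ∂(volume.prod volume) ≤
      (∫⁻ z, k z ^ (1 / (2 - 2 / r))) ^ (2 - 2 / r) *
        ((∫⁻ x, f x ^ r) ^ (1 / r) * (∫⁻ x, g x ^ r) ^ (1 / r)) := by
  set a := 1 / (2 - 2 / r) with ha
  have hr0 : 0 < r := by linarith
  have h2r : 2 / r < 2 := by rw [div_lt_iff₀ hr0]; linarith
  have h2r' : 1 < 2 / r := by rw [lt_div_iff₀ hr0]; linarith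
  have he1 : 0 ≤ 2 / r - 1 := by linarith
  have he2 : 0 ≤ 1 - 1 / r := by
    have : 1 / r ≤ 1 := by rw [div_le_one hr0]; linarith
    linarith
  have ha0 : 0 < a := by rw [ha]; exact one_div_pos.2 (by linarith)
  set F := fun x => f x ^ r
  set G := fun x => g x ^ r
  set κ := fun x => k x ^ a
  have hF : AEMeasurable F := hf.pow_const r
  have hG : AEMeasurable G := hg.pow_const r
  have hκ : Measurable κ := hk.pow_const a
  have hκ' : AEMeasurable (fun z : Rn N × Rn N => κ (z.1 - z.2)) (volume.prod volume) :=
    (hκ.comp (measurable_fst.sub measurable_snd)).aemeasurable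
  -- Three-factor Hölder with weights 2/r - 1, 1 - 1/r, 1 - 1/r of sum 1, applied to products of two
  -- of f^r, g^r, k^a. In the product of the weighted factors each of f, g, k regains exponent 1,
  -- and every factor integrates explicitly by Tonelli and translation invariance.
  have hHolder := ENNReal.lintegral_prod_norm_pow_le (μ := (volume.prod volume))
    (Finset.univ : Finset (Fin 3))
    (f := ![fun z : Rn N × Rn N => F z.1 * G z.2, fun z => F z.1 * κ (z.1 - z.2),
      fun z => G z.2 * κ (z.1 - z.2)])
    (by
      intro i _
      fin_cases i
      · exact (aemeasurable_fst hF).mul (aemeasurable_snd hG)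
      · exact (aemeasurable_fst hF).mul hκ'
      · exact (aemeasurable_snd hG).mul hκ')
    (p := ![2 / r - 1, 1 - 1 / r, 1 - 1 / r])
    (by simp [Fin.sum_univ_three]; ring)
    (by intro i _; fin_cases i; exacts [he1, he2, he2])
  simp only [Fin.prod_univ_three, Matrix.cons_val_zero, Matrix.cons_val_one, Matrix.cons_val_two,
    Matrix.head_cons, Matrix.tail_cons] at hHolder
  have i1 : ∫⁻ z : Rn N × Rn N, F z.1 * G z.2 ∂(volume.prod volume) = (∫⁻ x, F x) * ∫⁻ x, G x :=
    lintegral_prod_mul hF hG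
  have i2 : ∫⁻ z : Rn N × Rn N, F z.1 * κ (z.1 - z.2) ∂(volume.prod volume)
      = (∫⁻ x, F x) * ∫⁻ x, κ x := by
    rw [lintegral_prod _ (by exact (aemeasurable_fst hF).mul hκ'), ← lintegral_mul_const'' _ hF]
    congr 1 with x
    dsimp only
    rw [lintegral_const_mul _ (by exact hκ.comp (measurable_const.sub measurable_id)),
      lintegral_sub_left_eq_self κ x]
  have i3 : ∫⁻ z : Rn N × Rn N, G z.2 * κ (z.1 - z.2) ∂(volume.prod volume)
      = (∫⁻ x, G x) * ∫⁻ x, κ x := by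
    rw [lintegral_prod_symm _ (by exact (aemeasurable_snd hG).mul hκ'), ← lintegral_mul_const'' _ hG]
    congr 1 with x
    dsimp only
    rw [lintegral_const_mul _ (by exact hκ.comp (measurable_id.sub measurable_const)),
      lintegral_sub_right_eq_self κ x]
  rw [i1, i2, i3] at hHolder
  refine le_trans (lintegral_mono fun z => ?_) (hHolder.trans_eq ?_)
  · simp only [F, G, κ]
    simp only [ENNReal.mul_rpow_of_nonneg _ _ he1, ENNReal.mul_rpow_of_nonneg _ _ he2,
      ← ENNReal.rpow_mul]
    have e1 : f z.1 = f z.1 ^ (r * (2 / r - 1)) * f z.1 ^ (r * (1 - 1 / r)) := by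
      rw [← ENNReal.rpow_add_of_nonneg _ _ (by positivity) (by positivity)]
      conv_lhs => rw [← ENNReal.rpow_one (f z.1)]
      congr 1; field_simp; ring
    have e2 : g z.2 = g z.2 ^ (r * (2 / r - 1)) * g z.2 ^ (r * (1 - 1 / r)) := by
      rw [← ENNReal.rpow_add_of_nonneg _ _ (by positivity) (by positivity)]
      conv_lhs => rw [← ENNReal.rpow_one (g z.2)]
      congr 1; field_simp; ring
    have e3 : k (z.1 - z.2) = k (z.1 - z.2) ^ (a * (1 - 1 / r)) *
        k (z.1 - z.2) ^ (a * (1 - 1 / r)) := by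
      rw [← ENNReal.rpow_add_of_nonneg _ _ (by positivity) (by positivity)]
      conv_lhs => rw [← ENNReal.rpow_one (k (z.1 - z.2))]
      congr 1
      rw [ha, ← mul_add, one_div, inv_mul_eq_div, eq_comm, div_eq_one_iff_eq (by linarith)]
      ring
    conv_lhs => rw [e1, e2, e3]
    apply le_of_eq
    ring
  · simp only [ENNReal.mul_rpow_of_nonneg _ _ he1, ENNReal.mul_rpow_of_nonneg _ _ he2]
    have hexp : 1 / r = (2 / r - 1) + (1 - 1 / r) := by ring
    have hexp2 : 2 - 2 / r = (1 - 1 / r) + (1 - 1 / r) := by ring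
    conv_rhs => rw [hexp, hexp2]
    simp only [ENNReal.rpow_add_of_nonneg _ _ he1 he2, ENNReal.rpow_add_of_nonneg _ _ he2 he2]
    ring

/-- The norm of `L¹ ∩ L^r`. -/
def xNorm {N : ℕ} (r : ℝ) (f : Rn N → ℝ≥0∞) : ℝ≥0∞ :=
  (∫⁻ x, f x) + (∫⁻ x, f x ^ r) ^ (1 / r)

theorem xNorm_mono {N : ℕ} {r : ℝ} (hr : 0 < r) {f g : Rn N → ℝ≥0∞} (h : f ≤ᵐ[volume] g) :
    xNorm r f ≤ xNorm r g := by
  unfold xNorm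
  refine add_le_add (lintegral_mono_ae h) ?_
  refine ENNReal.rpow_le_rpow (lintegral_mono_ae ?_) (by positivity)
  filter_upwards [h] with x hx
  gcongr

theorem xNorm_add_le {N : ℕ} {r : ℝ} (hr : 1 ≤ r) {f g : Rn N → ℝ≥0∞} (hf : AEMeasurable f)
    (hg : AEMeasurable g) : xNorm r (f + g) ≤ xNorm r f + xNorm r g := by
  unfold xNorm
  have h1 : ∫⁻ x, (f + g) x = (∫⁻ x, f x) + ∫⁻ x, g x := lintegral_add_left' hf g
  have h2 := ENNReal.lintegral_Lp_add_le hf hg hr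
  rw [h1]
  calc _ ≤ _ := add_le_add le_rfl h2
    _ = _ := by ring

theorem xNorm_const_mul {N : ℕ} {r : ℝ} (hr : 0 < r) {c : ℝ≥0∞} (hc : c ≠ ∞)
    (f : Rn N → ℝ≥0∞) : xNorm r (fun x => c * f x) = c * xNorm r f := by
  unfold xNorm
  simp only [ENNReal.mul_rpow_of_nonneg _ _ hr.le]
  rw [lintegral_const_mul' _ _ hc, lintegral_const_mul' _ _ (ENNReal.rpow_ne_top_of_nonneg hr.le hc),
    ENNReal.mul_rpow_of_nonneg _ _ (by positivity), ← ENNReal.rpow_mul, mul_one_div_cancel hr.ne',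
    ENNReal.rpow_one, mul_add]

theorem lintegral_riesz_ball_lt_top {N : ℕ} {β a : ℝ} (ρ : ℝ) (hN : 0 < N) (ha : 0 < a)
    (h : ((N : ℝ) - β) * a < N) :
    ∫⁻ z : Rn N, ((Metric.ball (0 : Rn N) ρ).indicator (riesz β) z) ^ a < ∞ := by
  have e : ∀ z : Rn N, ((Metric.ball (0 : Rn N) ρ).indicator (riesz β) z) ^ a =
      (Metric.ball (0 : Rn N) ρ).indicator
        (fun z => ENNReal.ofReal (‖z‖ ^ (-(((N : ℝ) - β) * a)))) z := by
    intro z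
    by_cases hz : z ∈ Metric.ball (0 : Rn N) ρ
    · rw [Set.indicator_of_mem hz, Set.indicator_of_mem hz, riesz,
        ENNReal.ofReal_rpow_of_nonneg (by positivity) ha.le, ← Real.rpow_mul (norm_nonneg _)]
      congr 2
      ring
    · rw [Set.indicator_of_notMem hz, Set.indicator_of_notMem hz, ENNReal.zero_rpow_of_pos ha]
  simp only [e]
  rw [lintegral_indicator measurableSet_ball]
  have hi : IntegrableOn (fun z : Rn N => ‖z‖ ^ (-(((N : ℝ) - β) * a)))
      (Metric.ball (0 : Rn N) ρ) volume := by
    refine integrableOn_ball_of_norm_le_rpow (C := 1) (α := ((N : ℝ) - β) * a)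
      (by simpa using Nat.succ_le_of_lt hN) (by simpa using h) ?_ (Measurable.aestronglyMeasurable (by fun_prop))
    filter_upwards with z
    rw [Real.norm_of_nonneg (by positivity), one_mul]
  exact hi.lintegral_lt_top

/-- The kernel is singular only near the diagonal, where Young's inequality applies, and is at most
ρ^(β-N) at distance at least ρ. Keeping ρ free lets the long-range term be made small when only the
L¹ norms are bounded. -/
theorem form_le_cut {N : ℕ} {β r ρ : ℝ} (hN : 0 < N) (hβN : β < N) (hr1 : 1 < r) (hr2 : r < 2)
    (hr : 2 / r < 1 + β / N) (hρ : 0 < ρ) : ∃ C : ℝ≥0∞, C ≠ ∞ ∧ ∀ f g : Rn N → ℝ≥0∞,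
      AEMeasurable f → AEMeasurable g → form β f g ≤
        C * ((∫⁻ x, f x ^ r) ^ (1 / r) * (∫⁻ x, g x ^ r) ^ (1 / r)) +
        ENNReal.ofReal (ρ ^ (β - (N : ℝ))) * ((∫⁻ x, f x) * ∫⁻ x, g x) := by
  have hr0 : 0 < r := by linarith
  have hN' : (0 : ℝ) < N := by exact_mod_cast hN
  have h2r : 2 / r < 2 := by rw [div_lt_iff₀ hr0]; linarith
  set k1 : Rn N → ℝ≥0∞ := (Metric.ball (0 : Rn N) ρ).indicator (riesz β) with hk1
  have hk1m : Measurable k1 := (measurable_riesz β).indicator measurableSet_ball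
  set K := (∫⁻ z, k1 z ^ (1 / (2 - 2 / r))) ^ (2 - 2 / r)
  have hK : K ≠ ∞ := by
    refine ENNReal.rpow_ne_top_of_nonneg (by linarith) (lintegral_riesz_ball_lt_top ρ hN
      (one_div_pos.2 (by linarith)) ?_).ne
    -- Local integrability of the required power of the kernel amounts to N - β < N(2 - 2/r), which
    -- is 2/r < 1 + β/N.
    rw [mul_one_div, div_lt_iff₀ (by linarith)]
    have : N * (2 / r) < N * (1 + β / N) := by gcongr
    rw [mul_add, mul_div_cancel₀ _ hN'.ne'] at this
    linarith
  refine ⟨K, hK, fun f g hf hg => ?_⟩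
  set κ := ENNReal.ofReal (ρ ^ (β - (N : ℝ))) with hκ
  have hk : ∀ z : Rn N, riesz β z ≤ k1 z + κ := by
    intro z
    by_cases hz : z ∈ Metric.ball (0 : Rn N) ρ
    · rw [hk1, Set.indicator_of_mem hz]
      exact le_self_add
    · rw [hk1, Set.indicator_of_notMem hz, zero_add, riesz, hκ]
      apply ENNReal.ofReal_le_ofReal
      simp only [Metric.mem_ball, dist_zero_right, not_lt] at hz
      exact Real.rpow_le_rpow_of_nonpos hρ hz (by linarith)
  have hf' := aemeasurable_fst hf
  have hg' := aemeasurable_snd hg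
  have hm : AEMeasurable (fun z : Rn N × Rn N => f z.1 * k1 (z.1 - z.2) * g z.2)
      (volume.prod volume) := (hf'.mul
        (hk1m.comp (measurable_fst.sub measurable_snd)).aemeasurable).mul hg'
  calc form β f g ≤ ∫⁻ z : Rn N × Rn N, (f z.1 * k1 (z.1 - z.2) * g z.2 + κ * (f z.1 * g z.2))
        ∂(volume.prod volume) := by
        apply lintegral_mono
        intro z
        calc f z.1 * riesz β (z.1 - z.2) * g z.2 ≤ f z.1 * (k1 (z.1 - z.2) + κ) * g z.2 := by
              gcongr
              exact hk _
          _ = _ := by ring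
    _ ≤ _ := by
        rw [lintegral_add_left' hm, lintegral_const_mul' _ _ ENNReal.ofReal_ne_top,
          lintegral_prod_mul hf hg]
        gcongr
        exact young_le hr1 hr2 hf hg hk1m

theorem form_le {N : ℕ} {β r : ℝ} (hN : 0 < N) (hβN : β < N) (hr1 : 1 < r) (hr2 : r < 2)
    (hr : 2 / r < 1 + β / N) : ∃ C : ℝ≥0∞, C ≠ ∞ ∧ ∀ f g : Rn N → ℝ≥0∞,
      AEMeasurable f → AEMeasurable g → form β f g ≤ C * (xNorm r f * xNorm r g) := by
  obtain ⟨K, hK, h⟩ := form_le_cut hN hβN hr1 hr2 hr one_pos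
  refine ⟨K + 1, by simp [hK], fun f g hf hg => (h f g hf hg).trans ?_⟩
  rw [Real.one_rpow, ENNReal.ofReal_one, add_mul]
  unfold xNorm
  gcongr
  · exact le_add_self
  · exact le_add_self
  · exact le_self_add
  · exact le_self_add

theorem form_far_le {N : ℕ} {β a b : ℝ} (hβN : β < N) (hab : a < b) {f g : Rn N → ℝ≥0∞}
    (hf : AEMeasurable f) (hg : AEMeasurable g) :
    form β ((Metric.ball (0 : Rn N) a).indicator f) ((Metric.ball (0 : Rn N) b)ᶜ.indicator g) ≤
      ENNReal.ofReal ((b - a) ^ (β - (N : ℝ))) * ((∫⁻ x, f x) * ∫⁻ x, g x) := by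
  rw [← lintegral_prod_mul hf hg, ← lintegral_const_mul' _ _ ENNReal.ofReal_ne_top]
  apply lintegral_mono
  intro z
  dsimp only
  by_cases h1 : z.1 ∈ Metric.ball (0 : Rn N) a
  · by_cases h2 : z.2 ∈ (Metric.ball (0 : Rn N) b)ᶜ
    · rw [Set.indicator_of_mem h1, Set.indicator_of_mem h2, mul_right_comm, mul_comm]
      gcongr
      apply ENNReal.ofReal_le_ofReal
      simp only [Metric.mem_ball, dist_zero_right, Set.mem_compl_iff, not_lt] at h1 h2
      apply Real.rpow_le_rpow_of_nonpos (by linarith) _ (by linarith)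
      have := norm_sub_norm_le z.2 z.1
      rw [norm_sub_rev] at this
      linarith
    · simp [Set.indicator_of_notMem h2]
  · simp [Set.indicator_of_notMem h1]

/-! ### The Hartree term -/

/-- The density `G(|u|)`. -/
def dens {𝕜 : Type} [RCLike 𝕜] {N : ℕ} (G : ℝ → ℝ) (u : L2 𝕜 N) (x : Rn N) : ℝ≥0∞ :=
  ENNReal.ofReal (G ‖u x‖)

theorem aemeasurable_dens {𝕜 : Type} [RCLike 𝕜] {N : ℕ} {G : ℝ → ℝ}
    (hG : ContinuousOn G (Set.Ici 0)) (u : L2 𝕜 N) : AEMeasurable (dens G u) := by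
  -- Nothing is known about G on the negative half-line, so measurability goes through the
  -- continuous function t ↦ G |t|.
  have hc : Continuous (fun t : ℝ => G |t|) :=
    hG.comp_continuous continuous_abs fun t => abs_nonneg t
  have h : dens G u = fun x => ENNReal.ofReal ((fun t : ℝ => G |t|) ‖u x‖) := by
    ext x; simp [dens]
  rw [h]
  exact (hc.measurable.comp_aemeasurable
    (Lp.aestronglyMeasurable u).norm.aemeasurable).ennreal_ofReal

theorem hartree_eq_form {𝕜 : Type} [RCLike 𝕜] {N : ℕ} {β : ℝ} {G : ℝ → ℝ}
    (hG : ContinuousOn G (Set.Ici 0)) (hG0 : ∀ t, 0 ≤ t → 0 ≤ G t) (u : L2 𝕜 N) :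
    hartree β G u = form β (dens G u) (dens G u) := by
  rw [form, lintegral_prod _ (aemeasurable_form β (aemeasurable_dens hG u) (aemeasurable_dens hG u)),
    hartree]
  congr 1 with x
  congr 1 with y
  rw [ENNReal.ofReal_mul (mul_nonneg (hG0 _ (norm_nonneg _)) (by positivity)),
    ENNReal.ofReal_mul (hG0 _ (norm_nonneg _))]
  rfl

/-! ### Admissible exponents -/

/-- The relations between the exponents used to estimate the Hartree term. -/
structure Exponents (N : ℕ) (s β μ r : ℝ) : Prop where
  hN : 0 < N
  hs : 0 < s
  hβN : β < N
  hμ : 2 ≤ μ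
  hr1 : 1 < r
  hr2 : r < 2
  hrβ : 2 / r < 1 + β / N
  hrμ : μ - 2 * s / N < 2 / r

/-- The condition μ < 1 + (2s + β)/N says that the interval between μ - 2s/N and 1 + β/N is
nonempty. Choosing 2/r there and above 1 gives r < 2, and β < N gives r > 1. -/
theorem exists_exponents {N : ℕ} {s β μ : ℝ} (hs : 0 < s) (hβ0 : 0 < β) (hβN : β < N)
    (hμ : 2 ≤ μ) (hμ' : μ < 1 + (2 * s + β) / N) : ∃ r, Exponents N s β μ r := by
  have hN : (0 : ℝ) < N := hβ0.trans hβN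
  have h1 : max 1 (μ - 2 * s / N) < 1 + β / N := by
    apply max_lt
    · have : 0 < β / N := by positivity
      linarith
    · rw [add_div] at hμ'
      linarith
  obtain ⟨ρ, hρ1, hρ2⟩ := exists_between h1
  have hρ : 1 < ρ := (le_max_left _ _).trans_lt hρ1
  have hρ' : μ - 2 * s / N < ρ := (le_max_right _ _).trans_lt hρ1
  have hβ1 : β / N < 1 := (div_lt_one hN).2 hβN
  refine ⟨2 / ρ, by exact_mod_cast hN, hs, hβN, hμ, ?_, ?_, ?_, ?_⟩
  · rw [lt_div_iff₀ (by linarith)]; linarith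
  · rw [div_lt_iff₀ (by linarith)]; linarith
  · rwa [div_div_cancel₀ (by norm_num)]
  · rwa [div_div_cancel₀ (by norm_num)]

namespace Exponents

variable {N : ℕ} {s β μ r p : ℝ}

theorem hN' (E : Exponents N s β μ r) : (0 : ℝ) < N := by exact_mod_cast E.hN

theorem hr0 (E : Exponents N s β μ r) : 0 < r := by linarith [E.hr1]

theorem mul_lt (E : Exponents N s β μ r) : N * (μ - 2 / r) < 2 * s := by
  have h := E.hrμ
  have hN := E.hN'
  have : μ - 2 / r < 2 * s / N := by linarith
  rwa [lt_div_iff₀' hN] at this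

theorem two_div_lt (E : Exponents N s β μ r) : 2 / r < 2 := by
  rw [div_lt_iff₀ E.hr0]; linarith [E.hr1]

theorem sub_two_lt (E : Exponents N s β μ r) (hp : p ≤ μ) : N * (p - 2) < 2 * s := by
  have h := E.mul_lt
  have hN := E.hN'
  have h2 := E.two_div_lt
  nlinarith

theorem mul_sub_two_lt (E : Exponents N s β μ r) (hp : p ≤ μ) : N * (p * r - 2) < 4 * s := by
  have h := E.mul_lt
  have hN := E.hN'
  have hr := E.hr0
  have h3 : N * (p - 2 / r) < 2 * s := by nlinarith
  have h4 : N * (p * r - 2) = r * (N * (p - 2 / r)) := by field_simp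
  rw [h4]
  nlinarith [E.hr2, E.hs]

theorem two_lt_mul (E : Exponents N s β μ r) (hp : 2 ≤ p) : 2 < p * r := by
  nlinarith [E.hr1]

end Exponents

/-! ### Integrals of powers -/

/-- `∫_S |u|^p`. -/
def pInt {𝕜 : Type} [RCLike 𝕜] {N : ℕ} (S : Set (Rn N)) (p : ℝ) (u : L2 𝕜 N) : ℝ≥0∞ :=
  ∫⁻ x in S, ‖u x‖ₑ ^ p

section pInt

variable {𝕜 : Type} [RCLike 𝕜] {N : ℕ} {s p : ℝ}

theorem pInt_mono {S T : Set (Rn N)} (h : S ⊆ T) (u : L2 𝕜 N) : pInt S p u ≤ pInt T p u :=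
  lintegral_mono_set h

theorem aemeasurable_enorm (u : L2 𝕜 N) : AEMeasurable (fun x => ‖u x‖ₑ) :=
  (Lp.aestronglyMeasurable u).enorm

theorem pInt_univ (u : L2 𝕜 N) : pInt Set.univ p u = ∫⁻ x, ‖u x‖ₑ ^ p := by
  rw [pInt, Measure.restrict_univ]

theorem gnExp_nonneg (hs : 0 < s) (hp : 2 ≤ p) : 0 ≤ gnExp N s p :=
  div_nonneg (mul_nonneg (Nat.cast_nonneg N) (by linarith)) (by linarith)

/-- The power of the mass norm in the Gagliardo–Nirenberg inequality is positive, so L² convergence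
to 0 with bounded kinetic energy passes to L^p. -/
theorem gnExp_lt (hs : 0 < s) (hp : 2 ≤ p) (hps : N * (p - 2) ≤ 4 * s) :
    0 < p - 2 * gnExp N s p := by
  have : gnExp N s p ≤ 1 := (div_le_one (by linarith)).2 hps
  rcases eq_or_lt_of_le hp with rfl | h
  · simp [gnExp]
  · linarith

theorem exists_pInt_le (𝕜 : Type) [RCLike 𝕜] {N : ℕ} {s p : ℝ} (hN : 0 < N) (hs : 0 < s)
    (hp : 2 ≤ p) (hps : N * (p - 2) ≤ 4 * s) {M : ℝ≥0∞} (hM : M ≠ ∞) :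
    ∃ C : ℝ≥0∞, C ≠ ∞ ∧ ∀ u : L2 𝕜 N, ‖u‖ₑ ≤ M →
      pInt Set.univ p u ≤ C * kinetic s u ^ gnExp N s p := by
  obtain ⟨C, hC, h⟩ := gagliardo_nirenberg 𝕜 hN hs hp hps
  have h0 := (gnExp_lt hs hp hps).le
  refine ⟨C * M ^ (p - 2 * gnExp N s p),
    ENNReal.mul_ne_top hC (ENNReal.rpow_ne_top_of_nonneg h0 hM), fun u hu => ?_⟩
  rw [pInt_univ]
  exact (h u).trans (by gcongr)

theorem exists_pInt_le_of_le (𝕜 : Type) [RCLike 𝕜] {N : ℕ} {s p : ℝ} (hN : 0 < N) (hs : 0 < s)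
    (hp : 2 ≤ p) (hps : N * (p - 2) ≤ 4 * s) {M K : ℝ≥0∞} (hM : M ≠ ∞) (hK : K ≠ ∞) :
    ∃ C : ℝ≥0∞, C ≠ ∞ ∧ ∀ u : L2 𝕜 N, ‖u‖ₑ ≤ M → kinetic s u ≤ K → pInt Set.univ p u ≤ C := by
  obtain ⟨C, hC, h⟩ := exists_pInt_le 𝕜 hN hs hp hps hM
  have h0 := gnExp_nonneg (N := N) hs hp
  refine ⟨C * K ^ gnExp N s p, ENNReal.mul_ne_top hC (ENNReal.rpow_ne_top_of_nonneg h0 hK),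
    fun u hu hk => (h u hu).trans (by gcongr)⟩

theorem tendsto_rpow_zero {f : ℕ → ℝ≥0∞} {a : ℝ} (ha : 0 < a) (h : Tendsto f atTop (𝓝 0)) :
    Tendsto (fun n => f n ^ a) atTop (𝓝 0) := by
  have := ((ENNReal.continuous_rpow_const (y := a)).tendsto 0).comp h
  rwa [ENNReal.zero_rpow_of_pos ha] at this

theorem tendsto_const_mul_zero {f : ℕ → ℝ≥0∞} {c : ℝ≥0∞} (hc : c ≠ ∞)
    (h : Tendsto f atTop (𝓝 0)) : Tendsto (fun n => c * f n) atTop (𝓝 0) := by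
  have := ENNReal.Tendsto.const_mul h (Or.inr hc)
  rwa [mul_zero] at this

theorem tendsto_zero_of_le {f g : ℕ → ℝ≥0∞} (h : Tendsto g atTop (𝓝 0)) (hfg : ∀ n, f n ≤ g n) :
    Tendsto f atTop (𝓝 0) :=
  tendsto_of_tendsto_of_tendsto_of_le_of_le tendsto_const_nhds h (fun _ => zero_le) hfg

theorem tendsto_pInt_of_norm (hN : 0 < N) (hs : 0 < s) (hp : 2 ≤ p) (hps : N * (p - 2) ≤ 4 * s)
    {K : ℝ≥0∞} (hK : K ≠ ∞) {v : ℕ → L2 𝕜 N} (hv : Tendsto (fun n => ‖v n‖ₑ) atTop (𝓝 0))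
    (hk : ∀ n, kinetic s (v n) ≤ K) : Tendsto (fun n => pInt Set.univ p (v n)) atTop (𝓝 0) := by
  obtain ⟨C, hC, h⟩ := gagliardo_nirenberg 𝕜 hN hs hp hps
  have h0 := gnExp_nonneg (N := N) hs hp
  have h1 := tendsto_const_mul_zero (ENNReal.mul_ne_top (ENNReal.rpow_ne_top_of_nonneg h0 hK) hC)
    (tendsto_rpow_zero (gnExp_lt hs hp hps) hv)
  refine tendsto_zero_of_le h1 fun n => ?_
  rw [pInt_univ]
  refine (h (v n)).trans ?_
  calc _ ≤ C * ‖v n‖ₑ ^ (p - 2 * gnExp N s p) * K ^ gnExp N s p := by gcongr; exact hk n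
    _ = _ := by ring

/-- Interpolation on S between a vanishing L² norm and a bounded L^q norm. -/
theorem tendsto_pInt_local (hN : 0 < N) (hs : 0 < s) (hp : 2 ≤ p) (hps : N * (p - 2) < 4 * s)
    {M K : ℝ≥0∞} (hM : M ≠ ∞) (hK : K ≠ ∞) {v : ℕ → L2 𝕜 N} (hvM : ∀ n, ‖v n‖ₑ ≤ M)
    (hk : ∀ n, kinetic s (v n) ≤ K) {S : Set (Rn N)}
    (hv : Tendsto (fun n => pInt S 2 (v n)) atTop (𝓝 0)) :
    Tendsto (fun n => pInt S p (v n)) atTop (𝓝 0) := by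
  have hN' : (0 : ℝ) < N := by exact_mod_cast hN
  -- The endpoint where N(q - 2) = 4s, so that `gnExp` equals 1; every p in the statement lies
  -- strictly below it.
  set q : ℝ := 2 + 4 * s / N with hq
  have hq2 : 0 < 4 * s / N := by positivity
  have hqs : N * (q - 2) ≤ 4 * s := by rw [hq]; field_simp; simp
  have hpq : p - 2 < 4 * s / N := by rwa [lt_div_iff₀' hN']
  obtain ⟨C, hC, h⟩ := exists_pInt_le_of_le 𝕜 hN hs (show 2 ≤ q by linarith) hqs hM hK
  set t := (p - 2) / (4 * s / N) with ht
  have ht0 : 0 ≤ t := div_nonneg (by linarith) hq2.le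
  have ht1 : t < 1 := (div_lt_one hq2).2 hpq
  have hpt : p = 2 * (1 - t) + q * t := by
    have : t * (4 * s / N) = p - 2 := div_mul_cancel₀ _ hq2.ne'
    rw [hq]; linarith
  refine tendsto_zero_of_le (tendsto_const_mul_zero (ENNReal.rpow_ne_top_of_nonneg ht0 hC)
    (tendsto_rpow_zero (show 0 < 1 - t by linarith) hv)) fun n => ?_
  have hm := (aemeasurable_enorm (v n)).restrict (s := S)
  have := ENNReal.lintegral_mul_norm_pow_le (μ := volume.restrict S) (hm.pow_const q)
    (hm.pow_const (2 : ℝ)) ht0 (show 0 ≤ 1 - t by linarith) (by ring)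
  calc pInt S p (v n) = ∫⁻ x in S, (‖v n x‖ₑ ^ q) ^ t * (‖v n x‖ₑ ^ (2 : ℝ)) ^ (1 - t) := by
        unfold pInt
        congr 1 with x
        rw [← ENNReal.rpow_mul, ← ENNReal.rpow_mul, ← ENNReal.rpow_add_of_nonneg _ _
          (by positivity) (mul_nonneg (by norm_num) (by linarith)), hpt, add_comm]
    _ ≤ (pInt S q (v n)) ^ t * (pInt S 2 (v n)) ^ (1 - t) := this
    _ ≤ _ := by
        gcongr
        exact (pInt_mono (Set.subset_univ S) _).trans (h _ (hvM n) (hk n))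

theorem mixed_le {S : Set (Rn N)} {a b : ℝ} (ha : 0 < a) (hb : 0 < b) (u v : L2 𝕜 N) :
    ∫⁻ x in S, ‖u x‖ₑ ^ a * ‖v x‖ₑ ^ b ≤
      pInt S (a + b) u ^ (a / (a + b)) * pInt S (a + b) v ^ (b / (a + b)) := by
  have hab : 0 < a + b := by linarith
  have := ENNReal.lintegral_mul_norm_pow_le (μ := volume.restrict S)
    ((aemeasurable_enorm u).restrict.pow_const (a + b))
    ((aemeasurable_enorm v).restrict.pow_const (a + b)) (p := a / (a + b)) (q := b / (a + b))
    (by positivity) (by positivity) (by field_simp)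
  refine le_trans (le_of_eq ?_) this
  congr 1 with x
  rw [← ENNReal.rpow_mul, ← ENNReal.rpow_mul, mul_div_cancel₀ _ hab.ne', mul_div_cancel₀ _ hab.ne']

/-- The mass of an integrable function outside large balls tends to zero. -/
theorem tendsto_setLIntegral_compl_ball {f : Rn N → ℝ≥0∞} (hf : ∫⁻ x, f x ≠ ∞) :
    Tendsto (fun n : ℕ => ∫⁻ x in (Metric.ball (0 : Rn N) n)ᶜ, f x) atTop (𝓝 0) := by
  have hlim : Tendsto (fun n : ℕ => volume.withDensity f (Metric.ball (0 : Rn N) n)ᶜ) atTop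
      (𝓝 (volume.withDensity f (⋂ n : ℕ, (Metric.ball (0 : Rn N) n)ᶜ))) := by
    refine tendsto_measure_iInter_atTop
      (fun n => measurableSet_ball.compl.nullMeasurableSet) (fun m n hmn => ?_) ⟨0, ?_⟩
    · exact Set.compl_subset_compl.2 (Metric.ball_subset_ball (by exact_mod_cast hmn))
    · rw [withDensity_apply _ measurableSet_ball.compl]
      exact ne_top_of_le_ne_top hf (setLIntegral_le_lintegral _ _)
  have he : (⋂ n : ℕ, (Metric.ball (0 : Rn N) n)ᶜ) = ∅ := by
    rw [← Set.compl_iUnion, Metric.iUnion_ball_nat, Set.compl_univ]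
  rw [he, measure_empty] at hlim
  refine hlim.congr fun n => ?_
  rw [withDensity_apply _ measurableSet_ball.compl]

/-- Outside a large ball the fixed function u has small L^p mass; inside it v n vanishes in L^p by
local convergence. Hölder joins the two factors in each region. -/
theorem tendsto_mixed (hN : 0 < N) (hs : 0 < s) {a b : ℝ} (ha : 0 < a) (hb : 0 < b)
    (hab : 2 ≤ a + b) (habs : N * (a + b - 2) < 4 * s)
    {M K : ℝ≥0∞} (hM : M ≠ ∞) (hK : K ≠ ∞) {u : L2 𝕜 N} (hu : kinetic s u ≠ ∞)
    {v : ℕ → L2 𝕜 N} (hvM : ∀ n, ‖v n‖ₑ ≤ M) (hk : ∀ n, kinetic s (v n) ≤ K)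
    (hv : ∀ m : ℕ, Tendsto (fun n => pInt (Metric.ball 0 m) 2 (v n)) atTop (𝓝 0)) :
    Tendsto (fun n => ∫⁻ x, ‖u x‖ₑ ^ a * ‖v n x‖ₑ ^ b) atTop (𝓝 0) := by
  set p := a + b with hp
  have hp0 : 0 < p := by linarith
  obtain ⟨C, hC, h⟩ := exists_pInt_le_of_le 𝕜 hN hs hab habs.le hM hK
  obtain ⟨C', hC', h'⟩ := exists_pInt_le_of_le 𝕜 hN hs hab habs.le (M := ‖u‖ₑ) (by simp) hu
  have hu' := h' u le_rfl le_rfl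
  have hfin : ∫⁻ x, ‖u x‖ₑ ^ p ≠ ∞ := by
    rw [← pInt_univ]; exact ne_top_of_le_ne_top hC' hu'
  have hap : 0 < a / p := by positivity
  have hbp : 0 < b / p := by positivity
  have htail : Tendsto (fun m : ℕ => C ^ (b / p) * pInt (Metric.ball (0 : Rn N) m)ᶜ p u ^ (a / p))
      atTop (𝓝 0) := tendsto_const_mul_zero (ENNReal.rpow_ne_top_of_nonneg hbp.le hC)
    (tendsto_rpow_zero hap (tendsto_setLIntegral_compl_ball hfin))
  rw [ENNReal.tendsto_nhds_zero]
  intro ε hε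
  have hε2 : 0 < ε / 2 := ENNReal.half_pos hε.ne'
  obtain ⟨m, hm⟩ := (ENNReal.tendsto_nhds_zero.1 htail (ε / 2) hε2).exists
  have hloc := tendsto_const_mul_zero (ENNReal.rpow_ne_top_of_nonneg hap.le hC')
    (tendsto_rpow_zero hbp (tendsto_pInt_local hN hs hab habs hM hK hvM hk (hv m)))
  filter_upwards [ENNReal.tendsto_nhds_zero.1 hloc (ε / 2) hε2] with n hn
  rw [← lintegral_add_compl _ (measurableSet_ball (x := (0 : Rn N)) (ε := (m : ℝ))),
    ← ENNReal.add_halves ε]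
  refine add_le_add ((mixed_le ha hb u (v n)).trans (le_trans ?_ hn))
    ((mixed_le ha hb u (v n)).trans (le_trans ?_ hm))
  · gcongr
    exact (pInt_mono (Set.subset_univ _) u).trans hu'
  · rw [mul_comm]
    gcongr
    exact (pInt_mono (Set.subset_univ _) _).trans (h _ (hvM n) (hk n))

end pInt

/-! ### Bounds for the density -/

section density

variable {𝕜 : Type} [RCLike 𝕜] {N : ℕ} {s β μ r : ℝ}

theorem xNorm_indicator_pow (hr : 0 < r) {p : ℝ} {S : Set (Rn N)} (hS : MeasurableSet S)
    (u : L2 𝕜 N) : xNorm r (S.indicator fun x => ‖u x‖ₑ ^ p) =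
      pInt S p u + pInt S (p * r) u ^ (1 / r) := by
  unfold xNorm pInt
  rw [lintegral_indicator hS, ← lintegral_indicator hS (fun x => ‖u x‖ₑ ^ (p * r))]
  congr 3 with x
  by_cases h : x ∈ S
  · simp [h, ENNReal.rpow_mul]
  · simp [h, hr]

/-- The sum of integrals of powers that controls the density `G(|u|)` on `S`. -/
def powSum (μ r : ℝ) (S : Set (Rn N)) (u : L2 𝕜 N) : ℝ≥0∞ :=
  (pInt S 2 u + pInt S (2 * r) u ^ (1 / r)) + (pInt S μ u + pInt S (μ * r) u ^ (1 / r))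

theorem dens_le {G : ℝ → ℝ} {η : ℝ} (hη : 0 < η) (hG : ∀ t, 0 ≤ t → G t ≤ η * (t ^ 2 + t ^ μ))
    (hμ : 0 ≤ μ) (u : L2 𝕜 N) (x : Rn N) :
    dens G u x ≤ ENNReal.ofReal η * (‖u x‖ₑ ^ (2 : ℝ) + ‖u x‖ₑ ^ μ) := by
  rw [dens, ← ofReal_norm, ENNReal.ofReal_rpow_of_nonneg (norm_nonneg _) hμ,
    ENNReal.ofReal_rpow_of_nonneg (norm_nonneg _) (by norm_num),
    ← ENNReal.ofReal_add (by positivity) (by positivity), ← ENNReal.ofReal_mul hη.le]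
  apply ENNReal.ofReal_le_ofReal
  simpa using hG _ (norm_nonneg (u x))

theorem xNorm_dens_le (hr : 1 ≤ r) (hμ : 0 ≤ μ) {G : ℝ → ℝ} {η : ℝ} (hη : 0 < η)
    (hG : ∀ t, 0 ≤ t → G t ≤ η * (t ^ 2 + t ^ μ)) {S : Set (Rn N)} (hS : MeasurableSet S)
    (u : L2 𝕜 N) :
    xNorm r (S.indicator (dens G u)) ≤ ENNReal.ofReal η * powSum μ r S u := by
  have hr0 : 0 < r := by linarith
  have hm := aemeasurable_enorm u
  rw [powSum, ← xNorm_indicator_pow hr0 hS, ← xNorm_indicator_pow hr0 hS]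
  refine le_trans ?_ (mul_le_mul_right (xNorm_add_le hr ((hm.pow_const 2).indicator hS)
    ((hm.pow_const μ).indicator hS)) _)
  rw [← xNorm_const_mul hr0 ENNReal.ofReal_ne_top]
  apply xNorm_mono hr0
  filter_upwards with x
  by_cases h : x ∈ S
  · simpa [h] using dens_le hη hG hμ u x
  · simp [h]

theorem xNorm_dens_univ_le (hr : 1 ≤ r) (hμ : 0 ≤ μ) {G : ℝ → ℝ} {η : ℝ} (hη : 0 < η)
    (hG : ∀ t, 0 ≤ t → G t ≤ η * (t ^ 2 + t ^ μ)) (u : L2 𝕜 N) :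
    xNorm r (dens G u) ≤ ENNReal.ofReal η * powSum μ r Set.univ u := by
  simpa using xNorm_dens_le hr hμ hη hG MeasurableSet.univ u

theorem tendsto_powSum (E : Exponents N s β μ r) {S : Set (Rn N)} {v : ℕ → L2 𝕜 N}
    (h : ∀ p, 2 ≤ p → N * (p - 2) < 4 * s → Tendsto (fun n => pInt S p (v n)) atTop (𝓝 0)) :
    Tendsto (fun n => powSum μ r S (v n)) atTop (𝓝 0) := by
  have hs := E.hs
  have hr := E.hr0
  have hr' : 0 < 1 / r := by positivity
  have key : ∀ p, 2 ≤ p → p ≤ μ →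
      Tendsto (fun n => pInt S p (v n) + pInt S (p * r) (v n) ^ (1 / r)) atTop (𝓝 0) := by
    intro p hp hpμ
    have h1 := h p hp (by linarith [E.sub_two_lt hpμ])
    have h2 := tendsto_rpow_zero hr' (h (p * r) (E.two_lt_mul hp).le (E.mul_sub_two_lt hpμ))
    simpa using h1.add h2
  simpa [powSum] using (key 2 le_rfl E.hμ).add (key μ E.hμ le_rfl)

/-- Subcritical bound of the density in `L¹ ∩ L^r` by the kinetic energy. -/
theorem exists_powSum_le (𝕜 : Type) [RCLike 𝕜] (E : Exponents N s β μ r) :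
    ∃ κ : ℝ, 0 ≤ κ ∧ κ < 1 / 2 ∧ ∀ M : ℝ≥0∞, M ≠ ∞ → ∃ C : ℝ≥0∞, C ≠ ∞ ∧
      ∀ u : L2 𝕜 N, ‖u‖ₑ ≤ M → powSum μ r Set.univ u ≤ C * (1 + kinetic s u) ^ κ := by
  have hs := E.hs
  have hr := E.hr0
  have hN := E.hN'
  have hμ := E.hμ
  have h2r := E.two_div_lt
  -- The largest of the four kinetic exponents that occur, namely the one coming from the L^(μr)
  -- term; `Exponents.mul_lt` makes it less than 1/2.
  set κ := N * (μ - 2 / r) / (4 * s) with hκ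
  have hκ0 : 0 ≤ κ := div_nonneg (mul_nonneg hN.le (by linarith)) (by linarith)
  have hκ1 : κ < 1 / 2 := by
    rw [hκ, div_lt_iff₀ (by linarith)]
    linarith [E.mul_lt]
  refine ⟨κ, hκ0, hκ1, fun M hM => ?_⟩
  have key : ∀ p, 2 ≤ p → p ≤ μ → ∃ C : ℝ≥0∞, C ≠ ∞ ∧ ∀ u : L2 𝕜 N, ‖u‖ₑ ≤ M →
      pInt Set.univ p u + pInt Set.univ (p * r) u ^ (1 / r) ≤ C * (1 + kinetic s u) ^ κ := by
    intro p hp hpμ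
    obtain ⟨C₁, hC₁, h₁⟩ := exists_pInt_le 𝕜 E.hN hs hp
      (by linarith [E.sub_two_lt hpμ]) hM
    obtain ⟨C₂, hC₂, h₂⟩ := exists_pInt_le 𝕜 E.hN hs (E.two_lt_mul hp).le
      (E.mul_sub_two_lt hpμ).le hM
    refine ⟨C₁ + C₂ ^ (1 / r), ENNReal.add_ne_top.2
      ⟨hC₁, ENNReal.rpow_ne_top_of_nonneg (by positivity) hC₂⟩, fun u hu => ?_⟩
    -- Replacing K by 1 + K makes the base at least 1, so the smaller exponents are absorbed by κ.
    have hmono : ∀ e, 0 ≤ e → e ≤ κ → kinetic s u ^ e ≤ (1 + kinetic s u) ^ κ := by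
      intro e he heκ
      calc kinetic s u ^ e ≤ (1 + kinetic s u) ^ e := by
            gcongr
            exact le_add_self
        _ ≤ _ := ENNReal.rpow_le_rpow_of_exponent_le le_self_add heκ
    rw [add_mul]
    refine add_le_add ?_ ?_
    · refine (h₁ u hu).trans ?_
      gcongr
      refine hmono _ (gnExp_nonneg hs hp) ?_
      rw [gnExp, hκ]
      gcongr
    · calc pInt Set.univ (p * r) u ^ (1 / r)
          ≤ (C₂ * kinetic s u ^ gnExp N s (p * r)) ^ (1 / r) := by gcongr; exact h₂ u hu
        _ = C₂ ^ (1 / r) * kinetic s u ^ (gnExp N s (p * r) * (1 / r)) := by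
            rw [ENNReal.mul_rpow_of_nonneg _ _ (by positivity), ← ENNReal.rpow_mul]
        _ ≤ _ := by
            gcongr
            refine hmono _ (mul_nonneg (gnExp_nonneg hs (E.two_lt_mul hp).le) (by positivity)) ?_
            have : gnExp N s (p * r) * (1 / r) = N * (p - 2 / r) / (4 * s) := by
              rw [gnExp]; field_simp
            rw [this, hκ]
            gcongr
  obtain ⟨C₁, hC₁, h₁⟩ := key 2 le_rfl hμ
  obtain ⟨C₂, hC₂, h₂⟩ := key μ hμ le_rfl
  refine ⟨C₁ + C₂, ENNReal.add_ne_top.2 ⟨hC₁, hC₂⟩, fun u hu => ?_⟩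
  rw [powSum, add_mul]
  exact add_le_add (h₁ u hu) (h₂ u hu)

end density

/-! ### High frequencies -/

section highFreq

variable {𝕜 : Type} [RCLike 𝕜] {N : ℕ} {s : ℝ}

theorem complexify_complex (u : L2 ℂ N) : complexify u = u := by
  ext1
  filter_upwards [coeFn_complexify u] with x hx
  rw [hx]
  simp

theorem ft_complex (u : L2 ℂ N) : ft ℂ N u = 𝓕 u := by
  rw [ft_apply, complexify_complex]

theorem setLIntegral_compl_ball_le (hs : 0 < s) {R : ℝ} (hR : 0 < R) (u : L2 𝕜 N) :
    ∫⁻ ξ in (Metric.ball (0 : Rn N) R)ᶜ, ‖ft 𝕜 N u ξ‖ₑ ^ 2 ≤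
      ENNReal.ofReal ((2 * Real.pi * R) ^ (-(2 * s))) * kinetic s u := by
  have hpi := Real.pi_pos
  rw [kinetic_eq, ← lintegral_const_mul' _ _ ENNReal.ofReal_ne_top]
  refine le_trans ?_ (setLIntegral_le_lintegral (Metric.ball (0 : Rn N) R)ᶜ _)
  refine setLIntegral_mono' measurableSet_ball.compl fun ξ hξ => ?_
  simp only [Set.mem_compl_iff, Metric.mem_ball, dist_zero_right, not_lt] at hξ
  rw [← mul_assoc, ← ENNReal.ofReal_mul (by positivity)]
  refine le_mul_of_one_le_left zero_le ?_
  rw [← ENNReal.ofReal_one]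
  apply ENNReal.ofReal_le_ofReal
  have h1 : (2 * Real.pi * R) ^ (2 * s) ≤ (2 * Real.pi * ‖ξ‖) ^ (2 * s) := by gcongr
  rw [Real.rpow_neg (by positivity), inv_mul_eq_div, one_le_div (by positivity)]
  exact h1

/-- The part of `u` with frequencies `|ξ| ≥ R`. -/
def highPart (R : ℝ) (u : L2 𝕜 N) : L2 ℂ N :=
  𝓕⁻ (cutOp (Metric.ball 0 R)ᶜ measurableSet_ball.compl (ft 𝕜 N u))

theorem highPart_ae_eq (R : ℝ) (u : L2 𝕜 N) :
    highPart R u =ᵐ[volume] fun x => complexify u x - lowPass R (ft 𝕜 N u) x :=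
  sub_lowPass_ae_eq R (complexify u)

theorem enorm_highPart_sq_le (hs : 0 < s) {R : ℝ} (hR : 0 < R) (u : L2 𝕜 N) :
    ‖highPart R u‖ₑ ^ 2 ≤ ENNReal.ofReal ((2 * Real.pi * R) ^ (-(2 * s))) * kinetic s u := by
  rw [highPart, enorm_fourierInv, enorm_cutOp_sq]
  exact setLIntegral_compl_ball_le hs hR u

theorem kinetic_highPart_le (R : ℝ) (u : L2 𝕜 N) : kinetic s (highPart R u) ≤ kinetic s u := by
  rw [kinetic_eq, kinetic_eq, ft_complex, highPart, FourierTransform.fourier_fourierInv_eq]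
  apply lintegral_mono_ae
  filter_upwards [coeFn_cutOp (Metric.ball 0 R)ᶜ measurableSet_ball.compl (ft 𝕜 N u)] with ξ hξ
  rw [hξ]
  by_cases h : ξ ∈ (Metric.ball (0 : Rn N) R)ᶜ
  · rw [Set.indicator_of_mem h]
  · rw [Set.indicator_of_notMem h]
    simp

theorem tendsto_two_pi_mul_rpow (hs : 0 < s) :
    Tendsto (fun n : ℕ => ENNReal.ofReal ((2 * Real.pi * ((n : ℝ) + 1)) ^ (-(2 * s)))) atTop
      (𝓝 0) := by
  rw [← ENNReal.ofReal_zero]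
  apply ENNReal.tendsto_ofReal
  have h1 : Tendsto (fun n : ℕ => 2 * Real.pi * ((n : ℝ) + 1)) atTop atTop :=
    (tendsto_atTop_add_const_right _ 1 tendsto_natCast_atTop_atTop).const_mul_atTop
      (by have := Real.pi_pos; positivity)
  exact (tendsto_rpow_neg_atTop (show 0 < 2 * s by linarith)).comp h1

theorem tendsto_zero_of_sq {f : ℕ → ℝ≥0∞} (h : Tendsto (fun n => f n ^ 2) atTop (𝓝 0)) :
    Tendsto f atTop (𝓝 0) := by
  refine (tendsto_rpow_zero (show (0 : ℝ) < 1 / 2 by norm_num) h).congr fun n => ?_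
  rw [← ENNReal.rpow_natCast, ← ENNReal.rpow_mul]
  simp

theorem lintegral_lowPass_sq_le (R : ℝ) (u : L2 𝕜 N) :
    ∫⁻ x, ‖lowPass R (ft 𝕜 N u) x‖ₑ ^ 2 ≤ ‖u‖ₑ ^ 2 := by
  have h : ∫⁻ x, ‖lowPass R (ft 𝕜 N u) x‖ₑ ^ 2 =
      ‖cutOp (Metric.ball 0 R) measurableSet_ball (ft 𝕜 N u)‖ₑ ^ 2 := by
    rw [← enorm_fourierInv, enorm_sq_eq_lintegral]
    apply lintegral_congr_ae
    filter_upwards [lowPass_ae_eq R (ft 𝕜 N u)] with x hx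
    rw [hx]
  rw [h, enorm_cutOp_sq, ← enorm_ft, enorm_sq_eq_lintegral]
  exact setLIntegral_le_lintegral _ _

/-- If the low-frequency parts vanish uniformly, all subcritical `L^p` norms tend to zero. -/
theorem tendsto_pInt_of_lowPass (hN : 0 < N) (hs : 0 < s) {p : ℝ} (hp : 2 < p)
    (hps : N * (p - 2) ≤ 4 * s) {M K : ℝ≥0∞} (hM : M ≠ ∞) (hK : K ≠ ∞) {u : ℕ → L2 𝕜 N}
    (huM : ∀ n, ‖u n‖ₑ ≤ M) (hk : ∀ n, kinetic s (u n) ≤ K) {c : ℕ → ℝ≥0∞}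
    (hc : Tendsto c atTop (𝓝 0))
    (hlow : ∀ (n : ℕ) (x : Rn N), ‖lowPass ((n : ℝ) + 1) (ft 𝕜 N (u n)) x‖ₑ ≤ c n) :
    Tendsto (fun n => pInt Set.univ p (u n)) atTop (𝓝 0) := by
  -- The high-frequency parts have squared mass at most K (2π(n + 1))^(-2s), and their kinetic
  -- energy stays bounded.
  have hh : Tendsto (fun n : ℕ => ‖highPart ((n : ℝ) + 1) (u n)‖ₑ) atTop (𝓝 0) := by
    apply tendsto_zero_of_sq
    have h1 := tendsto_const_mul_zero hK (tendsto_two_pi_mul_rpow hs)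
    refine tendsto_zero_of_le h1 fun n => ?_
    refine (enorm_highPart_sq_le hs (by positivity) (u n)).trans ?_
    rw [mul_comm]
    gcongr
    exact hk n
  have hhp := tendsto_pInt_of_norm hN hs hp.le hps hK hh
    (fun n => (kinetic_highPart_le _ _).trans (hk n))
  have hlp : Tendsto (fun n => M ^ 2 * c n ^ (p - 2)) atTop (𝓝 0) :=
    tendsto_const_mul_zero (ENNReal.pow_ne_top hM) (tendsto_rpow_zero (by linarith) hc)
  have hsum := tendsto_const_mul_zero (c := (2 : ℝ≥0∞) ^ (p - 1))
    (ENNReal.rpow_ne_top_of_nonneg (by linarith) (by norm_num)) (by simpa using hlp.add hhp)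
  refine tendsto_zero_of_le hsum fun n => ?_
  rw [pInt_univ, pInt_univ]
  set P := lowPass ((n : ℝ) + 1) (ft 𝕜 N (u n))
  have hPm : AEMeasurable (fun x => ‖P x‖ₑ ^ p) volume :=
    ((continuous_lowPass _ _).enorm.measurable.pow_const p).aemeasurable
  have hP : ∫⁻ x, ‖P x‖ₑ ^ p ≤ M ^ 2 * c n ^ (p - 2) := by
    calc ∫⁻ x, ‖P x‖ₑ ^ p ≤ ∫⁻ x, ‖P x‖ₑ ^ 2 * c n ^ (p - 2) := by
          apply lintegral_mono
          intro x
          dsimp only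
          conv_lhs => rw [show p = (2 : ℕ) + (p - 2) by push_cast; ring,
            ENNReal.rpow_add_of_nonneg _ _ (by norm_num) (by linarith), ENNReal.rpow_natCast]
          gcongr
          exact hlow n x
      _ = (∫⁻ x, ‖P x‖ₑ ^ 2) * c n ^ (p - 2) :=
          lintegral_mul_const _ ((continuous_lowPass _ _).enorm.measurable.pow_const 2)
      _ ≤ _ := by
          gcongr
          exact (lintegral_lowPass_sq_le _ _).trans (by gcongr; exact huM n)
  calc ∫⁻ x, ‖u n x‖ₑ ^ p
      ≤ ∫⁻ x, (2 : ℝ≥0∞) ^ (p - 1) * (‖P x‖ₑ ^ p + ‖highPart ((n : ℝ) + 1) (u n) x‖ₑ ^ p) := by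
        apply lintegral_mono_ae
        filter_upwards [enorm_complexify_ae (u n), highPart_ae_eq ((n : ℝ) + 1) (u n)] with x h1 h2
        refine le_trans ?_ (ENNReal.rpow_add_le_mul_rpow_add_rpow _ _ (by linarith))
        rw [← h1, h2]
        gcongr
        calc ‖complexify (u n) x‖ₑ = ‖P x + (complexify (u n) x - P x)‖ₑ := by
              rw [add_sub_cancel]
          _ ≤ _ := enorm_add_le _ _
    _ = (2 : ℝ≥0∞) ^ (p - 1) * ((∫⁻ x, ‖P x‖ₑ ^ p) +
        ∫⁻ x, ‖highPart ((n : ℝ) + 1) (u n) x‖ₑ ^ p) := by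
        rw [lintegral_const_mul' _ _ (ENNReal.rpow_ne_top_of_nonneg (by linarith) (by norm_num)),
          lintegral_add_left' hPm]
    _ ≤ _ := by gcongr

end highFreq

/-! ### Vanishing -/

section vanishing

variable {𝕜 : Type} [RCLike 𝕜] {N : ℕ} {s β μ r : ℝ}

/-- The L¹ part of `xNorm` is left out on purpose: it involves the exponent 2, where nothing
vanishes, whereas 2r and μr exceed 2. -/
theorem rNorm_dens_le (hr : 1 ≤ r) (hμ : 0 ≤ μ) {G : ℝ → ℝ} {η : ℝ} (hη : 0 < η)
    (hG : ∀ t, 0 ≤ t → G t ≤ η * (t ^ 2 + t ^ μ)) (u : L2 𝕜 N) :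
    (∫⁻ x, dens G u x ^ r) ^ (1 / r) ≤ ENNReal.ofReal η *
      (pInt Set.univ (2 * r) u ^ (1 / r) + pInt Set.univ (μ * r) u ^ (1 / r)) := by
  have hr0 : 0 < r := by linarith
  have hm := aemeasurable_enorm u
  rw [pInt_univ, pInt_univ]
  have h := ENNReal.lintegral_Lp_add_le (hm.pow_const (2 : ℝ)) (hm.pow_const μ) hr
  simp only [Pi.add_apply, ← ENNReal.rpow_mul] at h
  refine le_trans ?_ (mul_le_mul_right h _)
  calc (∫⁻ x, dens G u x ^ r) ^ (1 / r)
      ≤ (∫⁻ x, (ENNReal.ofReal η * (‖u x‖ₑ ^ (2 : ℝ) + ‖u x‖ₑ ^ μ)) ^ r) ^ (1 / r) := by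
        gcongr with x
        exact dens_le hη hG hμ u x
    _ = _ := by
        simp only [ENNReal.mul_rpow_of_nonneg _ _ hr0.le]
        rw [lintegral_const_mul' _ _ (ENNReal.rpow_ne_top_of_nonneg hr0.le ENNReal.ofReal_ne_top),
          ENNReal.mul_rpow_of_nonneg _ _ (by positivity), ← ENNReal.rpow_mul,
          mul_one_div_cancel hr0.ne', ENNReal.rpow_one]

theorem exists_xNorm_dens_le (𝕜 : Type) [RCLike 𝕜] (E : Exponents N s β μ r) {G : ℝ → ℝ} {η : ℝ}
    (hη : 0 < η) (hG : ∀ t, 0 ≤ t → G t ≤ η * (t ^ 2 + t ^ μ)) {M K : ℝ≥0∞} (hM : M ≠ ∞)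
    (hK : K ≠ ∞) : ∃ C : ℝ≥0∞, C ≠ ∞ ∧ ∀ u : L2 𝕜 N, ‖u‖ₑ ≤ M → kinetic s u ≤ K →
      xNorm r (dens G u) ≤ C := by
  obtain ⟨κ, hκ0, -, h⟩ := exists_powSum_le 𝕜 E
  obtain ⟨C, hC, h⟩ := h M hM
  refine ⟨ENNReal.ofReal η * (C * (1 + K) ^ κ), ENNReal.mul_ne_top ENNReal.ofReal_ne_top
    (ENNReal.mul_ne_top hC (ENNReal.rpow_ne_top_of_nonneg hκ0 (by simp [hK]))), fun u hu hk => ?_⟩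
  refine (xNorm_dens_univ_le E.hr1.le (by linarith [E.hμ]) hη hG u).trans ?_
  gcongr
  exact (h u hu).trans (by gcongr)

/-- The mass need not vanish, so the L¹ norm of the density is merely bounded. The long-range part
of the kernel is small by its decay, the short-range part by the vanishing L^r norm. -/
theorem tendsto_form_dens_of_pInt (E : Exponents N s β μ r) {G : ℝ → ℝ} {η : ℝ}
    (hη : 0 < η) (hG : ∀ t, 0 ≤ t → G t ≤ η * (t ^ 2 + t ^ μ)) (hGc : ContinuousOn G (Set.Ici 0))
    {M K : ℝ≥0∞} (hM : M ≠ ∞) (hK : K ≠ ∞) {u : ℕ → L2 𝕜 N}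
    (huM : ∀ n, ‖u n‖ₑ ≤ M) (hk : ∀ n, kinetic s (u n) ≤ K)
    (h : ∀ p, 2 < p → N * (p - 2) < 4 * s →
      Tendsto (fun n => pInt Set.univ p (u n)) atTop (𝓝 0)) :
    Tendsto (fun n => form β (dens G (u n)) (dens G (u n))) atTop (𝓝 0) := by
  have hμ := E.hμ
  have hr' : 0 < 1 / r := by have := E.hr0; positivity
  obtain ⟨C, hC, hX⟩ := exists_xNorm_dens_le 𝕜 E hη hG hM hK
  have hfar : Tendsto (fun n : ℕ => (C * C) * ENNReal.ofReal (((n : ℝ) + 1) ^ (β - (N : ℝ)))) atTop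
      (𝓝 0) := by
    apply tendsto_const_mul_zero (ENNReal.mul_ne_top hC hC)
    rw [← ENNReal.ofReal_zero]
    apply ENNReal.tendsto_ofReal
    have h0 := tendsto_rpow_neg_atTop (show 0 < (N : ℝ) - β by linarith [E.hβN])
    rw [neg_sub] at h0
    exact h0.comp (tendsto_atTop_add_const_right _ 1 tendsto_natCast_atTop_atTop)
  have hnear : Tendsto (fun n => (∫⁻ x, dens G (u n) x ^ r) ^ (1 / r)) atTop (𝓝 0) := by
    refine tendsto_zero_of_le (tendsto_const_mul_zero ENNReal.ofReal_ne_top ?_)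
      (fun n => rNorm_dens_le E.hr1.le (by linarith) hη hG (u n))
    simpa using (tendsto_rpow_zero hr' (h _ (E.two_lt_mul le_rfl) (E.mul_sub_two_lt hμ))).add
      (tendsto_rpow_zero hr' (h _ (E.two_lt_mul hμ) (E.mul_sub_two_lt le_rfl)))
  rw [ENNReal.tendsto_nhds_zero]
  intro ε hε
  have hε2 : 0 < ε / 2 := ENNReal.half_pos hε.ne'
  -- The cut-off radius is fixed before n, since the constant of the short-range part depends on it.
  obtain ⟨m, hm⟩ := (ENNReal.tendsto_nhds_zero.1 hfar (ε / 2) hε2).exists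
  obtain ⟨A, hA, hform⟩ := form_le_cut (ρ := (m : ℝ) + 1) E.hN E.hβN E.hr1 E.hr2 E.hrβ
    (by positivity)
  have hnear2 := tendsto_const_mul_zero hA (f := fun n =>
    (∫⁻ x, dens G (u n) x ^ r) ^ (1 / r) * (∫⁻ x, dens G (u n) x ^ r) ^ (1 / r))
    (by simpa using ENNReal.Tendsto.mul hnear (by simp) hnear (by simp))
  filter_upwards [ENNReal.tendsto_nhds_zero.1 hnear2 (ε / 2) hε2] with n hn
  refine (hform _ _ (aemeasurable_dens hGc _) (aemeasurable_dens hGc _)).trans ?_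
  rw [← ENNReal.add_halves ε]
  refine add_le_add hn (le_trans ?_ hm)
  rw [mul_comm]
  have : ∫⁻ x, dens G (u n) x ≤ C := le_trans le_self_add (hX (u n) (huM n) (hk n))
  gcongr

/-- A function with non-negligible Hartree energy has a non-negligible low-frequency part. -/
theorem exists_lowPass_large (𝕜 : Type) [RCLike 𝕜] (E : Exponents N s β μ r) {G : ℝ → ℝ} {η : ℝ}
    (hη : 0 < η) (hG : ∀ t, 0 ≤ t → G t ≤ η * (t ^ 2 + t ^ μ)) (hGc : ContinuousOn G (Set.Ici 0))
    (hG0 : ∀ t, 0 ≤ t → 0 ≤ G t) {M K ε : ℝ≥0∞} (hM : M ≠ ∞) (hK : K ≠ ∞) (hε : 0 < ε) :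
    ∃ R c : ℝ, 0 < c ∧ ∀ u : L2 𝕜 N, ‖u‖ₑ ≤ M → kinetic s u ≤ K → ε ≤ hartree β G u →
      ∃ x, c < ‖lowPass R (ft 𝕜 N u) x‖ := by
  by_contra! hcon
  -- Failure for the cut-off R = n + 1 and threshold 1/(n + 1) produces a sequence whose
  -- low-frequency parts vanish uniformly while the cut-off exhausts all frequencies.
  choose u hu using fun n : ℕ => hcon ((n : ℝ) + 1) (1 / ((n : ℝ) + 1)) (by positivity)
  have hc : Tendsto (fun n : ℕ => ENNReal.ofReal (1 / ((n : ℝ) + 1))) atTop (𝓝 0) := by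
    rw [← ENNReal.ofReal_zero]
    exact ENNReal.tendsto_ofReal tendsto_one_div_add_atTop_nhds_zero_nat
  have hlim := tendsto_form_dens_of_pInt E hη hG hGc hM hK (fun n => (hu n).1)
    (fun n => (hu n).2.1) (fun p hp hps => tendsto_pInt_of_lowPass E.hN E.hs hp hps.le hM hK
      (fun n => (hu n).1) (fun n => (hu n).2.1) hc (fun n x => by
        rw [← ofReal_norm]
        exact ENNReal.ofReal_le_ofReal ((hu n).2.2.2 x)))
  have := ge_of_tendsto hlim (b := ε) (Eventually.of_forall fun n => by
    rw [← hartree_eq_form hGc hG0]; exact (hu n).2.2.1)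
  exact absurd this (not_le.2 hε)

end vanishing

/-! ### Local compactness -/

section rellich

variable {𝕜 : Type} [RCLike 𝕜] {N : ℕ} {s : ℝ}

/-- Evaluating the low-frequency part at a point is pairing with a fixed L² function, so weak
convergence becomes pointwise convergence. -/
theorem tendsto_lowPass {v : ℕ → L2 𝕜 N} {w : L2 𝕜 N}
    (hv : ∀ g : L2 ℂ N, Tendsto (fun n => inner ℂ g (ft 𝕜 N (v n))) atTop
      (𝓝 (inner ℂ g (ft 𝕜 N w)))) (R : ℝ) (x : Rn N) :
    Tendsto (fun n => lowPass R (ft 𝕜 N (v n)) x) atTop (𝓝 (lowPass R (ft 𝕜 N w) x)) := by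
  obtain ⟨g, hg, -⟩ := exists_inner_eq_lowPass R x
  simp only [hg]
  exact hv g

/-- Rellich's theorem: weakly null bounded sequences in `H^s` are null in `L²_loc`. -/
theorem tendsto_pInt_ball_of_weak (hs : 0 < s) {M K : ℝ≥0∞} (hM : M ≠ ∞)
    (hK : K ≠ ∞) {v : ℕ → L2 𝕜 N} (hvM : ∀ n, ‖v n‖ₑ ≤ M) (hk : ∀ n, kinetic s (v n) ≤ K)
    (hv : ∀ g : L2 ℂ N, Tendsto (fun n => inner ℂ g (ft 𝕜 N (v n))) atTop (𝓝 0)) (m : ℕ) :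
    Tendsto (fun n => pInt (Metric.ball (0 : Rn N) m) 2 (v n)) atTop (𝓝 0) := by
  set B := Metric.ball (0 : Rn N) (m : ℝ)
  have hfreq := tendsto_const_mul_zero (c := 2 * K) (ENNReal.mul_ne_top (by norm_num) hK)
    (tendsto_two_pi_mul_rpow hs)
  rw [ENNReal.tendsto_nhds_zero]
  intro ε hε
  have hε2 : 0 < ε / 2 := ENNReal.half_pos hε.ne'
  -- The frequency cut-off R = j + 1 makes the high-frequency part small uniformly in n; the
  -- low-frequency part is then handled by dominated convergence on the ball.
  obtain ⟨j, hj⟩ := (ENNReal.tendsto_nhds_zero.1 hfreq (ε / 2) hε2).exists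
  set R : ℝ := (j : ℝ) + 1
  have hR : 0 < R := by positivity
  have hlow : Tendsto (fun n => ∫⁻ x in B, ‖lowPass R (ft 𝕜 N (v n)) x‖ₑ ^ 2) atTop (𝓝 0) := by
    set A := (volume (Metric.ball (0 : Rn N) R)) ^ (1 / 2 : ℝ) * M
    have hA : A ≠ ∞ := ENNReal.mul_ne_top
      (ENNReal.rpow_ne_top_of_nonneg (by norm_num) measure_ball_lt_top.ne) hM
    have := tendsto_lintegral_of_dominated_convergence (μ := volume.restrict B)
      (F := fun n x => ‖lowPass R (ft 𝕜 N (v n)) x‖ₑ ^ 2) (f := fun _ => 0) (fun _ => A ^ 2)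
      (fun n => (continuous_lowPass _ _).enorm.measurable.pow_const 2)
      (fun n => Eventually.of_forall fun x => by
        refine pow_le_pow_left' ((enorm_lowPass_le R _ x).trans ?_) 2
        rw [enorm_ft]
        exact mul_le_mul_right (hvM n) _)
      (by
        rw [setLIntegral_const]
        exact ENNReal.mul_ne_top (ENNReal.pow_ne_top hA) measure_ball_lt_top.ne)
      (Eventually.of_forall fun x => by
        have h0 := tendsto_lowPass (v := v) (w := 0) (fun g => by simpa using hv g) R x
        obtain ⟨g, hg, -⟩ := exists_inner_eq_lowPass R x
        rw [hg (ft 𝕜 N 0), map_zero, inner_zero_right] at h0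
        have h1 := ((ENNReal.continuous_pow 2).comp continuous_enorm).tendsto (0 : ℂ) |>.comp h0
        simpa [Function.comp_def] using h1)
    simpa using this
  have hlow2 := tendsto_const_mul_zero (c := 2) (by norm_num) hlow
  filter_upwards [ENNReal.tendsto_nhds_zero.1 hlow2 (ε / 2) hε2] with n hn
  set P := lowPass R (ft 𝕜 N (v n))
  have hPm : Measurable (fun x => 2 * ‖P x‖ₑ ^ 2) :=
    ((continuous_lowPass _ _).enorm.measurable.pow_const 2).const_mul 2
  calc pInt B 2 (v n) ≤ ∫⁻ x in B, (2 * ‖P x‖ₑ ^ 2 + 2 * ‖highPart R (v n) x‖ₑ ^ 2) := by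
        apply lintegral_mono_ae
        filter_upwards [ae_restrict_of_ae (enorm_complexify_ae (v n)),
          ae_restrict_of_ae (highPart_ae_eq R (v n))] with x h1 h2
        rw [← h1, h2, ENNReal.rpow_two]
        have h3 : ‖complexify (v n) x‖ₑ ≤ ‖P x‖ₑ + ‖complexify (v n) x - P x‖ₑ := by
          calc ‖complexify (v n) x‖ₑ = ‖P x + (complexify (v n) x - P x)‖ₑ := by
                rw [add_sub_cancel]
            _ ≤ _ := enorm_add_le _ _
        refine (pow_le_pow_left' h3 2).trans ?_
        have h4 := ENNReal.rpow_add_le_mul_rpow_add_rpow ‖P x‖ₑ ‖complexify (v n) x - P x‖ₑ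
          (p := 2) (by norm_num)
        simp only [ENNReal.rpow_two] at h4
        refine h4.trans_eq ?_
        norm_num
        ring
    _ = 2 * (∫⁻ x in B, ‖P x‖ₑ ^ 2) + 2 * ∫⁻ x in B, ‖highPart R (v n) x‖ₑ ^ 2 := by
        rw [lintegral_add_left hPm, lintegral_const_mul' _ _ (by norm_num),
          lintegral_const_mul' _ _ (by norm_num)]
    _ ≤ ε / 2 + ε / 2 := by
        refine add_le_add hn (le_trans ?_ hj)
        calc 2 * ∫⁻ x in B, ‖highPart R (v n) x‖ₑ ^ 2 ≤ 2 * ‖highPart R (v n)‖ₑ ^ 2 := by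
              rw [enorm_sq_eq_lintegral]
              gcongr
              exact Measure.restrict_le_self
          _ ≤ 2 * (ENNReal.ofReal ((2 * Real.pi * R) ^ (-(2 * s))) * K) := by
              gcongr
              exact (enorm_highPart_sq_le hs hR _).trans (by gcongr; exact hk n)
          _ = _ := by ring
    _ = ε := ENNReal.add_halves ε

end rellich

/-! ### Translations -/

section translation

variable {𝕜 : Type} [RCLike 𝕜] {N : ℕ}

theorem coeFn_translate (y : Rn N) (u : L2 𝕜 N) :
    translate y u =ᵐ[volume] fun x => u (x + y) :=
  Lp.coeFn_compMeasurePreserving u (measurePreserving_add_right volume y)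

theorem norm_translate (y : Rn N) (u : L2 𝕜 N) : ‖translate y u‖ = ‖u‖ :=
  Lp.norm_compMeasurePreserving u (measurePreserving_add_right volume y)

theorem continuous_translate (y : Rn N) : Continuous (translate y : L2 𝕜 N → L2 𝕜 N) :=
  (Lp.compMeasurePreservingₗᵢ 𝕜 (fun x : Rn N => x + y)
    (measurePreserving_add_right volume y)).continuous

theorem measurable_phase (y : Rn N) :
    Measurable fun ξ : Rn N => ((Real.fourierChar (inner ℝ y ξ) : Circle) : ℂ) :=
  Continuous.measurable (by fun_prop)

theorem norm_phase_le (y ξ : Rn N) : ‖((Real.fourierChar (inner ℝ y ξ) : Circle) : ℂ)‖ ≤ 1 :=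
  (Circle.norm_coe _).le

/-- Translation becomes multiplication by a unimodular phase. For Schwartz functions this is a
change of variables in the Fourier integral; both sides are continuous on L², so density finishes.
-/
theorem fourier_translate (y : Rn N) (w : L2 ℂ N) :
    (𝓕 (translate y w) : L2 ℂ N) =
      mulOp _ (measurable_phase y) (norm_phase_le y) (𝓕 w : L2 ℂ N) := by
  refine DenseRange.induction_on (p := fun w : L2 ℂ N => (𝓕 (translate y w) : L2 ℂ N) =
      mulOp _ (measurable_phase y) (norm_phase_le y) (𝓕 w : L2 ℂ N))
    (SchwartzMap.denseRange_toLpCLM (E := Rn N) (F := ℂ) (μ := volume) (p := 2)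
      ENNReal.ofNat_ne_top) w ?_ ?_
  · apply isClosed_eq
    · exact (Lp.fourierTransformₗᵢ (Rn N) ℂ).continuous.comp (continuous_translate y)
    · exact (mulOp _ (measurable_phase y) (norm_phase_le y)).continuous.comp
        (Lp.fourierTransformₗᵢ (Rn N) ℂ).continuous
  · intro φ
    set w : L2 ℂ N := SchwartzMap.toLpCLM ℝ ℂ 2 volume φ
    have hw : w =ᵐ[volume] φ := SchwartzMap.coeFn_toLp φ 2 volume
    have hwi : Integrable w := φ.integrable.congr hw.symm
    have htw := coeFn_translate y w
    have htwi : Integrable (translate y w) :=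
      (hwi.comp_add_right y).congr htw.symm
    ext1
    filter_upwards [fourier_ae_eq _ htwi, fourier_ae_eq _ hwi, coeFn_mulOp _ (measurable_phase y)
      (norm_phase_le y) (𝓕 w : L2 ℂ N)] with ξ h1 h2 h3
    rw [h1, h3, h2, Real.fourier_congr_ae htw]
    have := congrFun (VectorFourier.fourierIntegral_comp_add_right Real.fourierChar volume
      (innerₗ (Rn N)) (w : Rn N → ℂ) y) ξ
    exact this

theorem complexify_translate (y : Rn N) (u : L2 𝕜 N) :
    complexify (translate y u) = translate y (complexify u) := by
  ext1
  have h := (measurePreserving_add_right (volume : Measure (Rn N)) y).quasiMeasurePreserving.ae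
    (coeFn_complexify u)
  filter_upwards [coeFn_complexify (translate y u), coeFn_translate y u,
    coeFn_translate y (complexify u), h] with x h1 h2 h3 h4
  rw [h1, h2, h3, h4]

theorem ft_translate_ae (y : Rn N) (u : L2 𝕜 N) :
    ft 𝕜 N (translate y u) =ᵐ[volume]
      fun ξ => ((Real.fourierChar (inner ℝ y ξ) : Circle) : ℂ) * ft 𝕜 N u ξ := by
  rw [ft_apply, complexify_translate, fourier_translate]
  exact coeFn_mulOp _ _ _ _

theorem kinetic_translate (s : ℝ) (y : Rn N) (u : L2 𝕜 N) :
    kinetic s (translate y u) = kinetic s u := by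
  rw [kinetic_eq, kinetic_eq]
  apply lintegral_congr_ae
  filter_upwards [ft_translate_ae y u] with ξ hξ
  rw [hξ, enorm_mul, ← ofReal_norm (((Real.fourierChar (inner ℝ y ξ) : Circle) : ℂ)),
    Circle.norm_coe, ENNReal.ofReal_one, one_mul]

/-- Moves the point where the low-frequency part is large to the origin, as
`exists_subseq_tendstoHs` requires. -/
theorem lowPass_translate (R : ℝ) (y : Rn N) (u : L2 𝕜 N) :
    lowPass R (ft 𝕜 N (translate y u)) 0 = lowPass R (ft 𝕜 N u) y := by
  rw [lowPass, lowPass, Real.fourierInv_eq, Real.fourierInv_eq]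
  apply integral_congr_ae
  filter_upwards [ft_translate_ae y u] with ξ hξ
  by_cases h : ξ ∈ Metric.ball (0 : Rn N) R
  · rw [Set.indicator_of_mem h, Set.indicator_of_mem h, hξ]
    simp [Circle.smul_def, real_inner_comm]
  · rw [Set.indicator_of_notMem h, Set.indicator_of_notMem h]
    simp

theorem hartree_translate (β : ℝ) (G : ℝ → ℝ) (y : Rn N) (u : L2 𝕜 N) :
    hartree β G (translate y u) = hartree β G u := by
  unfold hartree
  have hy := coeFn_translate y u
  have h1 : ∫⁻ x : Rn N, ∫⁻ z : Rn N, ENNReal.ofReal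
      (G ‖translate y u x‖ * ‖x - z‖ ^ (β - (N : ℝ)) * G ‖translate y u z‖) =
      ∫⁻ x : Rn N, ∫⁻ z : Rn N, ENNReal.ofReal
        (G ‖u (x + y)‖ * ‖(x + y) - (z + y)‖ ^ (β - (N : ℝ)) * G ‖u (z + y)‖) := by
    apply lintegral_congr_ae
    filter_upwards [hy] with x hx
    apply lintegral_congr_ae
    filter_upwards [hy] with z hz
    rw [hx, hz, add_sub_add_right_eq_sub]
  rw [h1, lintegral_add_right_eq_self (fun x => ∫⁻ z : Rn N, ENNReal.ofReal
        (G ‖u x‖ * ‖x - (z + y)‖ ^ (β - (N : ℝ)) * G ‖u (z + y)‖)) y]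
  congr 1 with x
  exact lintegral_add_right_eq_self (fun z => ENNReal.ofReal
        (G ‖u x‖ * ‖x - z‖ ^ (β - (N : ℝ)) * G ‖u z‖)) y

end translation

/-! ### Weak limits -/

/-- Sequential Banach–Alaoglu in a separable Hilbert space, carried back from the dual by the Riesz
isomorphism. -/
theorem exists_weak_subseq {H : Type*} [NormedAddCommGroup H] [InnerProductSpace ℝ H]
    [CompleteSpace H] [TopologicalSpace.SeparableSpace H] (x : ℕ → H) {M : ℝ}
    (hx : ∀ n, ‖x n‖ ≤ M) : ∃ (a : H) (φ : ℕ → ℕ), StrictMono φ ∧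
      ∀ l : H →L[ℝ] ℝ, Tendsto (fun n => l (x (φ n))) atTop (𝓝 (l a)) := by
  have hmem : ∀ n, StrongDual.toWeakDual (InnerProductSpace.toDual ℝ H (x n)) ∈
      (WeakDual.toStrongDual ⁻¹' Metric.closedBall (0 : StrongDual ℝ H) M) := by
    intro n
    simpa using hx n
  obtain ⟨A, -, φ, hφ, hlim⟩ := WeakDual.isSeqCompact_closedBall ℝ H 0 M hmem
  refine ⟨(InnerProductSpace.toDual ℝ H).symm (WeakDual.toStrongDual A), φ, hφ, fun l => ?_⟩
  have h1 := ((WeakDual.eval_continuous ((InnerProductSpace.toDual ℝ H).symm l)).tendsto A).comp hlim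
  have e : ∀ z : H, l z = inner ℝ z ((InnerProductSpace.toDual ℝ H).symm l) := fun z => by
    rw [real_inner_comm, InnerProductSpace.toDual_symm_apply]
  simp only [e]
  rw [InnerProductSpace.toDual_symm_apply]
  exact h1

/-- The difference equals 2⟨x n, a⟩ - ‖a‖², which is affine in x n and so passes to weak limits. -/
theorem tendsto_norm_sq_sub {H : Type*} [NormedAddCommGroup H] [InnerProductSpace ℝ H]
    {x : ℕ → H} {a : H} (h : ∀ l : H →L[ℝ] ℝ, Tendsto (fun n => l (x n)) atTop (𝓝 (l a))) :
    Tendsto (fun n => ‖x n‖ ^ 2 - ‖x n - a‖ ^ 2) atTop (𝓝 (‖a‖ ^ 2)) := by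
  have h1 := h (innerSL ℝ a)
  simp only [innerSL_apply_apply, real_inner_self_eq_norm_sq] at h1
  have h2 := (h1.const_mul 2).sub_const (‖a‖ ^ 2)
  rw [show 2 * ‖a‖ ^ 2 - ‖a‖ ^ 2 = ‖a‖ ^ 2 by ring] at h2
  refine h2.congr fun n => ?_
  rw [norm_sub_sq_real, real_inner_comm]
  ring

section weak

variable {𝕜 : Type} [RCLike 𝕜] {N : ℕ} {s : ℝ}

/-- The symbol of `(-Δ)^s`. -/
def symb (s : ℝ) (ξ : Rn N) : ℝ := (2 * Real.pi * ‖ξ‖) ^ (2 * s)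

theorem symb_nonneg (ξ : Rn N) : 0 ≤ symb s ξ := by
  have := Real.pi_pos
  unfold symb; positivity

theorem measurable_symb : Measurable (symb s : Rn N → ℝ) := by
  unfold symb; fun_prop

/-- The multiplier `(1 + |2πξ|^{2s})^{-1/2}`. -/
def besselMult (s : ℝ) (ξ : Rn N) : ℂ := ((√(1 + symb s ξ))⁻¹ : ℝ)

/-- The multiplier `|2πξ|^s (1 + |2πξ|^{2s})^{-1/2}`. -/
def rieszMult (s : ℝ) (ξ : Rn N) : ℂ := (√(symb s ξ) * (√(1 + symb s ξ))⁻¹ : ℝ)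

theorem measurable_besselMult : Measurable (besselMult s : Rn N → ℂ) :=
  Complex.measurable_ofReal.comp ((measurable_symb.const_add 1).sqrt.inv)

theorem measurable_rieszMult : Measurable (rieszMult s : Rn N → ℂ) :=
  Complex.measurable_ofReal.comp (measurable_symb.sqrt.mul (measurable_symb.const_add 1).sqrt.inv)

theorem norm_besselMult_le (ξ : Rn N) : ‖besselMult s ξ‖ ≤ 1 := by
  have h := symb_nonneg (s := s) ξ
  rw [besselMult, Complex.norm_real, Real.norm_of_nonneg (by positivity)]
  apply inv_le_one_of_one_le₀
  rw [Real.one_le_sqrt]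
  linarith

theorem norm_rieszMult_le (ξ : Rn N) : ‖rieszMult s ξ‖ ≤ 1 := by
  have h := symb_nonneg (s := s) ξ
  rw [rieszMult, Complex.norm_real, Real.norm_of_nonneg (by positivity), ← div_eq_mul_inv]
  apply div_le_one_of_le₀ _ (by positivity)
  apply Real.sqrt_le_sqrt
  linarith

/-- The operator `(1 + (-Δ)^s)^{-1/2}` on the Fourier side. -/
def besselOp (N : ℕ) (s : ℝ) : L2 ℂ N →L[ℂ] L2 ℂ N :=
  mulOp (besselMult s) measurable_besselMult norm_besselMult_le

/-- The operator `(-Δ)^{s/2} (1 + (-Δ)^s)^{-1/2}` on the Fourier side. -/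
def rieszOp (N : ℕ) (s : ℝ) : L2 ℂ N →L[ℂ] L2 ℂ N :=
  mulOp (rieszMult s) measurable_rieszMult norm_rieszMult_le

/-- Writes the possibly infinite kinetic energy as the squared norm of a bounded operator applied to
H, so that weak convergence in L² can be used for it. -/
theorem kinetic_eq_of_besselOp {u : L2 𝕜 N} {H : L2 ℂ N} (h : besselOp N s H = ft 𝕜 N u) :
    kinetic s u = ‖rieszOp N s H‖ₑ ^ 2 := by
  rw [kinetic_eq, enorm_sq_eq_lintegral, ← h]
  apply lintegral_congr_ae
  filter_upwards [coeFn_mulOp (besselMult s) measurable_besselMult norm_besselMult_le H,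
    coeFn_mulOp (rieszMult s) measurable_rieszMult norm_rieszMult_le H] with ξ h1 h2
  have h0 := symb_nonneg (s := s) ξ
  rw [besselOp, rieszOp, h1, h2, enorm_mul, enorm_mul, mul_pow, mul_pow, ← mul_assoc]
  congr 1
  rw [besselMult, rieszMult, ← ofReal_norm, ← ofReal_norm, Complex.norm_real, Complex.norm_real,
    Real.norm_of_nonneg (by positivity), Real.norm_of_nonneg (by positivity),
    ← ENNReal.ofReal_pow (by positivity), ← ENNReal.ofReal_pow (by positivity), mul_pow,
    Real.sq_sqrt h0, ENNReal.ofReal_mul h0]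
  rfl

/-- H is √(1 + symbol) times the transform of u; this identifies H^s isometrically with a subspace
of L², where weak compactness is available. -/
theorem exists_besselOp_eq {u : L2 𝕜 N} (hu : kinetic s u ≠ ∞) :
    ∃ H : L2 ℂ N, besselOp N s H = ft 𝕜 N u ∧ ‖H‖ₑ ^ 2 = ‖u‖ₑ ^ 2 + kinetic s u := by
  set f : Rn N → ℂ := fun ξ => (√(1 + symb s ξ) : ℝ) * ft 𝕜 N u ξ with hf
  have hUm := Lp.aestronglyMeasurable (ft 𝕜 N u)
  have hfm : AEStronglyMeasurable f volume :=
    (Complex.measurable_ofReal.comp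
      (measurable_symb.const_add 1).sqrt).aestronglyMeasurable.mul hUm
  have hfi : ∫⁻ ξ, ‖f ξ‖ₑ ^ 2 = ‖u‖ₑ ^ 2 + kinetic s u := by
    rw [kinetic_eq, ← enorm_ft u, enorm_sq_eq_lintegral, ← lintegral_add_left'
      (hUm.enorm.pow_const 2)]
    congr 1 with ξ
    have h0 := symb_nonneg (s := s) ξ
    rw [hf]
    dsimp only
    rw [enorm_mul, mul_pow, ← ofReal_norm ((√(1 + symb s ξ) : ℝ) : ℂ), Complex.norm_real,
      Real.norm_of_nonneg (by positivity),
      ← ENNReal.ofReal_pow (by positivity), Real.sq_sqrt (by positivity),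
      ENNReal.ofReal_add (by norm_num) h0, ENNReal.ofReal_one, add_mul, one_mul]
    rfl
  have hfL : MemLp f 2 volume := by
    refine ⟨hfm, ?_⟩
    rw [eLpNorm_eq_lintegral_rpow_enorm_toReal (by norm_num) (by norm_num)]
    refine ENNReal.rpow_lt_top_of_nonneg (by positivity) ?_
    simp only [ENNReal.toReal_ofNat, ENNReal.rpow_two]
    rw [hfi]
    simp [hu]
  refine ⟨hfL.toLp f, ?_, ?_⟩
  · ext1
    filter_upwards [coeFn_mulOp (besselMult s) measurable_besselMult norm_besselMult_le
      (hfL.toLp f), hfL.coeFn_toLp] with ξ h1 h2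
    have h0 := symb_nonneg (s := s) ξ
    have h3 : √(1 + symb s ξ) ≠ 0 := (Real.sqrt_pos.2 (by linarith)).ne'
    rw [besselOp, h1, h2, hf, besselMult, ← mul_assoc, ← Complex.ofReal_mul, inv_mul_cancel₀ h3]
    simp
  · rw [enorm_sq_eq_lintegral, ← hfi]
    apply lintegral_congr_ae
    filter_upwards [hfL.coeFn_toLp] with ξ h
    rw [h]

/-- Separability is what makes the weak compactness sequential. -/
instance : TopologicalSpace.SeparableSpace (L2 𝕜 N) := by
  have : Fact ((2 : ℝ≥0∞) ≠ ∞) := ⟨by norm_num⟩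
  infer_instance

theorem toReal_kinetic_of_besselOp {u : L2 𝕜 N} {H : L2 ℂ N} (h : besselOp N s H = ft 𝕜 N u) :
    (kinetic s u).toReal = ‖rieszOp N s H‖ ^ 2 := by
  rw [kinetic_eq_of_besselOp h, ← ofReal_norm, ← ENNReal.ofReal_pow (norm_nonneg _),
    ENNReal.toReal_ofReal (by positivity)]

theorem tendsto_inner_of_weak {H : Type*} [NormedAddCommGroup H] [NormedSpace ℝ H]
    (T : H →L[ℝ] L2 ℂ N) {x : ℕ → H} {a : H}
    (h : ∀ l : H →L[ℝ] ℝ, Tendsto (fun n => l (x n)) atTop (𝓝 (l a))) (g : L2 ℂ N) :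
    Tendsto (fun n => inner ℂ g (T (x n))) atTop (𝓝 (inner ℂ g (T a))) := by
  set l : H →L[ℝ] ℂ := ((innerSL ℂ g).restrictScalars ℝ) ∘L T
  have h1 := h (Complex.reCLM ∘L l)
  have h2 := h (Complex.imCLM ∘L l)
  have h3 : Tendsto (fun n => ((l (x n)).re : ℂ) + (l (x n)).im * Complex.I) atTop
      (𝓝 (((l a).re : ℂ) + (l a).im * Complex.I)) :=
    ((Complex.continuous_ofReal.tendsto _).comp h1).add
      (((Complex.continuous_ofReal.tendsto _).comp h2).mul_const _)
  simp only [Complex.re_add_im] at h3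
  exact h3

/-- Extraction of a weak limit in `H^s`, with the splitting of the mass and kinetic energy. -/
theorem exists_weak_limit {M K : ℝ} {u : ℕ → L2 𝕜 N} (hM : ∀ n, ‖u n‖ ≤ M)
    (hK : ∀ n, kinetic s (u n) ≤ ENNReal.ofReal K) :
    ∃ (w : L2 𝕜 N) (φ : ℕ → ℕ), StrictMono φ ∧ kinetic s w ≠ ∞ ∧
      (∀ n, kinetic s (u (φ n) - w) ≠ ∞) ∧
      (∀ g : L2 ℂ N, Tendsto (fun n => inner ℂ g (ft 𝕜 N (u (φ n)))) atTop
        (𝓝 (inner ℂ g (ft 𝕜 N w)))) ∧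
      Tendsto (fun n => ‖u (φ n)‖ ^ 2 - ‖u (φ n) - w‖ ^ 2) atTop (𝓝 (‖w‖ ^ 2)) ∧
      Tendsto (fun n => (kinetic s (u (φ n))).toReal - (kinetic s (u (φ n) - w)).toReal) atTop
        (𝓝 (kinetic s w).toReal) := by
  choose H hH hHn using fun n => exists_besselOp_eq (ne_top_of_le_ne_top ENNReal.ofReal_ne_top (hK n))
  -- K is not assumed nonnegative and `ENNReal.ofReal` truncates at 0, hence the maximum with 0.
  have hHb : ∀ n, ‖H n‖ ≤ √(M ^ 2 + K ⊔ 0) := by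
    intro n
    apply Real.le_sqrt_of_sq_le
    have h1 := hHn n
    have h2 : ENNReal.ofReal (‖H n‖ ^ 2) ≤ ENNReal.ofReal (M ^ 2 + K ⊔ 0) := by
      rw [ENNReal.ofReal_pow (norm_nonneg _), ofReal_norm, h1,
        ENNReal.ofReal_add (by positivity) (le_max_right _ _)]
      refine add_le_add ?_ ((hK n).trans (ENNReal.ofReal_le_ofReal (le_max_left _ _)))
      rw [← ofReal_norm, ← ENNReal.ofReal_pow (norm_nonneg _)]
      apply ENNReal.ofReal_le_ofReal
      gcongr
      exact hM n
    exact (ENNReal.ofReal_le_ofReal_iff (by positivity)).1 h2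
  obtain ⟨w, φ₁, hφ₁, hw⟩ := exists_weak_subseq u hM
  obtain ⟨h, φ₂, hφ₂, hh⟩ := exists_weak_subseq (fun n => H (φ₁ n)) (fun n => hHb _)
  have hw' : ∀ l : L2 𝕜 N →L[ℝ] ℝ,
      Tendsto (fun n => l (u (φ₁ (φ₂ n)))) atTop (𝓝 (l w)) :=
    fun l => (hw l).comp hφ₂.tendsto_atTop
  have hinner := fun g => tendsto_inner_of_weak (ft 𝕜 N) hw' g
  have hinner2 := fun g => tendsto_inner_of_weak ((besselOp N s).restrictScalars ℝ) hh g
  -- The weak limits in L² and in H^s are extracted separately; boundedness of the Bessel operator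
  -- and uniqueness of limits show that they belong to the same function.
  have heq : besselOp N s h = ft 𝕜 N w := by
    refine ext_inner_left ℂ fun g => ?_
    refine tendsto_nhds_unique (hinner2 g) ?_
    refine (hinner g).congr fun n => ?_
    rw [← hH]
    rfl
  have hsub : ∀ n, besselOp N s (H (φ₁ (φ₂ n)) - h) = ft 𝕜 N (u (φ₁ (φ₂ n)) - w) := fun n => by
    rw [map_sub, map_sub, heq, hH]
  refine ⟨w, φ₁ ∘ φ₂, hφ₁.comp hφ₂, ?_, fun n => ?_, hinner, tendsto_norm_sq_sub hw', ?_⟩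
  · rw [kinetic_eq_of_besselOp heq]; simp
  · rw [Function.comp_apply, kinetic_eq_of_besselOp (hsub n)]; simp
  · rw [toReal_kinetic_of_besselOp heq]
    have := tendsto_norm_sq_sub (x := fun n => rieszOp N s (H (φ₁ (φ₂ n))))
      (a := rieszOp N s h) (fun l => hh (l ∘L (rieszOp N s).restrictScalars ℝ))
    refine this.congr fun n => ?_
    rw [Function.comp_apply, toReal_kinetic_of_besselOp (hsub n), toReal_kinetic_of_besselOp (hH _),
      map_sub]

end weak

/-! ### Splitting of the Hartree term -/

theorem sub_le_of_derivWithin_le {G : ℝ → ℝ} {μ η T x y : ℝ} (hμ : 2 ≤ μ) (hη : 0 < η)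
    (hd : DifferentiableOn ℝ G (Set.Ici 0))
    (hG' : ∀ t, 0 ≤ t → |derivWithin G (Set.Ici 0) t| ≤ η * (t + t ^ (μ - 1)))
    (hx : 0 ≤ x) (hxT : x ≤ T) (hy : 0 ≤ y) (hyT : y ≤ T) :
    G x - G y ≤ η * (T + T ^ (μ - 1)) * |x - y| := by
  have h := Convex.norm_image_sub_le_of_norm_hasDerivWithin_le (f := G) (s := Set.Icc 0 T)
    (f' := derivWithin G (Set.Ici 0)) (C := η * (T + T ^ (μ - 1))) (x := y) (y := x)
    (fun t ht => ((hd t ht.1).hasDerivWithinAt).mono Set.Icc_subset_Ici_self)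
    (fun t ht => by
      refine (hG' t ht.1).trans ?_
      have := ht.1
      have := ht.2
      have h3 : t ^ (μ - 1) ≤ T ^ (μ - 1) := Real.rpow_le_rpow ht.1 ht.2 (by linarith)
      gcongr)
    (convex_Icc 0 T) ⟨hy, hyT⟩ ⟨hx, hxT⟩
  exact (le_abs_self _).trans h

/-- With a, b, c standing for |u|, |v|, |u + v|, compare c with the larger of a and b by the mean
value inequality: the two differ by at most the smaller one, and both are at most twice the larger.
The resulting errors are genuinely mixed in a and b. -/
theorem exists_superadd_le {G : ℝ → ℝ} {μ η : ℝ} (hμ : 2 ≤ μ) (hη : 0 < η)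
    (hd : DifferentiableOn ℝ G (Set.Ici 0)) (hG0 : ∀ t, 0 ≤ t → 0 ≤ G t)
    (hG' : ∀ t, 0 ≤ t → |derivWithin G (Set.Ici 0) t| ≤ η * (t + t ^ (μ - 1))) :
    ∃ C : ℝ, 0 < C ∧ ∀ a b c : ℝ, 0 ≤ a → 0 ≤ b → 0 ≤ c → c ≤ a + b → |c - a| ≤ b → |c - b| ≤ a →
      G c ≤ G a + G b + C * (a * b + a * b ^ (μ - 1) + a ^ (μ - 1) * b) := by
  set C := η * 2 ^ (μ - 1) with hC
  -- Lets the factor 2 from the linear part of the derivative bound be absorbed into 2^(μ - 1).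
  have h2 : (2 : ℝ) ≤ 2 ^ (μ - 1) := by
    conv_lhs => rw [← Real.rpow_one 2]
    exact Real.rpow_le_rpow_of_exponent_le (by norm_num) (by linarith)
  have key : ∀ a b c : ℝ, 0 ≤ a → a ≤ b → 0 ≤ c → c ≤ a + b → |c - b| ≤ a →
      G c ≤ G b + C * (a * b + a * b ^ (μ - 1)) := by
    intro a b c ha hab hc hcab hcb
    have hb : 0 ≤ b := ha.trans hab
    have h := sub_le_of_derivWithin_le hμ hη hd hG' hc (show c ≤ 2 * b by linarith) hb
      (show b ≤ 2 * b by linarith)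
    have hbp : 0 ≤ b ^ (μ - 1) := Real.rpow_nonneg hb _
    have h3 : η * (2 * b + (2 * b) ^ (μ - 1)) * |c - b| ≤ C * (a * b + a * b ^ (μ - 1)) := by
      rw [Real.mul_rpow (by norm_num) hb]
      calc η * (2 * b + 2 ^ (μ - 1) * b ^ (μ - 1)) * |c - b|
          ≤ η * (2 ^ (μ - 1) * b + 2 ^ (μ - 1) * b ^ (μ - 1)) * a := by gcongr
        _ = _ := by rw [hC]; ring
    linarith
  refine ⟨C, by positivity, fun a b c ha hb hc hcab hca hcb => ?_⟩
  have hap : 0 ≤ a ^ (μ - 1) := Real.rpow_nonneg ha _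
  have hbp : 0 ≤ b ^ (μ - 1) := Real.rpow_nonneg hb _
  have hC0 : 0 < C := by positivity
  rcases le_total a b with hab | hab
  · have h := key a b c ha hab hc hcab hcb
    have := hG0 a ha
    have : 0 ≤ C * (a ^ (μ - 1) * b) := by positivity
    linarith
  · have h := key b a c hb hab hc (by linarith) hca
    have := hG0 b hb
    have : 0 ≤ C * (a * b ^ (μ - 1)) := by positivity
    linarith

section splitting

variable {𝕜 : Type} [RCLike 𝕜] {N : ℕ} {s β μ r : ℝ}

/-- The mixed terms produced by splitting `G(|u + v|)`. -/
def mixedTerm (μ : ℝ) (u v : L2 𝕜 N) (x : Rn N) : ℝ≥0∞ :=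
  (‖u x‖ₑ ^ (1 : ℝ) * ‖v x‖ₑ ^ (1 : ℝ) + ‖u x‖ₑ ^ (1 : ℝ) * ‖v x‖ₑ ^ (μ - 1)) +
    ‖u x‖ₑ ^ (μ - 1) * ‖v x‖ₑ ^ (1 : ℝ)

theorem aemeasurable_mul_rpow (a b : ℝ) (u v : L2 𝕜 N) :
    AEMeasurable fun x => ‖u x‖ₑ ^ a * ‖v x‖ₑ ^ b :=
  ((aemeasurable_enorm u).pow_const a).mul ((aemeasurable_enorm v).pow_const b)

theorem aemeasurable_mixedTerm (u v : L2 𝕜 N) : AEMeasurable (mixedTerm μ u v) :=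
  ((aemeasurable_mul_rpow _ _ u v).add (aemeasurable_mul_rpow _ _ u v)).add
    (aemeasurable_mul_rpow _ _ u v)

theorem dens_add_le {G : ℝ → ℝ} {C : ℝ} (hC : 0 < C) (hμ : 2 ≤ μ) (hG0 : ∀ t, 0 ≤ t → 0 ≤ G t)
    (h : ∀ a b c : ℝ, 0 ≤ a → 0 ≤ b → 0 ≤ c → c ≤ a + b → |c - a| ≤ b → |c - b| ≤ a →
      G c ≤ G a + G b + C * (a * b + a * b ^ (μ - 1) + a ^ (μ - 1) * b)) (u v : L2 𝕜 N) :
    ∀ᵐ x, dens G (u + v) x ≤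
      (dens G u + dens G v + fun x => ENNReal.ofReal C * mixedTerm μ u v x) x := by
  filter_upwards [Lp.coeFn_add u v] with x hx
  have hμ' : 0 ≤ μ - 1 := by linarith
  have e : ENNReal.ofReal C * mixedTerm μ u v x = ENNReal.ofReal (C * (‖u x‖ * ‖v x‖ +
      ‖u x‖ * ‖v x‖ ^ (μ - 1) + ‖u x‖ ^ (μ - 1) * ‖v x‖)) := by
    rw [mixedTerm, ENNReal.ofReal_mul hC.le, ENNReal.ofReal_add (by positivity) (by positivity),
      ENNReal.ofReal_add (by positivity) (by positivity), ENNReal.ofReal_mul (by positivity),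
      ENNReal.ofReal_mul (by positivity), ENNReal.ofReal_mul (by positivity),
      ← ENNReal.ofReal_rpow_of_nonneg (norm_nonneg _) hμ',
      ← ENNReal.ofReal_rpow_of_nonneg (norm_nonneg _) hμ', ofReal_norm, ofReal_norm]
    simp
  simp only [Pi.add_apply]
  rw [e, dens, dens, dens, hx, Pi.add_apply,
    ← ENNReal.ofReal_add (hG0 _ (norm_nonneg _)) (hG0 _ (norm_nonneg _)),
    ← ENNReal.ofReal_add (add_nonneg (hG0 _ (norm_nonneg _)) (hG0 _ (norm_nonneg _)))
      (by positivity)]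
  apply ENNReal.ofReal_le_ofReal
  refine h _ _ _ (norm_nonneg _) (norm_nonneg _) (norm_nonneg _) (norm_add_le _ _) ?_ ?_
  · simpa using abs_norm_sub_norm_le (u x + v x) (u x)
  · simpa using abs_norm_sub_norm_le (u x + v x) (v x)

theorem tendsto_xNorm_mul_rpow (E : Exponents N s β μ r) {a b : ℝ} (ha : 0 < a) (hb : 0 < b)
    (hab : 2 ≤ a + b) (habμ : a + b ≤ μ)
    {M K : ℝ≥0∞} (hM : M ≠ ∞) (hK : K ≠ ∞) {u : L2 𝕜 N} (hu : kinetic s u ≠ ∞)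
    {v : ℕ → L2 𝕜 N} (hvM : ∀ n, ‖v n‖ₑ ≤ M) (hk : ∀ n, kinetic s (v n) ≤ K)
    (hv : ∀ m : ℕ, Tendsto (fun n => pInt (Metric.ball 0 m) 2 (v n)) atTop (𝓝 0)) :
    Tendsto (fun n => xNorm r fun x => ‖u x‖ₑ ^ a * ‖v n x‖ₑ ^ b) atTop (𝓝 0) := by
  have hr := E.hr0
  have hs := E.hs
  have h1 := tendsto_mixed E.hN hs ha hb hab (by linarith [E.sub_two_lt habμ]) hM hK hu hvM hk hv
  have h2 := tendsto_rpow_zero (show 0 < 1 / r by positivity)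
    (tendsto_mixed (a := a * r) (b := b * r) E.hN hs (by positivity) (by positivity)
      (by rw [← add_mul]; exact (E.two_lt_mul hab).le)
      (by rw [← add_mul]; exact E.mul_sub_two_lt habμ) hM hK hu hvM hk hv)
  have h3 := h1.add h2
  rw [add_zero] at h3
  refine h3.congr fun n => ?_
  unfold xNorm
  simp only [ENNReal.mul_rpow_of_nonneg _ _ hr.le, ← ENNReal.rpow_mul]

theorem tendsto_xNorm_mixedTerm (E : Exponents N s β μ r)
    {M K : ℝ≥0∞} (hM : M ≠ ∞) (hK : K ≠ ∞) {u : L2 𝕜 N} (hu : kinetic s u ≠ ∞)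
    {v : ℕ → L2 𝕜 N} (hvM : ∀ n, ‖v n‖ₑ ≤ M) (hk : ∀ n, kinetic s (v n) ≤ K)
    (hv : ∀ m : ℕ, Tendsto (fun n => pInt (Metric.ball 0 m) 2 (v n)) atTop (𝓝 0)) :
    Tendsto (fun n => xNorm r (mixedTerm μ u (v n))) atTop (𝓝 0) := by
  have hμ := E.hμ
  have hr := E.hr1.le
  have h1 := tendsto_xNorm_mul_rpow E (a := 1) (b := 1) one_pos one_pos (by norm_num)
    (by linarith) hM hK hu hvM hk hv
  have h2 := tendsto_xNorm_mul_rpow E (a := 1) (b := μ - 1) one_pos (by linarith) (by linarith)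
    (by linarith) hM hK hu hvM hk hv
  have h3 := tendsto_xNorm_mul_rpow E (a := μ - 1) (b := 1) (by linarith) one_pos (by linarith)
    (by linarith) hM hK hu hvM hk hv
  have h4 := (h1.add h2).add h3
  simp only [add_zero] at h4
  refine tendsto_zero_of_le h4 fun n => ?_
  refine (xNorm_add_le hr ((aemeasurable_mul_rpow _ _ u (v n)).add
    (aemeasurable_mul_rpow _ _ u (v n))) (aemeasurable_mul_rpow _ _ u (v n))).trans ?_
  gcongr
  exact xNorm_add_le hr (aemeasurable_mul_rpow _ _ u (v n)) (aemeasurable_mul_rpow _ _ u (v n))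

theorem xNorm_indicator_le (hr : 0 < r) (S : Set (Rn N)) (f : Rn N → ℝ≥0∞) :
    xNorm r (S.indicator f) ≤ xNorm r f :=
  xNorm_mono hr (Eventually.of_forall fun x => Set.indicator_le_self S f x)

theorem tendsto_xNorm_indicator_compl_ball (hr : 1 ≤ r) {f : Rn N → ℝ≥0∞}
    (hf : xNorm r f ≠ ∞) :
    Tendsto (fun n : ℕ => xNorm r ((Metric.ball (0 : Rn N) n)ᶜ.indicator f)) atTop (𝓝 0) := by
  have hr0 : 0 < r := by linarith
  have hr' : 0 < 1 / r := by positivity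
  rw [xNorm, ENNReal.add_ne_top] at hf
  have h2 : ∫⁻ x, f x ^ r ≠ ∞ := by
    intro h
    exact hf.2 (by rw [h, ENNReal.top_rpow_of_pos hr'])
  have h3 := (tendsto_setLIntegral_compl_ball hf.1).add
    (tendsto_rpow_zero hr' (tendsto_setLIntegral_compl_ball h2))
  rw [add_zero] at h3
  refine h3.congr fun n => ?_
  unfold xNorm
  rw [lintegral_indicator measurableSet_ball.compl, ← lintegral_indicator measurableSet_ball.compl
    (fun x => f x ^ r)]
  congr 3 with x
  by_cases h : x ∈ (Metric.ball (0 : Rn N) n)ᶜ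
  · rw [Set.indicator_of_mem h, Set.indicator_of_mem h]
  · rw [Set.indicator_of_notMem h, Set.indicator_of_notMem h, ENNReal.zero_rpow_of_pos hr0]

theorem form_add_right (β : ℝ) {f g g' : Rn N → ℝ≥0∞} (hf : AEMeasurable f)
    (hg : AEMeasurable g) : form β f (g + g') = form β f g + form β f g' := by
  rw [form_comm, form_add_left β hg hf, form_comm, form_comm (f := g')]

/-- The interaction of a fixed density with densities that vanish locally tends to zero. -/
theorem tendsto_form_of_local (E : Exponents N s β μ r) {f : Rn N → ℝ≥0∞} {g : ℕ → Rn N → ℝ≥0∞}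
    (hf : AEMeasurable f) (hg : ∀ n, AEMeasurable (g n)) (hfX : xNorm r f ≠ ∞) {C : ℝ≥0∞}
    (hC : C ≠ ∞) (hgX : ∀ n, xNorm r (g n) ≤ C)
    (hloc : ∀ m : ℕ, Tendsto (fun n => xNorm r ((Metric.ball (0 : Rn N) m).indicator (g n))) atTop
      (𝓝 0)) :
    Tendsto (fun n => form β f (g n)) atTop (𝓝 0) := by
  have hr := E.hr0
  obtain ⟨A, hA, hform⟩ := form_le E.hN E.hβN E.hr1 E.hr2 E.hrβ
  have hfar : Tendsto (fun k : ℕ => (xNorm r f * C) *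
      ENNReal.ofReal ((((k : ℝ) + 1)) ^ (β - (N : ℝ)))) atTop (𝓝 0) := by
    apply tendsto_const_mul_zero (ENNReal.mul_ne_top hfX hC)
    rw [← ENNReal.ofReal_zero]
    apply ENNReal.tendsto_ofReal
    have h0 := tendsto_rpow_neg_atTop (show 0 < (N : ℝ) - β by linarith [E.hβN])
    rw [neg_sub] at h0
    exact h0.comp (tendsto_atTop_add_const_right _ 1 tendsto_natCast_atTop_atTop)
  have htail := tendsto_const_mul_zero (ENNReal.mul_ne_top hA hC)
    (tendsto_xNorm_indicator_compl_ball E.hr1.le hfX)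
  rw [ENNReal.tendsto_nhds_zero]
  intro ε hε
  have hε2 : 0 < ε / 2 := ENNReal.half_pos hε.ne'
  have hε4 : 0 < ε / 2 / 2 := ENNReal.half_pos hε2.ne'
  obtain ⟨k, hk⟩ := (ENNReal.tendsto_nhds_zero.1 htail (ε / 2) hε2).exists
  obtain ⟨l, hl⟩ := (ENNReal.tendsto_nhds_zero.1 hfar (ε / 2 / 2) hε4).exists
  -- The radius k captures f up to a small tail; the margin l + 1 makes the kernel small between the
  -- ball of radius k and the complement of the ball of radius m.
  set m : ℕ := k + (l + 1) with hm
  have hnear := tendsto_const_mul_zero (ENNReal.mul_ne_top hA hfX) (hloc m)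
  filter_upwards [ENNReal.tendsto_nhds_zero.1 hnear (ε / 2 / 2) hε4] with n hn
  have hfB : AEMeasurable ((Metric.ball (0 : Rn N) k).indicator f) := hf.indicator measurableSet_ball
  have hfB' : AEMeasurable ((Metric.ball (0 : Rn N) k)ᶜ.indicator f) :=
    hf.indicator measurableSet_ball.compl
  have hgB : AEMeasurable ((Metric.ball (0 : Rn N) m).indicator (g n)) :=
    (hg n).indicator measurableSet_ball
  have e1 : form β f (g n) = form β ((Metric.ball (0 : Rn N) k)ᶜ.indicator f) (g n) +
      (form β ((Metric.ball (0 : Rn N) k).indicator f) ((Metric.ball (0 : Rn N) m).indicator (g n)) +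
      form β ((Metric.ball (0 : Rn N) k).indicator f)
        ((Metric.ball (0 : Rn N) m)ᶜ.indicator (g n))) := by
    rw [← form_add_right β hfB hgB, Set.indicator_self_add_compl, ← form_add_left β hfB' (hg n),
      Set.indicator_compl_add_self]
  rw [e1, ← ENNReal.add_halves ε]
  refine add_le_add ?_ ?_
  · refine (hform _ _ hfB' (hg n)).trans (le_trans ?_ hk)
    calc _ ≤ A * (xNorm r ((Metric.ball (0 : Rn N) k)ᶜ.indicator f) * C) := by
          gcongr
          exact hgX n
      _ = _ := by ring
  · rw [← ENNReal.add_halves (ε / 2)]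
    refine add_le_add ?_ ?_
    · refine (hform _ _ hfB hgB).trans (le_trans ?_ hn)
      rw [mul_assoc]
      gcongr
      exact xNorm_indicator_le hr _ f
    · refine (form_far_le E.hβN (show (k : ℝ) < m by rw [hm]; push_cast; linarith) hf
        (hg n)).trans (le_trans ?_ hl)
      rw [mul_comm, show (m : ℝ) - k = (l : ℝ) + 1 by rw [hm]; push_cast; ring]
      gcongr
      · exact le_self_add
      · exact le_trans le_self_add (hgX n)

/-- Asymptotic splitting of the Hartree term (upper bound). -/
theorem eventually_hartree_add_le (E : Exponents N s β μ r) {G : ℝ → ℝ} {η : ℝ} (hη : 0 < η)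
    (hG : ∀ t, 0 ≤ t → G t ≤ η * (t ^ 2 + t ^ μ)) (hd : DifferentiableOn ℝ G (Set.Ici 0))
    (hG0 : ∀ t, 0 ≤ t → 0 ≤ G t)
    (hG' : ∀ t, 0 ≤ t → |derivWithin G (Set.Ici 0) t| ≤ η * (t + t ^ (μ - 1)))
    {M K : ℝ≥0∞} (hM : M ≠ ∞) (hK : K ≠ ∞) {u : L2 𝕜 N} (hu : kinetic s u ≠ ∞)
    {v : ℕ → L2 𝕜 N} (hvM : ∀ n, ‖v n‖ₑ ≤ M) (hk : ∀ n, kinetic s (v n) ≤ K)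
    (hv : ∀ m : ℕ, Tendsto (fun n => pInt (Metric.ball 0 m) 2 (v n)) atTop (𝓝 0))
    {ε : ℝ≥0∞} (hε : 0 < ε) :
    ∀ᶠ n in atTop, hartree β G (u + v n) ≤ hartree β G u + hartree β G (v n) + ε := by
  have hGc := hd.continuousOn
  have hμ := E.hμ
  obtain ⟨C, hC, hsup⟩ := exists_superadd_le hμ hη hd hG0 hG'
  obtain ⟨A, hA, hform⟩ := form_le E.hN E.hβN E.hr1 E.hr2 E.hrβ
  obtain ⟨Cv, hCv, hXv⟩ := exists_xNorm_dens_le 𝕜 E hη hG hM hK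
  obtain ⟨Cu, hCu, hXu⟩ := exists_xNorm_dens_le 𝕜 E hη hG (M := ‖u‖ₑ) (by simp) hu
  have hXu := hXu u le_rfl le_rfl
  set f := dens G u
  set g := fun n => dens G (v n)
  set e := fun n x => ENNReal.ofReal C * mixedTerm μ u (v n) x
  have hf : AEMeasurable f := aemeasurable_dens hGc u
  have hg : ∀ n, AEMeasurable (g n) := fun n => aemeasurable_dens hGc (v n)
  have he : ∀ n, AEMeasurable (e n) := fun n => (aemeasurable_mixedTerm u (v n)).const_mul _
  have hXe : Tendsto (fun n => xNorm r (e n)) atTop (𝓝 0) := by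
    refine (tendsto_const_mul_zero (c := ENNReal.ofReal C) ENNReal.ofReal_ne_top
      (tendsto_xNorm_mixedTerm E hM hK hu hvM hk hv)).congr fun n => ?_
    exact (xNorm_const_mul E.hr0 ENNReal.ofReal_ne_top _).symm
  have hfg : Tendsto (fun n => form β f (g n)) atTop (𝓝 0) := by
    refine tendsto_form_of_local E hf hg (ne_top_of_le_ne_top hCu hXu) hCv
      (fun n => hXv _ (hvM n) (hk n)) fun m => ?_
    refine tendsto_zero_of_le (tendsto_const_mul_zero ENNReal.ofReal_ne_top
      (tendsto_powSum E fun p hp hps => tendsto_pInt_local E.hN E.hs hp hps hM hK hvM hk (hv m)))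
      (fun n => xNorm_dens_le E.hr1.le (by linarith) hη hG measurableSet_ball (v n))
  have hrest : Tendsto (fun n => 2 * form β f (g n) + (2 * A * (Cu + Cv) * xNorm r (e n) +
      A * (xNorm r (e n) * xNorm r (e n)))) atTop (𝓝 0) := by
    have h1 := tendsto_const_mul_zero (c := 2) (by norm_num) hfg
    have h2 := tendsto_const_mul_zero (c := 2 * A * (Cu + Cv)) (ENNReal.mul_ne_top
      (ENNReal.mul_ne_top (by norm_num) hA) (by simp [hCu, hCv])) hXe
    have h3 := tendsto_const_mul_zero hA (f := fun n => xNorm r (e n) * xNorm r (e n))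
      (by simpa using ENNReal.Tendsto.mul hXe (by simp) hXe (by simp))
    simpa using h1.add (h2.add h3)
  filter_upwards [ENNReal.tendsto_nhds_zero.1 hrest ε hε] with n hn
  rw [hartree_eq_form hGc hG0, hartree_eq_form hGc hG0, hartree_eq_form hGc hG0]
  refine le_trans (form_mono β (dens_add_le hC hμ hG0 hsup u (v n))
    (dens_add_le hC hμ hG0 hsup u (v n))) (le_trans ?_ (add_le_add le_rfl hn))
  have hfgm : AEMeasurable (f + g n) := hf.add (hg n)
  have hXh : xNorm r (f + g n) ≤ Cu + Cv :=
    (xNorm_add_le E.hr1.le hf (hg n)).trans (add_le_add hXu (hXv _ (hvM n) (hk n)))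
  have hhe : form β (f + g n) (e n) ≤ A * (Cu + Cv) * xNorm r (e n) := by
    refine (hform _ _ hfgm (he n)).trans ?_
    rw [mul_assoc]
    gcongr
  have hee := hform _ _ (he n) (he n)
  -- Beyond the two self-interactions, the form consists of the f–g interaction, which vanishes by
  -- locality, and terms containing e, which vanish in `xNorm`.
  calc form β (f + g n + e n) (f + g n + e n)
      = form β f f + form β (g n) (g n) + (2 * form β f (g n) +
        (2 * form β (f + g n) (e n) + form β (e n) (e n))) := by
        rw [form_add_left β hfgm (hfgm.add (he n)), form_add_right β hfgm hfgm,
          form_add_right β (he n) hfgm, form_comm (f := e n) (g := f + g n),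
          form_add_left β hf hfgm, form_add_right β hf hf, form_add_right β (hg n) hf,
          form_comm (f := g n) (g := f)]
        ring
    _ ≤ form β f f + form β (g n) (g n) + (2 * form β f (g n) +
        (2 * (A * (Cu + Cv) * xNorm r (e n)) + A * (xNorm r (e n) * xNorm r (e n)))) := by
        gcongr
    _ = _ := by ring

end splitting

section gaussian

variable {𝕜 : Type} [RCLike 𝕜] {N : ℕ} {s : ℝ}

/-! ### Scalar multiples -/

theorem kinetic_smul (θ : ℝ) (u : L2 𝕜 N) :
    kinetic s (θ • u) = ENNReal.ofReal (θ ^ 2) * kinetic s u := by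
  rw [kinetic_eq, kinetic_eq, map_smul, ← lintegral_const_mul' _ _ ENNReal.ofReal_ne_top]
  apply lintegral_congr_ae
  filter_upwards [Lp.coeFn_smul θ (ft 𝕜 N u)] with ξ h
  rw [h, Pi.smul_apply, enorm_smul, mul_pow, mul_left_comm]
  congr 1
  rw [← ofReal_norm, ← ENNReal.ofReal_pow (norm_nonneg _), Real.norm_eq_abs, sq_abs]

theorem norm_smul_ae (θ : ℝ) (u : L2 𝕜 N) : ∀ᵐ x, ‖(θ • u : L2 𝕜 N) x‖ = |θ| * ‖u x‖ := by
  filter_upwards [Lp.coeFn_smul θ u] with x h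
  rw [h, Pi.smul_apply, norm_smul, Real.norm_eq_abs]

/-! ### Gaussian trial functions -/

theorem integrable_gauss {b : ℝ} (hb : 0 < b) :
    Integrable fun x : Rn N => Real.exp (-b * ‖x‖ ^ 2) := by
  have h := GaussianFourier.integrable_cexp_neg_mul_sq_norm_add (V := Rn N) (b := (b : ℂ))
    (by simpa using hb) 0 0
  have h2 := h.re
  refine h2.congr (Eventually.of_forall fun x => ?_)
  simp only [zero_mul, add_zero]
  rw [show -(b : ℂ) * (‖x‖ : ℂ) ^ 2 = ((-b * ‖x‖ ^ 2 : ℝ) : ℂ) by push_cast; ring,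
    ← Complex.ofReal_exp]
  exact Complex.ofReal_re _

theorem lintegral_gauss {b : ℝ} (hb : 0 < b) :
    ∫⁻ x : Rn N, ENNReal.ofReal (Real.exp (-b * ‖x‖ ^ 2)) =
      ENNReal.ofReal ((Real.pi / b) ^ ((N : ℝ) / 2)) := by
  rw [← ofReal_integral_eq_lintegral_ofReal (integrable_gauss hb)
    (Eventually.of_forall fun x => (Real.exp_pos _).le),
    GaussianFourier.integral_rexp_neg_mul_sq_norm hb]
  simp

/-- The function `exp (-b |x|²)`. -/
def gaussFun (𝕜 : Type) [RCLike 𝕜] (N : ℕ) (b : ℝ) (x : Rn N) : 𝕜 :=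
  ((Real.exp (-b * ‖x‖ ^ 2) : ℝ) : 𝕜)

theorem norm_gaussFun (b : ℝ) (x : Rn N) : ‖gaussFun 𝕜 N b x‖ = Real.exp (-b * ‖x‖ ^ 2) := by
  rw [gaussFun, RCLike.norm_ofReal, abs_of_pos (Real.exp_pos _)]

theorem lintegral_gaussFun {b : ℝ} (hb : 0 < b) : ∫⁻ x, ‖gaussFun 𝕜 N b x‖ₑ ^ 2 =
    ENNReal.ofReal ((Real.pi / (2 * b)) ^ ((N : ℝ) / 2)) := by
  rw [← lintegral_gauss (by linarith)]
  congr 1 with x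
  rw [← ofReal_norm, norm_gaussFun, ← ENNReal.ofReal_pow (Real.exp_pos _).le, ← Real.exp_nat_mul]
  congr 2
  push_cast
  ring

theorem continuous_gaussFun (b : ℝ) : Continuous (gaussFun 𝕜 N b) := by
  unfold gaussFun
  exact RCLike.continuous_ofReal.comp (by fun_prop)

theorem memLp_gaussFun {b : ℝ} (hb : 0 < b) : MemLp (gaussFun 𝕜 N b) 2 volume := by
  refine ⟨(continuous_gaussFun b).aestronglyMeasurable, ?_⟩
  rw [eLpNorm_eq_lintegral_rpow_enorm_toReal (by norm_num) (by norm_num)]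
  refine ENNReal.rpow_lt_top_of_nonneg (by positivity) ?_
  simp only [ENNReal.toReal_ofNat, ENNReal.rpow_two]
  rw [lintegral_gaussFun hb]
  exact ENNReal.ofReal_ne_top

/-- The function `exp (-b |x|²)` in `L²`. -/
def gauss (𝕜 : Type) [RCLike 𝕜] (N : ℕ) {b : ℝ} (hb : 0 < b) : L2 𝕜 N :=
  (memLp_gaussFun hb).toLp (gaussFun 𝕜 N b)

theorem norm_gauss_sq {b : ℝ} (hb : 0 < b) :
    ‖gauss 𝕜 N hb‖ ^ 2 = (Real.pi / (2 * b)) ^ ((N : ℝ) / 2) := by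
  have hpi := Real.pi_pos
  have h : ‖gauss 𝕜 N hb‖ₑ ^ 2 = ENNReal.ofReal ((Real.pi / (2 * b)) ^ ((N : ℝ) / 2)) := by
    rw [enorm_sq_eq_lintegral, ← lintegral_gaussFun (𝕜 := 𝕜) hb]
    apply lintegral_congr_ae
    filter_upwards [(memLp_gaussFun (𝕜 := 𝕜) (N := N) hb).coeFn_toLp] with x hx
    rw [gauss, hx]
  rw [← ofReal_norm, ← ENNReal.ofReal_pow (norm_nonneg _)] at h
  exact (ENNReal.ofReal_eq_ofReal_iff (by positivity) (by positivity)).1 h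

theorem norm_ft_gauss_ae {b : ℝ} (hb : 0 < b) :
    ∀ᵐ ξ : Rn N, ‖ft 𝕜 N (gauss 𝕜 N hb) ξ‖ =
      (Real.pi / b) ^ ((N : ℝ) / 2) * Real.exp (-(Real.pi ^ 2 / b) * ‖ξ‖ ^ 2) := by
  have hpi := Real.pi_pos
  have h1 : complexify (gauss 𝕜 N hb) =ᵐ[volume] fun x : Rn N => Complex.exp (-b * ‖x‖ ^ 2) := by
    filter_upwards [coeFn_complexify (gauss 𝕜 N hb),
      (memLp_gaussFun (𝕜 := 𝕜) (N := N) hb).coeFn_toLp] with x hx hx2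
    rw [hx, gauss, hx2, gaussFun]
    simp
  have hi : Integrable (fun x : Rn N => Complex.exp (-b * ‖x‖ ^ 2)) := by
    have h := GaussianFourier.integrable_cexp_neg_mul_sq_norm_add (V := Rn N) (b := (b : ℂ))
      (by simpa using hb) 0 0
    simpa using h
  filter_upwards [fourier_ae_eq _ (hi.congr h1.symm)] with ξ hξ
  rw [ft_apply, hξ, Real.fourier_congr_ae h1, fourier_gaussian_innerProductSpace (by simpa using hb),
    norm_mul, Complex.norm_exp]
  congr 1
  · rw [← Complex.ofReal_div]
    rw [Complex.norm_cpow_eq_rpow_re_of_pos (by positivity)]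
    simp
  · congr 1
    rw [show (-(Real.pi : ℂ) ^ 2 * (‖ξ‖ : ℂ) ^ 2 / b) =
      ((-(Real.pi ^ 2 / b) * ‖ξ‖ ^ 2 : ℝ) : ℂ) by push_cast; ring, Complex.ofReal_re]

/-- Trades the symbol for half of the Gaussian decay of |û|², leaving an explicit Gaussian integral.
-/
theorem rpow_two_mul_le {x : ℝ} (hx : 0 ≤ x) (hs0 : 0 < s) (hs1 : s < 1) :
    x ^ (2 * s) ≤ 4 * Real.exp (x ^ 2 / 4) := by
  have h1 : x ^ (2 * s) ≤ 1 + x ^ 2 := by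
    rcases le_total x 1 with h | h
    · have := Real.rpow_le_one hx h (show 0 ≤ 2 * s by linarith)
      nlinarith [sq_nonneg x]
    · have := Real.rpow_le_rpow_of_exponent_le h (show 2 * s ≤ 2 by linarith)
      rw [Real.rpow_two] at this
      linarith
  have h2 := Real.add_one_le_exp (x ^ 2 / 4)
  linarith

theorem kinetic_gauss_le {b : ℝ} (hb : 0 < b) (hs0 : 0 < s) (hs1 : s < 1) :
    kinetic s (gauss 𝕜 N hb) ≤ ENNReal.ofReal (4 * b ^ s * (Real.pi / b) ^ ((N : ℝ) / 2)) := by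
  have hpi := Real.pi_pos
  have hc : 0 < Real.pi ^ 2 / b := by positivity
  calc kinetic s (gauss 𝕜 N hb)
      ≤ ∫⁻ ξ : Rn N, ENNReal.ofReal (4 * b ^ s * (Real.pi / b) ^ (N : ℝ)) *
        ENNReal.ofReal (Real.exp (-(Real.pi ^ 2 / b) * ‖ξ‖ ^ 2)) := by
        rw [kinetic_eq]
        apply lintegral_mono_ae
        filter_upwards [norm_ft_gauss_ae (𝕜 := 𝕜) (N := N) hb] with ξ h
        rw [← ofReal_norm, h, ← ENNReal.ofReal_pow (by positivity),
          ← ENNReal.ofReal_mul (by positivity), ← ENNReal.ofReal_mul (by positivity)]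
        apply ENNReal.ofReal_le_ofReal
        have e1 : (2 * Real.pi * ‖ξ‖) ^ (2 * s) =
            b ^ s * (2 * Real.pi * ‖ξ‖ / √b) ^ (2 * s) := by
          rw [Real.div_rpow (by positivity) (by positivity), Real.sqrt_eq_rpow,
            ← Real.rpow_mul hb.le, show 1 / 2 * (2 * s) = s by ring]
          field_simp
        have e2 := rpow_two_mul_le (show 0 ≤ 2 * Real.pi * ‖ξ‖ / √b by positivity) hs0 hs1
        have e3 : (2 * Real.pi * ‖ξ‖ / √b) ^ 2 / 4 = Real.pi ^ 2 / b * ‖ξ‖ ^ 2 := by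
          rw [div_pow, Real.sq_sqrt hb.le]
          ring
        rw [e3] at e2
        set t := Real.pi ^ 2 / b * ‖ξ‖ ^ 2
        rw [e1, show -(Real.pi ^ 2 / b) * ‖ξ‖ ^ 2 = -t by ring, mul_pow, ← Real.rpow_natCast,
          ← Real.rpow_mul (by positivity), show (N : ℝ) / 2 * (2 : ℕ) = N by push_cast; ring]
        calc b ^ s * (2 * Real.pi * ‖ξ‖ / √b) ^ (2 * s) *
              ((Real.pi / b) ^ (N : ℝ) * Real.exp (-t) ^ 2)
            ≤ b ^ s * (4 * Real.exp t) * ((Real.pi / b) ^ (N : ℝ) * Real.exp (-t) ^ 2) := by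
              gcongr
          _ = 4 * b ^ s * (Real.pi / b) ^ (N : ℝ) * Real.exp (-t) * (Real.exp t * Real.exp (-t)) := by
              ring
          _ = _ := by rw [← Real.exp_add, add_neg_cancel, Real.exp_zero, mul_one]
    _ = _ := by
        rw [lintegral_const_mul' _ _ ENNReal.ofReal_ne_top, lintegral_gauss hc,
          ← ENNReal.ofReal_mul (by positivity)]
        congr 1
        rw [mul_assoc]
        congr 1
        rw [show Real.pi / (Real.pi ^ 2 / b) = (Real.pi / b)⁻¹ by field_simp,
          Real.inv_rpow (by positivity), ← Real.rpow_neg (by positivity),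
          ← Real.rpow_add (by positivity)]
        congr 1
        ring

/-- On the ball of radius 1/√b the Gaussian lies between A/e and A < δ, where the lower bound on G
applies, and the kernel is at least its value at the diameter. -/
theorem hartree_smul_gauss_ge (hN : 0 < N) {β α η δ A b : ℝ} {G : ℝ → ℝ} (hβN : β < N) (hα : 0 < α)
    (hη : 0 < η) (hG : ∀ t, 0 < t → t < δ → η * t ^ α ≤ G t) (hA : 0 < A) (hAδ : A < δ)
    (hb : 0 < b) :
    ENNReal.ofReal ((η * (A * Real.exp (-1)) ^ α) * (2 / √b) ^ (β - (N : ℝ)) *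
      (η * (A * Real.exp (-1)) ^ α)) * (volume (Metric.ball (0 : Rn N) (1 / √b))) ^ 2 ≤
      hartree β G (A • gauss 𝕜 N hb) := by
  have : Nonempty (Fin N) := ⟨⟨0, hN⟩⟩
  set B := Metric.ball (0 : Rn N) (1 / √b)
  set u : L2 𝕜 N := A • gauss 𝕜 N hb
  have hsb : 0 < √b := Real.sqrt_pos.2 hb
  have hu : ∀ᵐ x, x ∈ B → η * (A * Real.exp (-1)) ^ α ≤ G ‖u x‖ := by
    filter_upwards [norm_smul_ae A (gauss 𝕜 N hb),
      (memLp_gaussFun (𝕜 := 𝕜) (N := N) hb).coeFn_toLp] with x h1 h2 hx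
    rw [h1, gauss, h2, norm_gaussFun, abs_of_pos hA]
    simp only [B, Metric.mem_ball, dist_zero_right] at hx
    have hx2 : b * ‖x‖ ^ 2 ≤ 1 := by
      have h3 : ‖x‖ * √b ≤ 1 := by
        rw [lt_div_iff₀ hsb] at hx
        exact hx.le
      have h4 : (‖x‖ * √b) ^ 2 ≤ 1 := pow_le_one₀ (by positivity) h3
      rw [mul_pow, Real.sq_sqrt hb.le] at h4
      linarith
    have hle : A * Real.exp (-b * ‖x‖ ^ 2) ≤ A := by
      have : Real.exp (-b * ‖x‖ ^ 2) ≤ 1 := Real.exp_le_one_iff.2 (by nlinarith [sq_nonneg ‖x‖])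
      nlinarith
    refine le_trans ?_ (hG _ (by positivity) (hle.trans_lt hAδ))
    gcongr
    linarith
  set c := (η * (A * Real.exp (-1)) ^ α) * (2 / √b) ^ (β - (N : ℝ)) *
      (η * (A * Real.exp (-1)) ^ α)
  calc ENNReal.ofReal c * volume B ^ 2 = ∫⁻ _ in B, ∫⁻ _ in B, ENNReal.ofReal c := by
        rw [setLIntegral_const, setLIntegral_const]; ring
    _ ≤ ∫⁻ x in B, ∫⁻ y in B,
        ENNReal.ofReal (G ‖u x‖ * ‖x - y‖ ^ (β - (N : ℝ)) * G ‖u y‖) := by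
        apply lintegral_mono_ae
        filter_upwards [ae_restrict_of_ae hu, ae_restrict_mem measurableSet_ball] with x hx hxB
        apply lintegral_mono_ae
        -- The diagonal has to be removed: there the negative power `‖x - y‖ ^ (β - N)` takes the
        -- default value 0 and the lower bound fails.
        filter_upwards [ae_restrict_of_ae hu, ae_restrict_mem measurableSet_ball,
          ae_restrict_of_ae (Measure.ae_ne volume x)] with y hy hyB hne
        apply ENNReal.ofReal_le_ofReal
        have hx' := hx hxB
        have hy' := hy hyB
        have h0 : 0 < η * (A * Real.exp (-1)) ^ α := by positivity
        have hpos : 0 < ‖x - y‖ := norm_pos_iff.2 (sub_ne_zero.2 (Ne.symm hne))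
        have hd : ‖x - y‖ ≤ 2 / √b := by
          simp only [Metric.mem_ball, dist_zero_right, B] at hxB hyB
          have := norm_sub_le x y
          have e : 2 / √b = 1 / √b + 1 / √b := by ring
          linarith
        have hk : (2 / √b) ^ (β - (N : ℝ)) ≤ ‖x - y‖ ^ (β - (N : ℝ)) :=
          Real.rpow_le_rpow_of_nonpos hpos hd (by linarith)
        have : 0 ≤ G ‖u x‖ := h0.le.trans hx'
        exact mul_le_mul (mul_le_mul hx' hk (by positivity) this) hy' h0.le (by positivity)
    _ ≤ _ := (lintegral_mono fun x => setLIntegral_le_lintegral _ _).trans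
        (setLIntegral_le_lintegral _ _)

theorem tendsto_rpow_nhdsGT_zero {p : ℝ} (hp : 0 < p) (c : ℝ) :
    Tendsto (fun b : ℝ => c * b ^ p) (𝓝[>] 0) (𝓝 0) := by
  have h := (Real.continuousAt_rpow_const 0 p (Or.inr hp.le)).tendsto
  rw [Real.zero_rpow hp.ne'] at h
  simpa using (h.mono_left nhdsWithin_le_nhds).const_mul c

/-- There are functions of any given mass with negative energy. -/
theorem exists_kinetic_lt_hartree (𝕜 : Type) [RCLike 𝕜] (hN : 0 < N) {β α η δ lam : ℝ} {G : ℝ → ℝ}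
    (hs0 : 0 < s) (hs1 : s < 1) (hβN : β < N) (hα : 0 < α) (hαs : α < 1 + (2 * s + β) / N)
    (hη : 0 < η) (hδ : 0 < δ) (hG : ∀ t, 0 < t → t < δ → η * t ^ α ≤ G t) (hlam : 0 < lam) :
    ∃ u : L2 𝕜 N, kinetic s u ≠ ∞ ∧ ‖u‖ ^ 2 = lam ∧ kinetic s u < hartree β G u := by
  have : Nonempty (Fin N) := ⟨⟨0, hN⟩⟩
  have hN' : (0 : ℝ) < N := by exact_mod_cast hN
  have hpi := Real.pi_pos
  set V := (volume (Metric.ball (0 : Rn N) 1)).toReal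
  have hV : 0 < V := ENNReal.toReal_pos (Metric.measure_ball_pos volume _ one_pos).ne'
    measure_ball_lt_top.ne
  have hV' : volume (Metric.ball (0 : Rn N) 1) = ENNReal.ofReal V :=
    (ENNReal.ofReal_toReal measure_ball_lt_top.ne).symm
  -- Normalizes the mass: with amplitude A = a b^(N/4) the Gaussian has mass λ for every b.
  set a := √lam * (2 / Real.pi) ^ ((N : ℝ) / 4) with ha
  have ha0 : 0 < a := by positivity
  -- The power of b in the lower bound for D: Nα/2 from the amplitude, (N - β)/2 from the kernel, -N
  -- from the squared volume.
  set q := (N * α - N - β) / 2 with hq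
  have hqs : 0 < s - q := by
    have : N * α < N * (1 + (2 * s + β) / N) := by gcongr
    rw [mul_add, mul_div_cancel₀ _ hN'.ne'] at this
    rw [hq]; linarith
  set C := (η * (a * Real.exp (-1)) ^ α) ^ 2 * 2 ^ (β - (N : ℝ)) * V ^ 2 with hC
  have hC0 : 0 < C := by positivity
  set K := 4 * 2 ^ ((N : ℝ) / 2) * lam with hK
  have ev1 := (tendsto_rpow_nhdsGT_zero (show 0 < (N : ℝ) / 4 by positivity) a).eventually
    (gt_mem_nhds hδ)
  have ev2 := (tendsto_rpow_nhdsGT_zero hqs K).eventually (gt_mem_nhds hC0)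
  obtain ⟨b, hbδ, hbC, hb⟩ := (ev1.and (ev2.and self_mem_nhdsWithin)).exists
  replace hb : 0 < b := hb
  set A := a * b ^ ((N : ℝ) / 4) with hA
  have hA0 : 0 < A := by positivity
  have hA2 : A ^ 2 = lam * (2 * b / Real.pi) ^ ((N : ℝ) / 2) := by
    rw [hA, ha, mul_pow, mul_pow, Real.sq_sqrt hlam.le, mul_assoc, ← Real.rpow_natCast,
      ← Real.rpow_natCast, ← Real.rpow_mul (by positivity), ← Real.rpow_mul (by positivity),
      ← Real.mul_rpow (by positivity) (by positivity)]
    congr 2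
    · ring
    · push_cast; ring
  have hkin : kinetic s (A • gauss 𝕜 N hb) ≤ ENNReal.ofReal (K * b ^ s) := by
    rw [kinetic_smul]
    refine (mul_le_mul_right (kinetic_gauss_le hb hs0 hs1) _).trans_eq ?_
    rw [← ENNReal.ofReal_mul (by positivity), hA2, hK]
    congr 1
    have e : (2 * b / Real.pi) ^ ((N : ℝ) / 2) * (Real.pi / b) ^ ((N : ℝ) / 2) =
        2 ^ ((N : ℝ) / 2) := by
      rw [← Real.mul_rpow (by positivity) (by positivity)]
      congr 1
      field_simp
    calc _ = lam * 4 * b ^ s *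
        ((2 * b / Real.pi) ^ ((N : ℝ) / 2) * (Real.pi / b) ^ ((N : ℝ) / 2)) := by ring
      _ = _ := by rw [e]; ring
  refine ⟨A • gauss 𝕜 N hb, ne_top_of_le_ne_top ENNReal.ofReal_ne_top hkin, ?_, ?_⟩
  · rw [norm_smul, mul_pow, norm_gauss_sq, Real.norm_eq_abs, sq_abs, hA2, mul_assoc,
      ← Real.mul_rpow (by positivity) (by positivity)]
    rw [show 2 * b / Real.pi * (Real.pi / (2 * b)) = 1 by field_simp, Real.one_rpow, mul_one]
  · refine lt_of_le_of_lt hkin (lt_of_lt_of_le ?_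
      (hartree_smul_gauss_ge hN hβN hα hη hG hA0 hbδ hb))
    have hsb : √b = b ^ (1 / 2 : ℝ) := Real.sqrt_eq_rpow b
    rw [Measure.addHaar_ball volume 0 (by positivity), hV', ← ENNReal.ofReal_mul (by positivity),
      ← ENNReal.ofReal_pow (by positivity), ← ENNReal.ofReal_mul (by positivity)]
    have e : (η * (A * Real.exp (-1)) ^ α) * (2 / √b) ^ (β - (N : ℝ)) *
        (η * (A * Real.exp (-1)) ^ α) * ((1 / √b) ^ Module.finrank ℝ (Rn N) * V) ^ 2 =
        C * b ^ q := by
      have e1 : (A * Real.exp (-1)) ^ α = (a * Real.exp (-1)) ^ α * b ^ ((N : ℝ) / 4 * α) := by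
        rw [hA, mul_right_comm, Real.mul_rpow (by positivity) (by positivity),
          ← Real.rpow_mul hb.le]
      have e2 : (2 / √b) ^ (β - (N : ℝ)) = 2 ^ (β - (N : ℝ)) * b ^ (((N : ℝ) - β) / 2) := by
        rw [Real.div_rpow (by positivity) (by positivity), hsb, ← Real.rpow_mul hb.le,
          div_eq_mul_inv, ← Real.rpow_neg hb.le]
        congr 2
        ring
      have e3 : ((1 / √b) ^ Module.finrank ℝ (Rn N)) ^ 2 = b ^ (-(N : ℝ)) := by
        rw [finrank_euclideanSpace, Fintype.card_fin, ← pow_mul, mul_comm, pow_mul, div_pow,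
          Real.sq_sqrt hb.le, one_pow, one_div, Real.rpow_neg hb.le, inv_pow, Real.rpow_natCast]
      have e4 : b ^ q = b ^ ((N : ℝ) / 4 * α) * b ^ ((N : ℝ) / 4 * α) *
          b ^ (((N : ℝ) - β) / 2) * b ^ (-(N : ℝ)) := by
        rw [← Real.rpow_add hb, ← Real.rpow_add hb, ← Real.rpow_add hb]
        congr 1
        rw [hq]; ring
      rw [mul_pow, e1, e2, e3, e4, hC]
      ring
    rw [e]
    apply (ENNReal.ofReal_lt_ofReal_iff (by positivity)).2
    calc K * b ^ s = K * b ^ (s - q) * b ^ q := by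
          rw [mul_assoc K, ← Real.rpow_add hb, sub_add_cancel]
      _ < C * b ^ q := by gcongr

end gaussian

/-! ### The energy functional -/

/-- The hypotheses on the nonlinearity, with fixed exponents. -/
structure Setting (N : ℕ) (s β : ℝ) (G : ℝ → ℝ) (μ r η : ℝ) : Prop where
  exps : Exponents N s β μ r
  hβ0 : 0 < β
  hη : 0 < η
  growth : ∀ t, 0 ≤ t → G t ≤ η * (t ^ 2 + t ^ μ)
  deriv_growth : ∀ t, 0 ≤ t → |derivWithin G (Set.Ici 0) t| ≤ η * (t + t ^ (μ - 1))
  diff : DifferentiableOn ℝ G (Set.Ici 0)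
  nonneg : ∀ t, 0 ≤ t → 0 ≤ G t
  map_zero : G 0 = 0
  scaling : ∀ θ t : ℝ, 1 ≤ θ → 0 ≤ t → θ ^ (1 + (2 * s + β) / (2 * N)) * G t ≤ G (θ * t)

/-- The energy as a real number, meaningful on `H^s`. -/
def realEnergy {𝕜 : Type} [RCLike 𝕜] {N : ℕ} (s β : ℝ) (G : ℝ → ℝ) (u : L2 𝕜 N) : ℝ :=
  (kinetic s u).toReal / 2 - (hartree β G u).toReal / 2

section energy

variable {𝕜 : Type} [RCLike 𝕜] {N : ℕ} {s β μ r η lam : ℝ} {G : ℝ → ℝ}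

/-- D is quadratic in the density, so its kinetic exponent is twice that of `exists_powSum_le`,
still below 1. -/
theorem exists_hartree_le (𝕜 : Type) [RCLike 𝕜] (S : Setting N s β G μ r η) :
    ∃ κ : ℝ, 0 ≤ κ ∧ κ < 1 ∧ ∀ M : ℝ≥0∞, M ≠ ∞ → ∃ C : ℝ≥0∞, C ≠ ∞ ∧
      ∀ u : L2 𝕜 N, ‖u‖ₑ ≤ M → hartree β G u ≤ C * (1 + kinetic s u) ^ κ := by
  have E := S.exps
  have hGc := S.diff.continuousOn
  obtain ⟨κ, hκ0, hκ1, h⟩ := exists_powSum_le 𝕜 E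
  obtain ⟨A, hA, hform⟩ := form_le E.hN E.hβN E.hr1 E.hr2 E.hrβ
  refine ⟨κ + κ, by linarith, by linarith, fun M hM => ?_⟩
  obtain ⟨C, hC, h⟩ := h M hM
  refine ⟨A * ((ENNReal.ofReal η * C) * (ENNReal.ofReal η * C)), by
    exact ENNReal.mul_ne_top hA (ENNReal.mul_ne_top (ENNReal.mul_ne_top ENNReal.ofReal_ne_top hC)
      (ENNReal.mul_ne_top ENNReal.ofReal_ne_top hC)), fun u hu => ?_⟩
  have hX : xNorm r (dens G u) ≤ ENNReal.ofReal η * C * (1 + kinetic s u) ^ κ := by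
    refine (xNorm_dens_univ_le E.hr1.le (by linarith [E.hμ]) S.hη S.growth u).trans ?_
    rw [mul_assoc]
    gcongr
    exact h u hu
  rw [hartree_eq_form hGc S.nonneg, ENNReal.rpow_add_of_nonneg _ _ hκ0 hκ0]
  refine (hform _ _ (aemeasurable_dens hGc u) (aemeasurable_dens hGc u)).trans ?_
  calc _ ≤ A * ((ENNReal.ofReal η * C * (1 + kinetic s u) ^ κ) *
        (ENNReal.ofReal η * C * (1 + kinetic s u) ^ κ)) := by gcongr
    _ = _ := by ring

theorem hartree_ne_top (S : Setting N s β G μ r η) {u : L2 𝕜 N} (hu : kinetic s u ≠ ∞) :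
    hartree β G u ≠ ∞ := by
  obtain ⟨κ, hκ0, -, h⟩ := exists_hartree_le 𝕜 S
  obtain ⟨C, hC, h⟩ := h ‖u‖ₑ (by simp)
  exact ne_top_of_le_ne_top (ENNReal.mul_ne_top hC
    (ENNReal.rpow_ne_top_of_nonneg hκ0 (by simp [hu]))) (h u le_rfl)

theorem energy_eq_coe (S : Setting N s β G μ r η) {u : L2 𝕜 N} (hu : kinetic s u ≠ ∞) :
    energy s β G u = (realEnergy s β G u : EReal) := by
  have hh := hartree_ne_top S hu
  rw [energy, realEnergy, EReal.coe_sub]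
  congr 1
  · rw [← EReal.coe_ennreal_toReal (ENNReal.div_ne_top hu (by norm_num)), ENNReal.toReal_div]
    simp
  · rw [← EReal.coe_ennreal_toReal (ENNReal.div_ne_top hh (by norm_num)), ENNReal.toReal_div]
    simp

theorem rpow_le_half_add {C κ : ℝ} (hC : 0 ≤ C) (hκ0 : 0 ≤ κ) (hκ1 : κ < 1) :
    ∃ B : ℝ, 0 ≤ B ∧ ∀ x, 0 < x → C * x ^ κ ≤ x / 2 + B := by
  set x₀ := (2 * C) ^ (1 / (1 - κ)) with hx₀
  have h1 : 0 < 1 - κ := by linarith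
  have hx₀0 : 0 ≤ x₀ := by positivity
  refine ⟨C * x₀ ^ κ, by positivity, fun x hx => ?_⟩
  rcases le_total x x₀ with h | h
  · have : C * x ^ κ ≤ C * x₀ ^ κ := by gcongr
    linarith
  · have h2 : 2 * C ≤ x ^ (1 - κ) := by
      calc 2 * C = x₀ ^ (1 - κ) := by
            rw [hx₀, ← Real.rpow_mul (by positivity), one_div_mul_cancel h1.ne', Real.rpow_one]
        _ ≤ _ := by gcongr
    have h3 : x = x ^ (1 - κ) * x ^ κ := by
      rw [← Real.rpow_add hx, sub_add_cancel, Real.rpow_one]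
    have h4 : 2 * C * x ^ κ ≤ x := by
      conv_rhs => rw [h3]
      gcongr
    have h5 : 0 ≤ C * x₀ ^ κ := by positivity
    linarith

/-- Coercivity of the energy on spheres of `L²`. -/
theorem exists_kinetic_le (𝕜 : Type) [RCLike 𝕜] (S : Setting N s β G μ r η) (lam : ℝ) :
    ∃ B : ℝ, ∀ u : L2 𝕜 N, u ∈ admissible 𝕜 N s lam →
      (kinetic s u).toReal ≤ 4 * realEnergy s β G u + B := by
  obtain ⟨κ, hκ0, hκ1, h⟩ := exists_hartree_le 𝕜 S
  obtain ⟨C, hC, h⟩ := h (ENNReal.ofReal √lam) ENNReal.ofReal_ne_top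
  obtain ⟨B, hB, hx⟩ := rpow_le_half_add (C := C.toReal) ENNReal.toReal_nonneg hκ0 hκ1
  -- From K = 2E + D and D ≤ (1 + K)/2 + B it follows that K ≤ 4E + 1 + 2B.
  refine ⟨1 + 2 * B, fun u hu => ?_⟩
  have hk : kinetic s u ≠ ∞ := hu.1.ne
  have hn : ‖u‖ₑ ≤ ENNReal.ofReal √lam := by
    rw [← hu.2, Real.sqrt_sq (norm_nonneg _), ofReal_norm]
  have h1 := ENNReal.toReal_mono (ENNReal.mul_ne_top hC
    (ENNReal.rpow_ne_top_of_nonneg hκ0 (by simp [hk]))) (h u hn)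
  rw [ENNReal.toReal_mul, ← ENNReal.toReal_rpow, ENNReal.toReal_add (by simp) hk,
    ENNReal.toReal_one] at h1
  have h0 : 0 ≤ (kinetic s u).toReal := ENNReal.toReal_nonneg
  have h2 := hx (1 + (kinetic s u).toReal) (by linarith)
  rw [realEnergy]
  linarith

theorem hartree_smul_ge (S : Setting N s β G μ r η) {θ : ℝ} (hθ : 1 ≤ θ) (u : L2 𝕜 N) :
    ENNReal.ofReal (θ ^ (2 + (2 * s + β) / N)) * hartree β G u ≤ hartree β G (θ • u) := by
  have hN := S.exps.hN'
  have hθ0 : 0 < θ := by linarith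
  set p := 1 + (2 * s + β) / (2 * N) with hp
  have hpp : θ ^ (2 + (2 * s + β) / N) = θ ^ p * θ ^ p := by
    rw [← Real.rpow_add hθ0, hp]
    congr 1
    field_simp
    ring
  unfold hartree
  rw [← lintegral_const_mul' _ _ ENNReal.ofReal_ne_top]
  have hu := norm_smul_ae θ u
  apply lintegral_mono_ae
  filter_upwards [hu] with x hx
  rw [← lintegral_const_mul' _ _ ENNReal.ofReal_ne_top]
  apply lintegral_mono_ae
  filter_upwards [hu] with y hy
  rw [← ENNReal.ofReal_mul (by positivity), hx, hy, abs_of_pos hθ0, hpp]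
  apply ENNReal.ofReal_le_ofReal
  have h1 := S.scaling θ ‖u x‖ hθ (norm_nonneg _)
  have h2 := S.scaling θ ‖u y‖ hθ (norm_nonneg _)
  have h3 := S.nonneg _ (norm_nonneg (u x))
  have h4 := S.nonneg _ (norm_nonneg (u y))
  have h5 := S.nonneg (θ * ‖u x‖) (by positivity)
  calc θ ^ p * θ ^ p * (G ‖u x‖ * ‖x - y‖ ^ (β - (N : ℝ)) * G ‖u y‖)
      = (θ ^ p * G ‖u x‖) * ‖x - y‖ ^ (β - (N : ℝ)) * (θ ^ p * G ‖u y‖) := by ring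
    _ ≤ _ := by
      refine mul_le_mul (mul_le_mul_of_nonneg_right h1 (by positivity)) h2 (by positivity)
        (by positivity)

theorem realEnergy_smul_le (S : Setting N s β G μ r η) {θ : ℝ} (hθ : 1 ≤ θ) {u : L2 𝕜 N}
    (hu : kinetic s u ≠ ∞) : realEnergy s β G (θ • u) ≤
      θ ^ 2 * ((kinetic s u).toReal / 2 - θ ^ ((2 * s + β) / N) * ((hartree β G u).toReal / 2)) := by
  have hθ0 : 0 < θ := by linarith
  have hk : (kinetic s (θ • u)).toReal = θ ^ 2 * (kinetic s u).toReal := by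
    rw [kinetic_smul, ENNReal.toReal_mul, ENNReal.toReal_ofReal (by positivity)]
  have hkθ : kinetic s (θ • u) ≠ ∞ := by
    rw [kinetic_smul]; exact ENNReal.mul_ne_top ENNReal.ofReal_ne_top hu
  have hh := ENNReal.toReal_mono (hartree_ne_top S hkθ) (hartree_smul_ge S hθ u)
  rw [ENNReal.toReal_mul, ENNReal.toReal_ofReal (by positivity), Real.rpow_add hθ0,
    Real.rpow_two] at hh
  rw [realEnergy, hk]
  linarith

theorem realEnergy_zero (S : Setting N s β G μ r η) : realEnergy s β G (0 : L2 𝕜 N) = 0 := by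
  have hk : kinetic s (0 : L2 𝕜 N) = 0 := by
    simpa using kinetic_smul (s := s) 0 (0 : L2 𝕜 N)
  have hh : hartree β G (0 : L2 𝕜 N) = 0 := by
    rw [hartree, lintegral_eq_zero_iff']
    · filter_upwards [Lp.coeFn_zero 𝕜 2 (volume : Measure (Rn N))] with x hx
      rw [hx]
      simp [S.map_zero]
    · have : AEMeasurable (fun _ : Rn N => (0 : ℝ≥0∞)) volume := aemeasurable_const
      refine this.congr ?_
      filter_upwards [Lp.coeFn_zero 𝕜 2 (volume : Measure (Rn N))] with x hx
      rw [hx]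
      simp [S.map_zero]
  rw [realEnergy, hk, hh]
  simp

variable {I : ℝ}

/-- Tests the infimum with θw, where θ² = λ/‖w‖² restores the mass λ, and divides by θ². The Hartree
term retains the extra factor θ^((2s+β)/N) ≥ 1, the source of strict binding. -/
theorem le_smul_energy (S : Setting N s β G μ r η) (hlam : 0 < lam)
    (hI : ∀ u ∈ admissible 𝕜 N s lam, I ≤ realEnergy s β G u) {w : L2 𝕜 N}
    (hw : kinetic s w ≠ ∞) (hw0 : 0 < ‖w‖ ^ 2) (hwl : ‖w‖ ^ 2 ≤ lam) :
    ‖w‖ ^ 2 / lam * I ≤ (kinetic s w).toReal / 2 -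
      (lam / ‖w‖ ^ 2) ^ ((2 * s + β) / N / 2) * ((hartree β G w).toReal / 2) := by
  set θ := √(lam / ‖w‖ ^ 2) with hθ
  have hq : 1 ≤ lam / ‖w‖ ^ 2 := (one_le_div hw0).2 hwl
  have hθ1 : 1 ≤ θ := Real.one_le_sqrt.2 hq
  have hθ2 : θ ^ 2 = lam / ‖w‖ ^ 2 := Real.sq_sqrt (by positivity)
  have hadm : θ • w ∈ admissible 𝕜 N s lam := by
    refine ⟨?_, ?_⟩
    · change kinetic s (θ • w) < ∞
      rw [kinetic_smul]
      exact ENNReal.mul_lt_top ENNReal.ofReal_lt_top (lt_top_iff_ne_top.2 hw)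
    · rw [norm_smul, mul_pow, Real.norm_eq_abs, sq_abs, hθ2, div_mul_cancel₀ _ hw0.ne']
  have h := (hI _ hadm).trans (realEnergy_smul_le S hθ1 hw)
  have hθσ : θ ^ ((2 * s + β) / N) = (lam / ‖w‖ ^ 2) ^ ((2 * s + β) / N / 2) := by
    rw [hθ, Real.sqrt_eq_rpow, ← Real.rpow_mul (by positivity)]
    congr 1
    ring
  rw [hθσ, hθ2] at h
  set X := (kinetic s w).toReal / 2 -
      (lam / ‖w‖ ^ 2) ^ ((2 * s + β) / N / 2) * ((hartree β G w).toReal / 2)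
  calc ‖w‖ ^ 2 / lam * I ≤ ‖w‖ ^ 2 / lam * (lam / ‖w‖ ^ 2 * X) := by gcongr
    _ = X := by rw [← mul_assoc, div_mul_div_cancel₀ hlam.ne', div_self hw0.ne', one_mul]

theorem mass_mul_le_realEnergy (S : Setting N s β G μ r η) (hlam : 0 < lam)
    (hI : ∀ u ∈ admissible 𝕜 N s lam, I ≤ realEnergy s β G u) {w : L2 𝕜 N}
    (hw : kinetic s w ≠ ∞) (hwl : ‖w‖ ^ 2 ≤ lam) : ‖w‖ ^ 2 / lam * I ≤ realEnergy s β G w := by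
  rcases eq_or_ne w 0 with rfl | hw0
  · rw [realEnergy_zero S]; simp
  have hw0 : 0 < ‖w‖ ^ 2 := by positivity
  refine (le_smul_energy S hlam hI hw hw0 hwl).trans ?_
  rw [realEnergy]
  have hN := S.exps.hN'
  have hs := S.exps.hs
  have hβ := S.hβ0
  have h1 : 1 ≤ (lam / ‖w‖ ^ 2) ^ ((2 * s + β) / N / 2) :=
    Real.one_le_rpow ((one_le_div hw0).2 hwl) (by positivity)
  have h2 : 0 ≤ (hartree β G w).toReal / 2 := by positivity
  nlinarith

/-- If D(w) = 0, the energy is nonnegative while I < 0; otherwise the factor in front of D in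
`le_smul_energy` is strictly greater than 1. -/
theorem mass_mul_lt_realEnergy (S : Setting N s β G μ r η) (hlam : 0 < lam) (hI0 : I < 0)
    (hI : ∀ u ∈ admissible 𝕜 N s lam, I ≤ realEnergy s β G u) {w : L2 𝕜 N}
    (hw : kinetic s w ≠ ∞) (hw0 : 0 < ‖w‖ ^ 2) (hwl : ‖w‖ ^ 2 < lam) :
    ‖w‖ ^ 2 / lam * I < realEnergy s β G w := by
  rcases eq_or_lt_of_le (show 0 ≤ (hartree β G w).toReal by positivity) with h | h
  · rw [realEnergy, ← h]
    have h1 : 0 ≤ (kinetic s w).toReal := by positivity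
    have h2 : ‖w‖ ^ 2 / lam * I < 0 := mul_neg_of_pos_of_neg (by positivity) hI0
    linarith
  · refine (le_smul_energy S hlam hI hw hw0 hwl.le).trans_lt ?_
    rw [realEnergy]
    have hN := S.exps.hN'
    have hs := S.exps.hs
    have hβ := S.hβ0
    have h1 : 1 < (lam / ‖w‖ ^ 2) ^ ((2 * s + β) / N / 2) :=
      Real.one_lt_rpow ((one_lt_div hw0).2 hwl) (by positivity)
    nlinarith

end energy

/-! ### Compactness of minimizing sequences -/

section compactness

variable {𝕜 : Type} [RCLike 𝕜] {N : ℕ} {s β μ r η lam I : ℝ} {G : ℝ → ℝ}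

/-- The kinetic terms of w + v and v are kept as a difference, since that difference is what
converges in `exists_weak_limit`. -/
theorem realEnergy_add_ge (S : Setting N s β G μ r η) {w v : L2 𝕜 N} {ε : ℝ} (hε : 0 ≤ ε)
    (hw : kinetic s w ≠ ∞) (hv : kinetic s v ≠ ∞)
    (h : hartree β G (w + v) ≤ hartree β G w + hartree β G v + ENNReal.ofReal ε) :
    ((kinetic s (w + v)).toReal - (kinetic s v).toReal) / 2 - (hartree β G w).toReal / 2 +
      realEnergy s β G v - ε / 2 ≤ realEnergy s β G (w + v) := by
  have h1 := hartree_ne_top S hw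
  have h2 := hartree_ne_top S hv
  have h3 := ENNReal.toReal_mono (by simp [h1, h2]) h
  rw [ENNReal.toReal_add (by simp [h1, h2]) ENNReal.ofReal_ne_top, ENNReal.toReal_add h1 h2,
    ENNReal.toReal_ofReal hε] at h3
  rw [realEnergy, realEnergy]
  linarith

theorem tendsto_kinetic_zero_of_real {v : ℕ → L2 𝕜 N} (hv : ∀ n, kinetic s (v n) ≠ ∞)
    (h : Tendsto (fun n => (kinetic s (v n)).toReal) atTop (𝓝 0)) :
    Tendsto (fun n => kinetic s (v n)) atTop (𝓝 0) := by
  have := ENNReal.tendsto_ofReal h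
  rw [ENNReal.ofReal_zero] at this
  exact this.congr fun n => ENNReal.ofReal_toReal (hv n)

/-- A minimizing sequence with non-vanishing low frequencies at the origin is relatively compact
in `H^s`. -/
theorem exists_subseq_tendstoHs (S : Setting N s β G μ r η) (hlam : 0 < lam) (hI0 : I < 0)
    (hI : ∀ u ∈ admissible 𝕜 N s lam, I ≤ realEnergy s β G u) {z : ℕ → L2 𝕜 N}
    (hz : ∀ n, z n ∈ admissible 𝕜 N s lam)
    (hzI : Tendsto (fun n => realEnergy s β G (z n)) atTop (𝓝 I)) {R c : ℝ} (hc : 0 < c)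
    (hlow : ∀ n, c < ‖lowPass R (ft 𝕜 N (z n)) 0‖) :
    ∃ ψ : ℕ → ℕ, StrictMono ψ ∧ ∃ w : L2 𝕜 N, w ∈ admissible 𝕜 N s lam ∧
      realEnergy s β G w = I ∧ TendstoHs s (fun k => z (ψ k)) w := by
  have E := S.exps
  have hs := E.hs
  obtain ⟨B, hB⟩ := exists_kinetic_le 𝕜 S lam
  obtain ⟨T, hT⟩ := hzI.bddAbove_range
  have hkz : ∀ n, (kinetic s (z n)).toReal ≤ 4 * T + B := fun n =>
    (hB _ (hz n)).trans (by linarith [hT ⟨n, rfl⟩])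
  have hzM : ∀ n, ‖z n‖ ≤ √lam := fun n => by
    rw [← (hz n).2, Real.sqrt_sq (norm_nonneg _)]
  obtain ⟨w, ψ, hψ, hwk, hvk, hweak, hmass, hkin⟩ := exists_weak_limit (s := s) (K := 4 * T + B) hzM
    (fun n => by
      rw [← ENNReal.ofReal_toReal (hz n).1.ne]
      exact ENNReal.ofReal_le_ofReal (hkz n))
  set v := fun n => z (ψ n) - w with hv
  have hzv : ∀ n, w + v n = z (ψ n) := fun n => add_sub_cancel _ _
  have hvweak : ∀ g : L2 ℂ N, Tendsto (fun n => inner ℂ g (ft 𝕜 N (v n))) atTop (𝓝 0) := by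
    intro g
    have := (hweak g).sub_const (inner ℂ g (ft 𝕜 N w))
    rw [sub_self] at this
    refine this.congr fun n => ?_
    rw [hv, map_sub, inner_sub_right]
  -- A lower bound T' for the convergent kinetic differences turns the bound on the kinetic energy
  -- of z into one for the remainders.
  obtain ⟨T', hT'⟩ := hkin.bddBelow_range
  set K := ENNReal.ofReal (4 * T + B - T')
  have hvK : ∀ n, kinetic s (v n) ≤ K := fun n => by
    rw [← ENNReal.ofReal_toReal (hvk n)]
    apply ENNReal.ofReal_le_ofReal
    have h1 := hT' ⟨n, rfl⟩
    have h2 := hkz (ψ n)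
    dsimp only at h1
    linarith
  set M := ENNReal.ofReal (√lam + ‖w‖)
  have hvM : ∀ n, ‖v n‖ₑ ≤ M := fun n => by
    rw [← ofReal_norm]
    apply ENNReal.ofReal_le_ofReal
    exact (norm_sub_le _ _).trans (by linarith [hzM (ψ n)])
  have hM : M ≠ ∞ := ENNReal.ofReal_ne_top
  have hK : K ≠ ∞ := ENNReal.ofReal_ne_top
  have hloc := fun m => tendsto_pInt_ball_of_weak hs hM hK hvM hvK hvweak m
  -- The lower bound on the low-frequency part at the origin survives the weak limit; this excludes
  -- vanishing.
  have hw0 : w ≠ 0 := by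
    rintro rfl
    have h1 := (tendsto_lowPass hweak R 0).norm
    obtain ⟨g, hg, -⟩ := exists_inner_eq_lowPass (N := N) R 0
    rw [hg (ft 𝕜 N 0), map_zero, inner_zero_right, norm_zero] at h1
    have h2 := ge_of_tendsto h1 (Eventually.of_forall fun n => (hlow (ψ n)).le)
    linarith
  have hm0 : 0 < ‖w‖ ^ 2 := by positivity
  have hmass' : Tendsto (fun n => ‖v n‖ ^ 2) atTop (𝓝 (lam - ‖w‖ ^ 2)) := by
    refine (hmass.const_sub lam).congr fun n => ?_
    rw [(hz (ψ n)).2]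
    simp [hv]
  have hml : ‖w‖ ^ 2 ≤ lam := by
    have := ge_of_tendsto hmass' (Eventually.of_forall fun n => sq_nonneg ‖v n‖)
    linarith
  have hzψ : Tendsto (fun n => realEnergy s β G (z (ψ n))) atTop (𝓝 I) :=
    hzI.comp hψ.tendsto_atTop
  have hsplit : ∀ ε : ℝ, 0 < ε → ∀ᶠ n in atTop,
      ((kinetic s (z (ψ n))).toReal - (kinetic s (v n)).toReal) / 2 - (hartree β G w).toReal / 2 +
      realEnergy s β G (v n) - ε / 2 ≤ realEnergy s β G (z (ψ n)) := by
    intro ε hε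
    filter_upwards [eventually_hartree_add_le E S.hη S.growth S.diff S.nonneg S.deriv_growth hM hK
      hwk hvM hvK hloc (ENNReal.ofReal_pos.2 hε)] with n hn
    have := realEnergy_add_ge S hε.le hwk (hvk n) hn
    rwa [hzv] at this
  have hkin2 : Tendsto (fun n => ((kinetic s (z (ψ n))).toReal - (kinetic s (v n)).toReal) / 2 -
      (hartree β G w).toReal / 2) atTop (𝓝 (realEnergy s β G w)) :=
    (hkin.div_const 2).sub_const _
  -- Excludes dichotomy: the remainder has energy at least (‖v‖²/λ) I, so in the limit E(w) -
  -- (‖w‖²/λ) I ≤ d/2, while the left side is d > 0 by strict binding.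
  have hmeq : ‖w‖ ^ 2 = lam := by
    by_contra hne
    have hlt : ‖w‖ ^ 2 < lam := lt_of_le_of_ne hml hne
    have hstrict := mass_mul_lt_realEnergy S hlam hI0 hI hwk hm0 hlt
    set d := realEnergy s β G w - ‖w‖ ^ 2 / lam * I with hd
    have hd0 : 0 < d := by linarith
    have hlim := ((hkin2.add ((hmass'.div_const lam).mul_const I)).sub_const (d / 2))
    have hle := le_of_tendsto_of_tendsto hlim hzψ (by
      filter_upwards [hsplit d hd0, hmass'.eventually (gt_mem_nhds (show lam - ‖w‖ ^ 2 < lam by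
        linarith))] with n h1 h2
      have h3 := mass_mul_le_realEnergy S hlam hI (hvk n) h2.le
      change ‖v n‖ ^ 2 / lam * I ≤ realEnergy s β G (v n) at h3
      linarith)
    have e : (lam - ‖w‖ ^ 2) / lam * I = I - ‖w‖ ^ 2 / lam * I := by
      field_simp
    rw [e] at hle
    linarith
  have hwadm : w ∈ admissible 𝕜 N s lam := ⟨lt_top_iff_ne_top.2 hwk, hmeq⟩
  have hwI := hI w hwadm
  have hv0 : Tendsto (fun n => ‖v n‖ₑ) atTop (𝓝 0) := by
    rw [hmeq, sub_self] at hmass'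
    apply tendsto_zero_of_sq
    have := ENNReal.tendsto_ofReal hmass'
    rw [ENNReal.ofReal_zero] at this
    refine this.congr fun n => ?_
    rw [ENNReal.ofReal_pow (norm_nonneg _), ofReal_norm]
  have hhv : Tendsto (fun n => (hartree β G (v n)).toReal) atTop (𝓝 0) := by
    have h1 := tendsto_form_dens_of_pInt E S.hη S.growth S.diff.continuousOn hM hK hvM hvK
      (fun p hp hps => tendsto_pInt_of_norm E.hN hs hp.le hps.le hK hv0 hvK)
    have h2 := (ENNReal.tendsto_toReal ENNReal.zero_ne_top).comp h1
    rw [ENNReal.toReal_zero] at h2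
    refine h2.congr fun n => ?_
    rw [Function.comp_apply, hartree_eq_form S.diff.continuousOn S.nonneg]
  -- Now D(v) → 0, so the energy splitting controls K(v)/2 and the excess E(w) - I together; both
  -- are nonnegative, hence each is negligible.
  have hbound : ∀ ε : ℝ, 0 < ε → ∀ᶠ n in atTop,
      (kinetic s (v n)).toReal / 2 + (realEnergy s β G w - I) < ε := by
    intro ε hε
    have hlim := (hkin2.sub (hhv.div_const 2)).sub hzψ
    simp only [zero_div, sub_zero] at hlim
    filter_upwards [hsplit ε hε, hlim.eventually (lt_mem_nhds
      (show realEnergy s β G w - I - ε / 2 < realEnergy s β G w - I by linarith))] with n h1 h2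
    have e : realEnergy s β G (v n) =
      (kinetic s (v n)).toReal / 2 - (hartree β G (v n)).toReal / 2 := rfl
    linarith
  have hwI' : realEnergy s β G w = I := by
    refine le_antisymm (le_of_forall_pos_lt_add fun ε hε => ?_) hwI
    obtain ⟨n, hn⟩ := (hbound ε hε).exists
    have : 0 ≤ (kinetic s (v n)).toReal := ENNReal.toReal_nonneg
    linarith
  have hkv : Tendsto (fun n => (kinetic s (v n)).toReal) atTop (𝓝 0) := by
    rw [Metric.tendsto_atTop']
    intro ε hε
    obtain ⟨n₀, hn₀⟩ := eventually_atTop.1 (hbound (ε / 2) (by linarith))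
    refine ⟨n₀, fun n hn => ?_⟩
    have h1 := hn₀ n hn.le
    rw [hwI', sub_self] at h1
    rw [Real.dist_0_eq_abs, abs_of_nonneg ENNReal.toReal_nonneg]
    linarith
  refine ⟨ψ, hψ, w, hwadm, hwI', ?_⟩
  have h1 := tendsto_kinetic_zero_of_real hvk hkv
  have h2 : Tendsto (fun n => ‖v n‖ₑ ^ 2) atTop (𝓝 0) := by
    have := (ENNReal.continuous_pow 2).tendsto 0 |>.comp hv0
    simpa [Function.comp_def] using this
  have h3 := h2.add h1
  rw [add_zero] at h3
  exact h3

/-! ### The infimum, minimizing sequences and their translates -/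

theorem exists_setting {N : ℕ} {s β : ℝ} {G : ℝ → ℝ} (hs0 : 0 < s) (hβ0 : 0 < β) (hβN : β < N)
    (hA0 : AssumptionA0 N s β G) (hA1 : AssumptionA1 N s β G) :
    ∃ μ r η, Setting N s β G μ r η := by
  obtain ⟨μ, hμ, hμ', η, hη, h⟩ := hA0.growth
  obtain ⟨r, E⟩ := exists_exponents hs0 hβ0 hβN hμ hμ'
  exact ⟨μ, r, η, E, hβ0, hη, fun t ht => (h t ht).1, fun t ht => (h t ht).2, hA0.differentiable,
    hA0.nonneg, hA0.map_zero, hA1.scaling⟩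

/-- Finite from below by coercivity, negative by the Gaussian trial functions. -/
theorem groundEnergy_eq_coe (𝕜 : Type) [RCLike 𝕜] (S : Setting N s β G μ r η) (hs1 : s < 1)
    (hA1 : AssumptionA1 N s β G) (hlam : 0 < lam) :
    ∃ I : ℝ, I < 0 ∧ groundEnergy 𝕜 N s β G lam = (I : EReal) ∧
      ∀ u ∈ admissible 𝕜 N s lam, I ≤ realEnergy s β G u := by
  obtain ⟨α, hα, hα', η', hη', δ, hδ, hlower⟩ := hA1.lower
  obtain ⟨u, huk, hum, hlt⟩ := exists_kinetic_lt_hartree 𝕜 S.exps.hN S.exps.hs hs1 S.exps.hβN hα hα'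
    hη' hδ hlower hlam
  have huadm : u ∈ admissible 𝕜 N s lam := ⟨lt_top_iff_ne_top.2 huk, hum⟩
  have huneg : realEnergy s β G u < 0 := by
    have := (ENNReal.toReal_lt_toReal huk (hartree_ne_top S huk)).2 hlt
    rw [realEnergy]
    linarith
  obtain ⟨B, hB⟩ := exists_kinetic_le 𝕜 S lam
  have hle : groundEnergy 𝕜 N s β G lam ≤ (realEnergy s β G u : EReal) := by
    rw [← energy_eq_coe S huk]
    exact iInf₂_le u huadm
  have hge : ((-B / 4 : ℝ) : EReal) ≤ groundEnergy 𝕜 N s β G lam := by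
    refine le_iInf₂ fun w hw => ?_
    rw [energy_eq_coe S hw.1.ne, EReal.coe_le_coe_iff]
    have h1 := hB w hw
    have h2 : 0 ≤ (kinetic s w).toReal := ENNReal.toReal_nonneg
    linarith
  have hcoe : ((groundEnergy 𝕜 N s β G lam).toReal : EReal) = groundEnergy 𝕜 N s β G lam :=
    EReal.coe_toReal (ne_top_of_le_ne_top (EReal.coe_ne_top _) hle)
      (ne_bot_of_le_ne_bot (EReal.coe_ne_bot _) hge)
  refine ⟨(groundEnergy 𝕜 N s β G lam).toReal, ?_, hcoe.symm, fun w hw => ?_⟩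
  · rw [← hcoe, EReal.coe_le_coe_iff] at hle
    exact hle.trans_lt huneg
  · rw [← EReal.coe_le_coe_iff, hcoe, ← energy_eq_coe S hw.1.ne]
    exact iInf₂_le w hw

theorem exists_isMinimizingSeq (S : Setting N s β G μ r η)
    (hI : groundEnergy 𝕜 N s β G lam = (I : EReal)) :
    ∃ u : ℕ → L2 𝕜 N, IsMinimizingSeq s β G lam u := by
  have h : ∀ n : ℕ, ∃ u ∈ admissible 𝕜 N s lam, realEnergy s β G u < I + 1 / ((n : ℝ) + 1) := by
    intro n
    have h1 : groundEnergy 𝕜 N s β G lam < ((I + 1 / ((n : ℝ) + 1) : ℝ) : EReal) := by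
      rw [hI, EReal.coe_lt_coe_iff]
      have : 0 < 1 / ((n : ℝ) + 1) := by positivity
      linarith
    simp only [groundEnergy, iInf_lt_iff] at h1
    obtain ⟨u, hu, hlt⟩ := h1
    rw [energy_eq_coe S hu.1.ne, EReal.coe_lt_coe_iff] at hlt
    exact ⟨u, hu, hlt⟩
  choose u hu hlt using h
  refine ⟨u, hu, ?_⟩
  have hge : ∀ n, I ≤ realEnergy s β G (u n) := fun n => by
    rw [← EReal.coe_le_coe_iff, ← hI, ← energy_eq_coe S (hu n).1.ne]
    exact iInf₂_le (u n) (hu n)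
  have hlim : Tendsto (fun n => realEnergy s β G (u n)) atTop (𝓝 I) := by
    refine tendsto_of_tendsto_of_tendsto_of_le_of_le tendsto_const_nhds ?_ hge
      (fun n => (hlt n).le)
    simpa using tendsto_one_div_add_atTop_nhds_zero_nat.const_add I
  rw [hI]
  refine (EReal.tendsto_coe.2 hlim).congr fun n => ?_
  rw [energy_eq_coe S (hu n).1.ne]

/-- Minimizing sequences are relatively compact in `H^s` up to translations. -/
theorem exists_translates (S : Setting N s β G μ r η) (hlam : 0 < lam) (hI0 : I < 0)
    (hIg : groundEnergy 𝕜 N s β G lam = (I : EReal))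
    (hI : ∀ u ∈ admissible 𝕜 N s lam, I ≤ realEnergy s β G u) {u : ℕ → L2 𝕜 N}
    (hu : IsMinimizingSeq s β G lam u) :
    ∃ y : ℕ → Rn N, ∀ φ : ℕ → ℕ, StrictMono φ → ∃ ψ : ℕ → ℕ, StrictMono ψ ∧ ∃ w : L2 𝕜 N,
      IsMinimizer s β G lam w ∧
        TendstoHs s (fun k => translate (y (φ (ψ k))) (u (φ (ψ k)))) w := by
  have E := S.exps
  have huk : ∀ n, kinetic s (u n) ≠ ∞ := fun n => (hu.1 n).1.ne
  have hlim : Tendsto (fun n => realEnergy s β G (u n)) atTop (𝓝 I) := by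
    have h := hu.2
    rw [hIg] at h
    refine EReal.tendsto_coe.1 (h.congr fun n => ?_)
    rw [energy_eq_coe S (huk n)]
  obtain ⟨B, hB⟩ := exists_kinetic_le 𝕜 S lam
  obtain ⟨T, hT⟩ := hlim.bddAbove_range
  obtain ⟨R, c, hc, hlow⟩ := exists_lowPass_large 𝕜 E S.hη S.growth S.diff.continuousOn S.nonneg
    (M := ENNReal.ofReal √lam) (K := ENNReal.ofReal (4 * T + B)) (ε := ENNReal.ofReal (-I))
    ENNReal.ofReal_ne_top ENNReal.ofReal_ne_top (ENNReal.ofReal_pos.2 (by linarith))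
  -- Once E < I/2 < 0, the identity D = K - 2E gives D ≥ -I, which rules out vanishing. The finitely
  -- many earlier indices get the arbitrary translation 0.
  obtain ⟨n₀, hn₀⟩ := eventually_atTop.1 (hlim.eventually (gt_mem_nhds (show I < I / 2 by linarith)))
  have hex : ∀ n, ∃ y : Rn N, n₀ ≤ n → c < ‖lowPass R (ft 𝕜 N (u n)) y‖ := by
    intro n
    by_cases hn : n₀ ≤ n
    · have h1 : ‖u n‖ₑ ≤ ENNReal.ofReal √lam := by
        rw [← (hu.1 n).2, Real.sqrt_sq (norm_nonneg _), ofReal_norm]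
      have h2 : kinetic s (u n) ≤ ENNReal.ofReal (4 * T + B) := by
        rw [← ENNReal.ofReal_toReal (huk n)]
        apply ENNReal.ofReal_le_ofReal
        exact (hB _ (hu.1 n)).trans (by linarith [hT ⟨n, rfl⟩])
      have h3 : ENNReal.ofReal (-I) ≤ hartree β G (u n) := by
        rw [← ENNReal.ofReal_toReal (hartree_ne_top S (huk n))]
        apply ENNReal.ofReal_le_ofReal
        have h4 := hn₀ n hn
        rw [realEnergy] at h4
        have h5 : 0 ≤ (kinetic s (u n)).toReal := ENNReal.toReal_nonneg
        linarith
      obtain ⟨y, hy⟩ := hlow (u n) h1 h2 h3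
      exact ⟨y, fun _ => hy⟩
    · exact ⟨0, fun h => absurd h hn⟩
  choose y hy using hex
  refine ⟨y, fun φ hφ => ?_⟩
  -- A strictly increasing φ dominates the identity, so shifting the index by n₀ reaches only the
  -- range where the lower bound holds; the shift is carried along in the final subsequence.
  have hidx : ∀ k, n₀ ≤ φ (k + n₀) := fun k => (Nat.le_add_left _ _).trans hφ.le_apply
  set z := fun k => translate (y (φ (k + n₀))) (u (φ (k + n₀))) with hz
  have hzadm : ∀ k, z k ∈ admissible 𝕜 N s lam := fun k => by
    refine ⟨?_, ?_⟩
    · change kinetic s (translate _ _) < ∞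
      rw [kinetic_translate]
      exact (hu.1 _).1
    · rw [norm_translate]
      exact (hu.1 _).2
  have hzlim : Tendsto (fun k => realEnergy s β G (z k)) atTop (𝓝 I) := by
    have h1 := (hlim.comp hφ.tendsto_atTop).comp (tendsto_add_atTop_nat n₀)
    refine h1.congr fun k => ?_
    simp only [Function.comp_apply, realEnergy, hz, kinetic_translate, hartree_translate]
  obtain ⟨ψ, hψ, w, hw, hwI, hconv⟩ := exists_subseq_tendstoHs S hlam hI0 hI hzadm hzlim hc
    (R := R) (fun k => by
      rw [hz, lowPass_translate]
      exact hy _ (hidx k))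
  refine ⟨fun k => ψ k + n₀, fun i j hij => Nat.add_lt_add_right (hψ hij) n₀, w, ⟨hw, ?_⟩, hconv⟩
  rw [energy_eq_coe S hw.1.ne, hwI, hIg]

end compactness

end FracHartree

end

/-! ### Conclusion -/

theorem theorem1p2 (𝕜 : Type) [RCLike 𝕜] (N : ℕ) (s β : ℝ) (hs0 : 0 < s) (hs1 : s < 1)
    (hβ0 : 0 < β) (hβN : β < N) (hβs : (N : ℝ) - β ≤ 2 * s) (G : ℝ → ℝ)
    (hA0 : FracHartree.AssumptionA0 N s β G) (hA1 : FracHartree.AssumptionA1 N s β G)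
    (lam : ℝ) (hlam : 0 < lam) :
    ⊥ < FracHartree.groundEnergy 𝕜 N s β G lam ∧
    (∃ u : FracHartree.L2 𝕜 N, FracHartree.IsMinimizer s β G lam u) ∧
    ∀ u : ℕ → FracHartree.L2 𝕜 N, FracHartree.IsMinimizingSeq s β G lam u →
      ∃ y : ℕ → FracHartree.Rn N, ∀ φ : ℕ → ℕ, StrictMono φ →
        ∃ ψ : ℕ → ℕ, StrictMono ψ ∧ ∃ w : FracHartree.L2 𝕜 N,
          FracHartree.IsMinimizer s β G lam w ∧
          FracHartree.TendstoHs s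
            (fun k => FracHartree.translate (y (φ (ψ k))) (u (φ (ψ k)))) w := by
  obtain ⟨μ, r, η, S⟩ := FracHartree.exists_setting hs0 hβ0 hβN hA0 hA1
  obtain ⟨I, hI0, hIg, hI⟩ := FracHartree.groundEnergy_eq_coe 𝕜 S hs1 hA1 hlam
  refine ⟨?_, ?_, fun u hu => FracHartree.exists_translates S hlam hI0 hIg hI hu⟩
  · rw [hIg]
    exact EReal.bot_lt_coe I
  · obtain ⟨u, hu⟩ := FracHartree.exists_isMinimizingSeq S hIg
    obtain ⟨y, hy⟩ := FracHartree.exists_translates S hlam hI0 hIg hI hu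
    obtain ⟨ψ, -, w, hw, -⟩ := hy id strictMono_id
    exact ⟨w, hw⟩
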